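/- Let $n\ge 0$ be an integer, $0<t<1$, $\alpha\in\mathbb{C}$, and $\gamma=t^{\alpha}$, with $\gamma t^{2j}\ne 1$ for $1\le j\le n$. Let $s_0,s_1,s_2,\dots$ and $u_1,\dots,u_{2n}$ be complex numbers such that $1-s_xu_i\neq0$ for all $i,x$ and, for some $\varepsilon>0$, $$\left|\frac{u_i-s_x}{1-s_xu_i}\right|\le 1-\varepsilon\qquad\text{for all } i \text{ and all } x\ge 0 .$$ Assume that the $u_i$ are pairwise distinct and that $1-tu_iu_j\ne0$ for $i<j$. **Vertex weights.** For $i_1,i_2\in\mathbb{Z}_{\ge0}$, $j_1,j_2\in\{0,1\}$ and $\kappa\in\mathbb{C}$ let $w^{\kappa}_{u,s}(i_1,j_1;i_2,j_2)$ be zero unless $i_1+j_1=i_2+j_2$, and $$w^{\kappa}_{u,s}(g,0;g,0)=\frac{1-s\kappa t^{g}u}{1-su},\quad w^{\kappa}_{u,s}(g,1;g,1)=\frac{u-s\kappa t^{g}}{1-su},$$ $$w^{\kappa}_{u,s}(g+1,0;g,1)=\frac{(1-s^2\kappa t^{g})u}{1-su},\quad w^{\kappa}_{u,s}(g,1;g+1,0)=\frac{1-\kappa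 t^{g+1}}{1-su}.$$ For a signature $\lambda=(\lambda_1\ge\dots\ge\lambda_{N}\ge0)$ with multiplicities $m_i(\lambda)=\#\{k:\lambda_k=i\}$, let $F^{\alpha}_\lambda(u_1,\dots,u_{N})$ be the sum, over all ensembles of $N$ up-right lattice paths in $\mathbb{Z}_{\ge0}\times\{1,\dots,N\}$ such that exactly one path enters through the left edge of each row, each horizontal edge carries at most one path, the bottom boundary is empty, no path escapes to infinity on the right, and exactly $m_x(\lambda)$ paths leave through the top of column $x$ for every $x\ge0$, of the product over all vertices $(x,y)$ of the weights $w^{\kappa_x}_{u_y,s_x}(i_1,j_1;i_2,j_2)$. Here $i_1,j_1,i_2,j_2$ are the numbers of paths on the bottom, left, top and right edges of the vertex, $\kappa_0=\gamma$ (that is, the occupation numbers of column $0$ are shifted by $\alpha$), and $\kappa_x=1$ for $x\ge1$. **Partition function.** Consider the series $$\mathcal{P}(u_1,\dots,u_{2n};t,\alpha)=\sum_{\lambda}\ \prod_{j=1}^{m_0(\lambda)/2}\frac{1-s_0^2\gamma t^{2j-2}}{1-\gamma t^{2j}}\ \prod_{i\ge1}\prod_{j=1}^{m_i(\lambda)/2}\frac{1-s_i^2t^{2j-2}}{1-t^{2j}}\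 F^{\alpha}_\lambda(u_1,\dots,u_{2n}),$$ where $\lambda$ runs over the signatures with $2n$ parts all of whose multiplicities $m_i(\lambda)$, $i\ge0$, are even. **Theorem.** The series for $\mathcal{P}$ converges absolutely, and $$\mathcal{P}(u_1,\dots,u_{2n};t,\alpha)=\prod_{j=1}^{2n}\frac{1}{1-s_0u_j}\prod_{1\le i<j\le 2n}\frac{1-tu_iu_j}{u_i-u_j}\ \mathop{\rm Pf}_{1\le i<j\le 2n}\left[\frac{Z_2(u_i,u_j)(u_i-u_j)}{(1-u_iu_j)(1-tu_iu_j)}\right],$$ where $$Z_2(x,y)=(1-t)(1-\gamma s_0x)(1-\gamma s_0y)+(1-\gamma)(t-\gamma s_0^2)(1-xy).$$ -/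

import Mathlib

open scoped BigOperators

noncomputable section

namespace SpinHL

/-- The higher spin six vertex weight `w_{u,s}(i₁, j₁; i₂, j₂)`, for a column whose occupation
numbers are shifted by a constant: the numbers of vertical paths below and above the vertex are
`a + i₁` and `a + i₂`, and `κ = t ^ a` (so `t ^ (a + i) = κ * t ^ i`). The unshifted weights are
those with `κ = 1`. The horizontal edges to the left and to the right of the vertex are occupied
by at most one path each, as recorded by `j₁` and `j₂`. A vertex that violates the conservation
`i₁ + j₁ = i₂ + j₂` has weight `0`. -/
def vertexWeight (t κ s u : ℂ) : ℕ → Bool → ℕ → Bool → ℂ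
  | i₁, false, i₂, false =>
      if i₁ = i₂ then (1 - s * (κ * t ^ i₁) * u) / (1 - s * u) else 0
  | i₁, true, i₂, true =>
      if i₁ = i₂ then (u - s * (κ * t ^ i₁)) / (1 - s * u) else 0
  | i₁, false, i₂, true =>
      if i₁ = i₂ + 1 then (1 - s ^ 2 * (κ * t ^ i₂)) * u / (1 - s * u) else 0
  | i₁, true, i₂, false =>
      if i₁ + 1 = i₂ then (1 - κ * t ^ i₂) / (1 - s * u) else 0

/-- The factor `κ = t ^ a` of column `x`: only column `0` is shifted, with `γ = t ^ α`. -/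
def columnShift (γ : ℂ) (x : ℕ) : ℂ := if x = 0 then γ else 1

/-- The matrix element `⟨μ; α| T₊(u) |ν; α⟩` of the row transfer matrix, where `γ = t ^ α` and
`μ x`, `ν x` are the (unshifted) numbers of paths in column `x` below and above the row. It is the
sum, over the finite sets `H` of occupied horizontal edges, of the product of the vertex weights;
edge `x` is the one to the left of column `x`, so that edge `0` is the left boundary, which is
occupied. Finiteness of `H` says that no path escapes to the right. -/
def rowWeight (t γ : ℂ) (s : ℕ → ℂ) (u : ℂ) (μ ν : ℕ →₀ ℕ) : ℂ :=
  ∑ᶠ H : Finset ℕ,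
    if 0 ∈ H then
      ∏ᶠ x : ℕ, vertexWeight t (columnShift γ x) (s x) u
        (μ x) (decide (x ∈ H)) (ν x) (decide (x + 1 ∈ H))
    else 0

/-- `⟨0; α| T₊(u₁) ⋯ T₊(u_N) |ν; α⟩`, where `γ = t ^ α`: the partition function of the up-right path
ensembles in `N` rows with empty bottom boundary and top boundary `ν`. -/
def latticeF (t γ : ℂ) (s : ℕ → ℂ) : (N : ℕ) → (Fin N → ℂ) → (ℕ →₀ ℕ) → ℂ
  | 0, _, ν => if ν = 0 then 1 else 0
  | N + 1, u, ν =>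
      ∑ᶠ μ : ℕ →₀ ℕ,
        latticeF t γ s N (fun i => u i.castSucc) μ * rowWeight t γ s (u (Fin.last N)) μ ν

/-- The multiplicities `m_i` of the parts of a signature: `mult l i` is the number of `k` such that
`l k = i`. -/
def mult {N : ℕ} (l : Fin N → ℕ) : ℕ →₀ ℕ := ∑ k, Finsupp.single (l k) 1

/-- Signatures `l 0 ≥ l 1 ≥ ⋯ ≥ l (N - 1) ≥ 0` with all multiplicities even. -/
def EvenSignature (N : ℕ) : Type :=
  {l : Fin N → ℕ // Antitone l ∧ ∀ i, Even (mult l i)}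

/-- The `α`-refined spin Hall--Littlewood function `F^α_l(u₁, …, u_N)`. -/
def refinedF (t : ℝ) (α : ℂ) (s : ℕ → ℂ) {N : ℕ} (u : Fin N → ℂ) (l : Fin N → ℕ) : ℂ :=
  latticeF (t : ℂ) ((t : ℂ) ^ α) s N u (mult l)

/-- The coefficient of the state with (even) multiplicities `m`. -/
def evenCoeff (t : ℝ) (α : ℂ) (s : ℕ → ℂ) (m : ℕ →₀ ℕ) : ℂ :=
  (∏ j ∈ Finset.Icc 1 (m 0 / 2),
      (1 - s 0 ^ 2 * (t : ℂ) ^ α * (t : ℂ) ^ (2 * j - 2)) /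
        (1 - (t : ℂ) ^ α * (t : ℂ) ^ (2 * j))) *
    ∏ i ∈ m.support.erase 0, ∏ j ∈ Finset.Icc 1 (m i / 2),
      (1 - s i ^ 2 * (t : ℂ) ^ (2 * j - 2)) / (1 - (t : ℂ) ^ (2 * j))

/-- The summand of the partition function `𝒫(u₁, …, u_N; t, α)`. -/
def partitionTerm (t : ℝ) (α : ℂ) (s : ℕ → ℂ) {N : ℕ} (u : Fin N → ℂ) (l : EvenSignature N) : ℂ :=
  evenCoeff t α s (mult l.1) * refinedF t α s u l.1

/-- The partition function `𝒫(u₁, …, u_N; t, α)`. -/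
def partitionP (t : ℝ) (α : ℂ) (s : ℕ → ℂ) {N : ℕ} (u : Fin N → ℂ) : ℂ :=
  ∑' l : EvenSignature N, partitionTerm t α s u l

/-- The polynomial `Z₂(x, y)`, with `γ = t ^ α` and `s₀` the inhomogeneity of column `0`. -/
def Z₂ (t : ℝ) (α s₀ x y : ℂ) : ℂ :=
  (1 - t) * (1 - (t : ℂ) ^ α * s₀ * x) * (1 - (t : ℂ) ^ α * s₀ * y) +
    (1 - (t : ℂ) ^ α) * (t - (t : ℂ) ^ α * s₀ ^ 2) * (1 - x * y)

/-- The Pfaffian of a skew-symmetric `2n × 2n` matrix. -/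
def pfaffian {n : ℕ} (A : Matrix (Fin (2 * n)) (Fin (2 * n)) ℂ) : ℂ :=
  (1 / (2 ^ n * (n.factorial : ℂ))) *
    ∑ σ : Equiv.Perm (Fin (2 * n)), ((Equiv.Perm.sign σ : ℤ) : ℂ) *
      ∏ i : Fin n, A (σ ⟨2 * i, by omega⟩) (σ ⟨2 * i + 1, by omega⟩)

end SpinHL

end

open scoped BigOperators

noncomputable section

namespace SpinHL

/-! Rows are treated as operators on functions of the occupation numbers. The Yang–Baxter equation
yields exchange relations (`rowOp_exchange`): in unshifted columns occupied rows commute, and an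
empty row can be moved through a product of occupied ones as in the algebraic Bethe ansatz
(`rowOp_false_rowsSet`). Consequently the state created by rows with parameters `S` splits along its
first column into a sum over subsets `J ⊆ S`, the parameters that go on to the right
(`rowsOp_cons`). Only the first column is shifted, so what lies to its right depends on the set `J`
alone. Summation over even occupation numbers with the given coefficients then becomes a recursion
over columns, whose weights `columnWeight` are triangular with respect to inclusion.

On the other side, the product of the `(1 - t u_i u_j) / (u_i - u_j)` times the Pfaffian is a sum
over perfect matchings without signs (`pairProd_mul_pfaffian`, `matchingSum`). The two sides meet in
`columnSum_eq_matchingSum`: one column with shift `p`, applied to the matching sums with pair weight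
`(1 - t) / (1 - x y)`, produces the matching sum with numerator `shiftedNumerator`. For `p = 1` this
numerator factors as `(1 - t) (1 - s x) (1 - s y)`, so the constant numerator is a fixed point of
the unshifted recursion; for `p = γ` it is `Z₂`.

That identity is proved by induction, two variables at a time. As functions of one variable `x`,
both sides are rational with at most simple poles at the other variables `y` and at `y⁻¹`. There is
no pole at `x = y`, the residues at `y⁻¹` are known from fewer variables, and the degree bound makes
one further value sufficient. It comes from the pair of variables `p s`, `t p s`, for which both
sides lose two variables while `p` becomes `p t ^ 2` (`columnSum_special`, `matchingSum_special`).
Non-generic `s` are reached by continuity.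

For convergence, the diagonal weight of a nonempty set is a product of factors `(x - s) / (1 - s
x)`, hence at most `q < 1` in norm, and the other weights are bounded uniformly in `s`
(`exists_bound_columnWeight`). Induction over subsets bounds the absolute sums and gives geometric
convergence to the fixed point; the shifted column is then applied once. What remains is to identify
the lattice definition with the row operators and to exhaust the signatures by finite boxes. -/

/-- The spectral factor `(x - t y) / (x - y)`. -/
def hopFactor (t x y : ℂ) : ℂ := (x - t * y) / (x - y)

/-! ### Row operators and their exchange relations -/

/-- The row operator on functions of lists of occupation numbers, with left edge occupied according
to `b` and right edge empty; `κ` is the shift of the first column. -/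
def rowOp (t : ℂ) : ℂ → Bool → (ℕ → ℂ) → ℂ → (List ℕ → ℂ) → List ℕ → ℂ
  | _, b, _, _, φ, [] => if b then 0 else φ []
  | κ, false, s, u, φ, g :: ν =>
      (1 - s 0 * (κ * t ^ g) * u) / (1 - s 0 * u) *
          rowOp t 1 false (fun x => s (x + 1)) u (fun μ => φ (g :: μ)) ν +
        (1 - s 0 ^ 2 * (κ * t ^ g)) * u / (1 - s 0 * u) *
          rowOp t 1 true (fun x => s (x + 1)) u (fun μ => φ ((g + 1) :: μ)) ν
  | κ, true, s, u, φ, g :: ν =>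
      (u - s 0 * (κ * t ^ g)) / (1 - s 0 * u) *
          rowOp t 1 true (fun x => s (x + 1)) u (fun μ => φ (g :: μ)) ν +
        (if g = 0 then 0 else (1 - κ * t ^ g) / (1 - s 0 * u)) *
          rowOp t 1 false (fun x => s (x + 1)) u (fun μ => φ ((g - 1) :: μ)) ν

/-- `rowOp` is linear. -/
theorem rowOp_add (t κ : ℂ) (b : Bool) (s : ℕ → ℂ) (u : ℂ) (φ ψ : List ℕ → ℂ) (ν : List ℕ) :
    rowOp t κ b s u (fun μ => φ μ + ψ μ) ν = rowOp t κ b s u φ ν + rowOp t κ b s u ψ ν := by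
  induction ν generalizing κ b s φ ψ with
  | nil => cases b <;> simp [rowOp]
  | cons g ν ih => cases b <;> simp only [rowOp, ih] <;> ring

theorem rowOp_mul (t κ : ℂ) (b : Bool) (s : ℕ → ℂ) (u c : ℂ) (φ : List ℕ → ℂ) (ν : List ℕ) :
    rowOp t κ b s u (fun μ => c * φ μ) ν = c * rowOp t κ b s u φ ν := by
  induction ν generalizing κ b s φ with
  | nil => cases b <;> simp [rowOp]
  | cons g ν ih => cases b <;> simp only [rowOp, ih] <;> ring

theorem rowOp_sum {ι : Type*} (t κ : ℂ) (b : Bool) (s : ℕ → ℂ) (u : ℂ) (A : Finset ι)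
    (c : ι → ℂ) (φ : ι → List ℕ → ℂ) (ν : List ℕ) :
    rowOp t κ b s u (fun μ => ∑ i ∈ A, c i * φ i μ) ν = ∑ i ∈ A, c i * rowOp t κ b s u (φ i) ν := by
  classical
  induction A using Finset.induction_on with
  | empty => simpa using rowOp_mul t κ b s u 0 (fun _ => 0) ν
  | insert a A ha ih =>
    simp only [Finset.sum_insert ha]
    rw [rowOp_add, rowOp_mul, ih]

/-- The exchange relations of two rows, which follow from the Yang--Baxter equation. -/
theorem rowOp_exchange (t : ℂ) (u v : ℂ) (huv : u ≠ v) (s : ℕ → ℂ) (φ : List ℕ → ℂ) (ν : List ℕ) :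
    rowOp t 1 true s u (rowOp t 1 true s v φ) ν = rowOp t 1 true s v (rowOp t 1 true s u φ) ν ∧
    rowOp t 1 false s u (rowOp t 1 false s v φ) ν =
      rowOp t 1 false s v (rowOp t 1 false s u φ) ν ∧
    (u - v) * rowOp t 1 false s v (rowOp t 1 true s u φ) ν =
      (u - t * v) * rowOp t 1 true s u (rowOp t 1 false s v φ) ν -
        (1 - t) * v * rowOp t 1 true s v (rowOp t 1 false s u φ) ν ∧
    (v - u) * rowOp t 1 false s u (rowOp t 1 true s v φ) ν =
      (v - t * u) * rowOp t 1 true s v (rowOp t 1 false s u φ) ν -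
        (1 - t) * u * rowOp t 1 true s u (rowOp t 1 false s v φ) ν := by
  have huv' : u - v ≠ 0 := sub_ne_zero.mpr huv
  induction ν generalizing s φ with
  | nil => simp [rowOp]
  | cons g ν ih =>
    have key := fun i => ih (fun x => s (x + 1)) (fun μ => φ (i :: μ))
    have k1 := fun i => (key i).1
    have k2 := fun i => (key i).2.1
    have k3 := fun i => eq_div_of_mul_eq huv' ((mul_comm _ _).trans (key i).2.2.1)
    have k4 := fun i => eq_div_of_mul_eq (sub_ne_zero.mpr huv.symm)
      ((mul_comm _ _).trans (key i).2.2.2)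
    have e : v - u = -(u - v) := by ring
    simp only [e] at k4 ⊢
    -- Two occupied rows remove up to two paths from the column, and `rowOp` has a separate value at
    -- occupation zero, so occupations 0 and 1 are treated apart.
    rcases g with _ | _ | g
    all_goals
      simp only [rowOp, rowOp_add, rowOp_mul, k1, k2, k3, k4, div_eq_mul_inv _ (1 - s 0 * _),
        if_pos, zero_mul, add_zero, Nat.add_eq_zero_iff, one_ne_zero, and_false, if_false,
        Nat.add_sub_cancel, zero_add, mul_one, one_mul, pow_zero, pow_succ]
      refine ⟨?_, ?_, ?_, ?_⟩
    all_goals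
      -- Each row contributes exactly one of these inverses to every term, so they act as free
      -- symbols and need not come from nonzero denominators.
      generalize (1 - s 0 * u)⁻¹ = d₁
      generalize (1 - s 0 * v)⁻¹ = d₂
      field_simp <;> ring

theorem rowOp_true_comm (t : ℂ) (s : ℕ → ℂ) (u v : ℂ) (φ : List ℕ → ℂ) :
    rowOp t 1 true s u (rowOp t 1 true s v φ) = rowOp t 1 true s v (rowOp t 1 true s u φ) := by
  rcases eq_or_ne u v with rfl | h
  · rfl
  · exact funext fun ν => (rowOp_exchange t u v h s φ ν).1

/-- Moving an empty row through an occupied one. -/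
theorem rowOp_false_true (t : ℂ) (s : ℕ → ℂ) (u v : ℂ) (h : u ≠ v) (φ : List ℕ → ℂ)
    (ν : List ℕ) :
    rowOp t 1 false s v (rowOp t 1 true s u φ) ν =
      hopFactor t u v * rowOp t 1 true s u (rowOp t 1 false s v φ) ν +
        (1 - t) * v / (v - u) * rowOp t 1 true s v (rowOp t 1 false s u φ) ν := by
  have h1 : u - v ≠ 0 := sub_ne_zero.mpr h
  have h2 : v - u ≠ 0 := sub_ne_zero.mpr h.symm
  refine mul_left_cancel₀ h1 ((rowOp_exchange t u v h s φ ν).2.2.1.trans ?_)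
  rw [hopFactor]
  field_simp
  ring

/-! ### States created by occupied rows, and the action of an empty row on them -/

/-- The indicator of the empty state. -/
def emptyState : List ℕ → ℂ
  | [] => 1
  | g :: ν => if g = 0 then emptyState ν else 0

theorem rowOp_zero (t κ : ℂ) (b : Bool) (s : ℕ → ℂ) (u : ℂ) (ν : List ℕ) :
    rowOp t κ b s u (fun _ => 0) ν = 0 := by
  simpa using rowOp_mul t κ b s u 0 (fun _ => 0) ν

theorem rowOp_false_emptyState (t : ℂ) (s : ℕ → ℂ) (u : ℂ) (h : ∀ x, 1 - s x * u ≠ 0) :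
    rowOp t 1 false s u emptyState = emptyState := by
  funext ν
  induction ν generalizing s with
  | nil => simp [rowOp]
  | cons g ν ih =>
    have ih' := ih (fun x => s (x + 1)) (fun x => h (x + 1))
    rcases g with _ | g
    · simp only [rowOp, emptyState, if_true, Nat.add_eq_zero_iff, one_ne_zero, and_false, if_false,
        rowOp_zero, mul_zero, add_zero, pow_zero, mul_one]
      rw [div_self (h 0), one_mul]
      exact ih'
    · simp [rowOp, emptyState, rowOp_zero]

/-- The state produced from the empty one by occupied rows; the head of the list is the top row. -/
def rowsOp (t κ : ℂ) (s : ℕ → ℂ) (us : List ℂ) : List ℕ → ℂ :=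
  us.foldr (fun u φ => rowOp t κ true s u φ) emptyState

/-- Commutation makes folding over a multiset well defined; this is what allows states to be indexed
by sets of parameters. -/
instance leftCommutative_rowOp (t : ℂ) (s : ℕ → ℂ) :
    LeftCommutative (fun u φ => rowOp t 1 true s u φ) :=
  ⟨fun u v φ => rowOp_true_comm t s u v φ⟩

/-- The state produced from the empty one by occupied rows in unshifted columns. -/
def rowsSet (t : ℂ) (s : ℕ → ℂ) (K : Finset ℂ) : List ℕ → ℂ :=
  K.val.foldr (fun u φ => rowOp t 1 true s u φ) emptyState

theorem rowsSet_empty (t : ℂ) (s : ℕ → ℂ) : rowsSet t s ∅ = emptyState := rfl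

theorem rowsSet_insert (t : ℂ) (s : ℕ → ℂ) {K : Finset ℂ} {v : ℂ} (h : v ∉ K) :
    rowsSet t s (insert v K) = rowOp t 1 true s v (rowsSet t s K) := by
  rw [rowsSet, Finset.insert_val_of_notMem h, Multiset.foldr_cons, rowsSet]

theorem rowsOp_one (t : ℂ) (s : ℕ → ℂ) (us : List ℂ) (h : us.Nodup) :
    rowsOp t 1 s us = rowsSet t s us.toFinset := by
  induction us with
  | nil => rfl
  | cons v us ih =>
    rw [List.nodup_cons] at h
    rw [List.toFinset_cons, rowsSet_insert t s (by simpa using h.1), ← ih h.2]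
    rfl

/-- The action of an empty row on a state with occupied rows. -/
theorem rowOp_false_rowsSet (t : ℂ) (s : ℕ → ℂ) (K : Finset ℂ) (v : ℂ) (hv : v ∉ K)
    (hK : ∀ k ∈ insert v K, ∀ x, 1 - s x * k ≠ 0) (ν : List ℕ) :
    rowOp t 1 false s v (rowsSet t s K) ν = (∏ i ∈ K, hopFactor t i v) * rowsSet t s K ν +
      ∑ i ∈ K, ((1 - t) * v / (v - i) * ∏ k ∈ K.erase i, hopFactor t k i) *
        rowOp t 1 true s v (rowsSet t s (K.erase i)) ν := by
  induction K using Finset.induction_on generalizing v ν with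
  | empty =>
    rw [rowsSet_empty, rowOp_false_emptyState t s v (hK v (by simp))]
    simp
  | insert r K hr ih =>
    have hrv : r ≠ v := fun h => hv (h ▸ Finset.mem_insert_self _ _)
    have hvK : v ∉ K := fun h => hv (Finset.mem_insert_of_mem h)
    have e1 := funext fun ν => ih v hvK (fun k hk => hK k (by
      simp only [Finset.mem_insert] at hk ⊢; tauto)) ν
    have e2 := funext fun ν => ih r hr (fun k hk => hK k (by
      simp only [Finset.mem_insert] at hk ⊢; tauto)) ν
    rw [rowsSet_insert t s hr, rowOp_false_true t s r v hrv, e1, e2]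
    simp only [rowOp_add, rowOp_mul, rowOp_sum]
    rw [Finset.prod_insert hr, Finset.sum_insert hr, Finset.erase_insert hr]
    -- The parameter `i` ends up in the empty row in two ways: `v` passes `r` and is then exchanged
    -- with `i`, or `v` is exchanged with `r`, which is then exchanged with `i`. A three-term
    -- identity of partial fractions merges the two coefficients.
    have e3 : ∀ i ∈ K, ((1 - t) * v / (v - i) * ∏ k ∈ (insert r K).erase i, hopFactor t k i) *
        rowOp t 1 true s v (rowsSet t s ((insert r K).erase i)) ν =
        hopFactor t r v * (((1 - t) * v / (v - i) * ∏ k ∈ K.erase i, hopFactor t k i) *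
          rowOp t 1 true s r (rowOp t 1 true s v (rowsSet t s (K.erase i))) ν) +
        (1 - t) * v / (v - r) * (((1 - t) * r / (r - i) * ∏ k ∈ K.erase i, hopFactor t k i) *
          rowOp t 1 true s v (rowOp t 1 true s r (rowsSet t s (K.erase i))) ν) := by
      intro i hi
      have hir : i ≠ r := fun h => hr (h ▸ hi)
      have hiv : i ≠ v := fun h => hvK (h ▸ hi)
      have hr' : r ∉ K.erase i := fun h => hr (Finset.mem_of_mem_erase h)
      rw [Finset.erase_insert_of_ne hir.symm, Finset.prod_insert hr', rowsSet_insert t s hr',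
        rowOp_true_comm t s r v]
      have a1 : r - i ≠ 0 := sub_ne_zero.mpr hir.symm
      have a2 : v - i ≠ 0 := sub_ne_zero.mpr hiv.symm
      have a3 : r - v ≠ 0 := sub_ne_zero.mpr hrv
      have a4 : v - r ≠ 0 := sub_ne_zero.mpr hrv.symm
      have : (1 - t) * v / (v - i) * hopFactor t r i = hopFactor t r v * ((1 - t) * v / (v - i)) +
          (1 - t) * v / (v - r) * ((1 - t) * r / (r - i)) := by
        simp only [hopFactor]
        field_simp
        ring
      linear_combination (∏ k ∈ K.erase i, hopFactor t k i) *
        rowOp t 1 true s v (rowOp t 1 true s r (rowsSet t s (K.erase i))) ν * this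
    rw [Finset.sum_congr rfl e3, Finset.sum_add_distrib, ← Finset.mul_sum, ← Finset.mul_sum]
    ring

/-- This is the partial fraction expansion in `v` of the right-hand side: both sides have the same
residues at the points of `I`, the same leading growth `v` at infinity and the value `-a t ^ |I|` at
`v = 0`. The induction replaces this argument by a three-term identity. -/
theorem sum_hopFactor (t a : ℂ) (I : Finset ℂ) (v : ℂ) (hv : v ∉ I) :
    (v - a * t ^ I.card) +
      ∑ i ∈ I, (i - a) * (∏ j ∈ I.erase i, hopFactor t i j) * ((1 - t) * v / (v - i)) =
    (v - a) * ∏ j ∈ I, hopFactor t v j := by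
  induction I using Finset.induction_on generalizing v with
  | empty => simp
  | insert r I hr ih =>
    have hrv : r ≠ v := fun h => hv (h ▸ Finset.mem_insert_self _ _)
    have hvI : v ∉ I := fun h => hv (Finset.mem_insert_of_mem h)
    have a3 : r - v ≠ 0 := sub_ne_zero.mpr hrv
    have a4 : v - r ≠ 0 := sub_ne_zero.mpr hrv.symm
    rw [Finset.prod_insert hr, Finset.sum_insert hr, Finset.erase_insert hr,
      Finset.card_insert_of_notMem hr]
    have e3 : ∀ i ∈ I, (i - a) * (∏ j ∈ (insert r I).erase i, hopFactor t i j) *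
        ((1 - t) * v / (v - i)) =
        hopFactor t v r * ((i - a) * (∏ j ∈ I.erase i, hopFactor t i j) *
          ((1 - t) * v / (v - i))) -
        (1 - t) * v / (v - r) * ((i - a) * (∏ j ∈ I.erase i, hopFactor t i j) *
          ((1 - t) * r / (r - i))) := by
      intro i hi
      have hir : i ≠ r := fun h => hr (h ▸ hi)
      have hiv : i ≠ v := fun h => hvI (h ▸ hi)
      have hr' : r ∉ I.erase i := fun h => hr (Finset.mem_of_mem_erase h)
      rw [Finset.erase_insert_of_ne hir.symm, Finset.prod_insert hr']
      have a1 : r - i ≠ 0 := sub_ne_zero.mpr hir.symm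
      have a1' : i - r ≠ 0 := sub_ne_zero.mpr hir
      have a2 : v - i ≠ 0 := sub_ne_zero.mpr hiv.symm
      have : hopFactor t i r * ((1 - t) * v / (v - i)) = hopFactor t v r * ((1 - t) * v / (v - i)) -
          (1 - t) * v / (v - r) * ((1 - t) * r / (r - i)) := by
        simp only [hopFactor]
        field_simp
        ring
      linear_combination (i - a) * (∏ j ∈ I.erase i, hopFactor t i j) * this
    rw [Finset.sum_congr rfl e3, Finset.sum_sub_distrib, ← Finset.mul_sum, ← Finset.mul_sum]
    have h1 := ih v hvI
    have h2 := ih r hr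
    have : v - a * t ^ (I.card + 1) = hopFactor t v r * (v - a * t ^ I.card) -
        (1 - t) * v / (v - r) * (r - a * t ^ I.card) := by
      simp only [hopFactor]
      field_simp
      ring
    rw [this]
    linear_combination hopFactor t v r * h1 - (1 - t) * v / (v - r) * h2

/-! ### Branching with respect to the first column -/

/-- The weight of the configurations of a single column in which, in terms of sets of spectral
parameters, the paths `S` enter from the left, the paths `J` leave to the right and the remaining
ones stay in the column. -/
def columnKernel (t κ s₀ : ℂ) (S J : Finset ℂ) : ℂ :=
  (∏ j ∈ Finset.range (S \ J).card, (1 - κ * t ^ (j + 1))) * (∏ x ∈ S, (1 - s₀ * x)⁻¹) *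
    (∏ x ∈ J, (x - κ * s₀)) * ∏ i ∈ J, ∏ j ∈ S \ J, hopFactor t i j

theorem columnKernel_insert_left (t κ s₀ : ℂ) {S J : Finset ℂ} (hJ : J ⊆ S) {v : ℂ} (hv : v ∉ S) :
    columnKernel t κ s₀ (insert v S) J =
      (1 - κ * t ^ ((S \ J).card + 1)) / (1 - s₀ * v) * columnKernel t κ s₀ S J *
        ∏ i ∈ J, hopFactor t i v := by
  have hvJ : v ∉ J := fun h => hv (hJ h)
  have hv' : v ∉ S \ J := fun h => hv (Finset.mem_sdiff.mp h).1
  rw [columnKernel, columnKernel, Finset.insert_sdiff_of_notMem _ hvJ,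
    Finset.card_insert_of_notMem hv', Finset.prod_range_succ, Finset.prod_insert hv]
  simp only [Finset.prod_insert hv', Finset.prod_mul_distrib]
  ring

/-- The new parameter `v` continues to the right either because its row crosses the column with its
right edge occupied, or because its row leaves the column empty and `v` is then exchanged with some
`i`. With the common factor `columnKernel t κ s₀ S K` pulled out, the claim is `sum_hopFactor` for
`a = κ * s₀`. -/
theorem columnKernel_insert_right (t κ s₀ : ℂ) {S K : Finset ℂ} (hK : K ⊆ S) {v : ℂ}
    (hv : v ∉ S) :
    columnKernel t κ s₀ (insert v S) (insert v K) =
      (v - s₀ * (κ * t ^ (S \ K).card)) / (1 - s₀ * v) * columnKernel t κ s₀ S K +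
        ∑ i ∈ S \ K, (1 - κ * t ^ (S \ K).card) / (1 - s₀ * v) *
          (columnKernel t κ s₀ S (insert i K) *
            ((1 - t) * v / (v - i) * ∏ k ∈ K, hopFactor t k i)) := by
  have hvK : v ∉ K := fun h => hv (hK h)
  have hv' : v ∉ S \ K := fun h => hv (Finset.mem_sdiff.mp h).1
  have e0 : insert v S \ insert v K = S \ K := by
    ext x
    simp only [Finset.mem_sdiff, Finset.mem_insert]
    constructor
    · tauto
    · rintro ⟨h1, h2⟩
      exact ⟨Or.inr h1, fun h => h.elim (fun h => hv (h ▸ h1)) h2⟩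
  have e1 : ∀ i ∈ S \ K, (1 - κ * t ^ (S \ K).card) / (1 - s₀ * v) *
      (columnKernel t κ s₀ S (insert i K) *
        ((1 - t) * v / (v - i) * ∏ k ∈ K, hopFactor t k i)) =
      columnKernel t κ s₀ S K / (1 - s₀ * v) *
        ((i - κ * s₀) * (∏ j ∈ (S \ K).erase i, hopFactor t i j) *
          ((1 - t) * v / (v - i))) := by
    intro i hi
    have hiK : i ∉ K := (Finset.mem_sdiff.mp hi).2
    have e2 : S \ insert i K = (S \ K).erase i := by
      rw [Finset.sdiff_insert]
    have e3 : (S \ K).card = ((S \ K).erase i).card + 1 := (Finset.card_erase_add_one hi).symm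
    have e4 : ∀ k, ∏ j ∈ S \ K, hopFactor t k j =
        hopFactor t k i * ∏ j ∈ (S \ K).erase i, hopFactor t k j := fun k =>
      (Finset.mul_prod_erase _ _ hi).symm
    rw [columnKernel, columnKernel, e2, e3, Finset.prod_range_succ, Finset.prod_insert hiK,
      Finset.prod_insert hiK]
    simp only [e4, Finset.prod_mul_distrib]
    ring
  rw [Finset.sum_congr rfl e1, ← Finset.mul_sum]
  have key := sum_hopFactor t (κ * s₀) (S \ K) v hv'
  have e5 : columnKernel t κ s₀ (insert v S) (insert v K) =
      columnKernel t κ s₀ S K / (1 - s₀ * v) *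
        ((v - κ * s₀) * ∏ j ∈ S \ K, hopFactor t v j) := by
    rw [columnKernel, columnKernel, e0, Finset.prod_insert hv, Finset.prod_insert hvK,
      Finset.prod_insert hvK]
    ring
  rw [e5, ← key]
  ring

/-- Summation over a subset and one of its elements, reorganized by the remaining elements. -/
theorem sum_powerset_sum_mem {M : Type*} [AddCommMonoid M] (S : Finset ℂ)
    (F : Finset ℂ → ℂ → M) :
    ∑ J ∈ S.powerset, ∑ i ∈ J, F J i = ∑ K ∈ S.powerset, ∑ i ∈ S \ K, F (insert i K) i := by
  rw [Finset.sum_sigma', Finset.sum_sigma']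
  refine Finset.sum_bij' (fun p _ => ⟨p.1.erase p.2, p.2⟩) (fun p _ => ⟨insert p.2 p.1, p.2⟩)
    ?_ ?_ ?_ ?_ ?_
  · rintro ⟨J, i⟩ h
    simp only [Finset.mem_sigma, Finset.mem_powerset, Finset.mem_sdiff] at h ⊢
    exact ⟨(Finset.erase_subset _ _).trans h.1, h.1 h.2, Finset.notMem_erase _ _⟩
  · rintro ⟨K, i⟩ h
    simp only [Finset.mem_sigma, Finset.mem_powerset, Finset.mem_sdiff] at h ⊢
    exact ⟨Finset.insert_subset h.2.1 h.1, Finset.mem_insert_self _ _⟩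
  · rintro ⟨J, i⟩ h
    simp only [Finset.mem_sigma] at h
    simp [Finset.insert_erase h.2]
  · rintro ⟨K, i⟩ h
    simp only [Finset.mem_sigma, Finset.mem_sdiff] at h
    simp [Finset.erase_insert h.2.2]
  · rintro ⟨J, i⟩ h
    simp only [Finset.mem_sigma] at h
    simp [Finset.insert_erase h.2]

/-- Branching of the state produced by occupied rows with respect to the first column. -/
theorem rowsOp_cons (t κ : ℂ) (s : ℕ → ℂ) (us : List ℂ) (hus : us.Nodup)
    (h : ∀ u ∈ us, ∀ x, 1 - s x * u ≠ 0) (k : ℕ) (ν : List ℕ) :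
    rowsOp t κ s us (k :: ν) = ∑ J ∈ us.toFinset.powerset,
      if (us.toFinset \ J).card = k then
        columnKernel t κ (s 0) us.toFinset J * rowsSet t (fun x => s (x + 1)) J ν
      else 0 := by
  induction us generalizing k ν with
  | nil =>
    have : rowsOp t κ s [] (k :: ν) = if k = 0 then emptyState ν else 0 := rfl
    rw [this]
    simp [columnKernel, rowsSet_empty, eq_comm]
  | cons v us ih =>
    rw [List.nodup_cons] at hus
    have ih' := ih hus.2 (fun u hu => h u (List.mem_cons_of_mem _ hu))
    have hv : v ∉ us.toFinset := by simpa using hus.1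
    rw [List.toFinset_cons, Finset.sum_powerset_insert hv]
    have e0 : rowsOp t κ s (v :: us) (k :: ν) = rowOp t κ true s v (rowsOp t κ s us) (k :: ν) := rfl
    have hS : ∀ J ∈ us.toFinset.powerset, ∀ k ∈ insert v J, ∀ x, 1 - s (x + 1) * k ≠ 0 := by
      intro J hJ k hk x
      rcases Finset.mem_insert.mp hk with rfl | hk
      · exact h _ (by simp) _
      · exact h k (List.mem_cons_of_mem _ (by simpa using Finset.mem_powerset.mp hJ hk)) _
    generalize us.toFinset = S at *
    rw [e0, rowOp]
    simp only [ih']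
    have ite_eq : ∀ (J : Finset ℂ) (m : ℕ) (μ : List ℕ), (if (S \ J).card = m then
        columnKernel t κ (s 0) S J * rowsSet t (fun x => s (x + 1)) J μ else 0) =
        (if (S \ J).card = m then columnKernel t κ (s 0) S J else 0) *
          rowsSet t (fun x => s (x + 1)) J μ := by
      intro J m μ
      split_ifs <;> simp
    simp only [ite_eq, rowOp_sum]
    -- If the row of `v` leaves the column empty, `rowOp_false_rowsSet` moves it through the rows of
    -- `J`: either `J` survives unchanged, or `v` takes the place of some `i ∈ J`.
    have e1 : ∀ J ∈ S.powerset, (if k = 0 then 0 else (1 - κ * t ^ k) / (1 - s 0 * v)) *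
        ((if (S \ J).card = k - 1 then columnKernel t κ (s 0) S J else 0) *
          rowOp t 1 false (fun x => s (x + 1)) v (rowsSet t (fun x => s (x + 1)) J) ν) =
        (if (S \ J).card + 1 = k then columnKernel t κ (s 0) (insert v S) J else 0) *
          rowsSet t (fun x => s (x + 1)) J ν +
        ∑ i ∈ J, (if (S \ J).card + 1 = k then (1 - κ * t ^ k) / (1 - s 0 * v) *
          (columnKernel t κ (s 0) S J *
            ((1 - t) * v / (v - i) * ∏ k ∈ J.erase i, hopFactor t k i)) else 0) *
          rowOp t 1 true (fun x => s (x + 1)) v (rowsSet t (fun x => s (x + 1)) (J.erase i)) ν := by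
      intro J hJ
      have hvJ : v ∉ J := fun h => hv (Finset.mem_powerset.mp hJ h)
      rcases k with _ | k
      · simp
      · simp only [Nat.add_eq_zero_iff, one_ne_zero, and_false, if_false, Nat.add_sub_cancel,
          Nat.add_right_cancel_iff]
        split_ifs with hk
        · rw [rowOp_false_rowsSet t _ J v hvJ (hS J hJ),
            columnKernel_insert_left t κ (s 0) (Finset.mem_powerset.mp hJ) hv, hk, mul_add, mul_add,
            Finset.mul_sum, Finset.mul_sum]
          congr 1
          · ring
          · exact Finset.sum_congr rfl fun i _ => by ring
        · simp
    -- The exchanged terms are collected by `K = J.erase i`, so that they join the subsets of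
    -- `insert v S` that contain `v`; the unchanged ones are the subsets without `v`.
    rw [Finset.mul_sum, Finset.mul_sum, Finset.sum_congr rfl e1, Finset.sum_add_distrib,
      sum_powerset_sum_mem, add_left_comm, ← Finset.sum_add_distrib]
    congr 1
    · refine Finset.sum_congr rfl fun J hJ => ?_
      have hvJ : v ∉ J := fun h => hv (Finset.mem_powerset.mp hJ h)
      have hv' : v ∉ S \ J := fun h => hv (Finset.mem_sdiff.mp h).1
      rw [Finset.insert_sdiff_of_notMem _ hvJ, Finset.card_insert_of_notMem hv', ite_mul, zero_mul]
    · refine Finset.sum_congr rfl fun K hK => ?_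
      have hKS := Finset.mem_powerset.mp hK
      have hvK : v ∉ K := fun h => hv (hKS h)
      have e2 : insert v S \ insert v K = S \ K := by
        ext x
        simp only [Finset.mem_sdiff, Finset.mem_insert]
        constructor
        · tauto
        · rintro ⟨h1, h2⟩
          exact ⟨Or.inr h1, fun h => h.elim (fun h => hv (h ▸ h1)) h2⟩
      rw [e2, rowsSet_insert _ _ hvK, columnKernel_insert_right t κ (s 0) hKS hv]
      have e3 : ∀ i ∈ S \ K, (if (S \ insert i K).card + 1 = k then
          (1 - κ * t ^ k) / (1 - s 0 * v) * (columnKernel t κ (s 0) S (insert i K) *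
            ((1 - t) * v / (v - i) * ∏ k ∈ (insert i K).erase i, hopFactor t k i)) else 0) *
          rowOp t 1 true (fun x => s (x + 1)) v
            (rowsSet t (fun x => s (x + 1)) ((insert i K).erase i)) ν =
          (if (S \ K).card = k then (1 - κ * t ^ (S \ K).card) / (1 - s 0 * v) *
            (columnKernel t κ (s 0) S (insert i K) *
              ((1 - t) * v / (v - i) * ∏ k ∈ K, hopFactor t k i)) else 0) *
          rowOp t 1 true (fun x => s (x + 1)) v (rowsSet t (fun x => s (x + 1)) K) ν := by
        intro i hi
        rw [Finset.erase_insert (Finset.mem_sdiff.mp hi).2, Finset.sdiff_insert,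
          Finset.card_erase_add_one hi]
        split_ifs with hk
        · rw [hk]
        · rfl
      rw [Finset.sum_congr rfl e3, ← Finset.sum_mul]
      split_ifs with hk
      · rw [hk]
        ring
      · simp

/-! ### Sums over perfect matchings without signs -/

section PairSum

variable {ι : Type*} [DecidableEq ι]

/-- The average over the choices of the first pair in the expansion of a Pfaffian-like sum over
perfect matchings with pair weights `m` and interaction factors `c`. -/
def pairSumAux (m c : ι → ι → ℂ) : ℕ → Finset ι → ℂ
  | 0, S => if S = ∅ then 1 else 0
  | n + 1, S => (1 / (2 * (n + 1))) * ∑ x ∈ S, ∑ y ∈ S.erase x,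
      m x y * (∏ z ∈ (S.erase x).erase y, c x z * c y z) *
        pairSumAux m c n ((S.erase x).erase y)

/-- The sum over perfect matchings of `S` of the product of the weights `m x y` of the pairs and of
the factors `c x z` for `x`, `z` in different pairs; it is the Pfaffian of `m / c` times the product
of all `c x y`. It vanishes if `S` has odd cardinality. -/
def pairSum (m c : ι → ι → ℂ) (S : Finset ι) : ℂ := pairSumAux m c (S.card / 2) S

theorem sum_erase_comm {M : Type*} [AddCommMonoid M] (R : Finset ι) (F : ι → ι → M) :
    ∑ y ∈ R, ∑ w ∈ R.erase y, F y w = ∑ y ∈ R, ∑ w ∈ R.erase y, F w y := by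
  refine Finset.sum_comm' fun x y => ?_
  simp only [Finset.mem_erase]
  tauto

theorem pairSumAux_odd (m c : ι → ι → ℂ) (n : ℕ) (S : Finset ι) (hS : S.card ≠ 2 * n) :
    pairSumAux m c n S = 0 := by
  induction n generalizing S with
  | zero =>
    rw [pairSumAux, if_neg]
    rintro rfl
    simp at hS
  | succ n ih =>
    rw [pairSumAux]
    refine mul_eq_zero_of_right _ (Finset.sum_eq_zero fun x hx => Finset.sum_eq_zero fun y hy => ?_)
    rw [ih, mul_zero]
    have h1 := Finset.card_erase_add_one hx
    have h2 := Finset.card_erase_add_one hy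
    omega

variable {m c : ι → ι → ℂ} (hm : ∀ x y, m x y = m y x) (hc : ∀ x y, c x y = -c y x)

include hm hc

/-- The expansion does not depend on the chosen element: expanding along `x` and then along `x'`
gives the same double sum as in the opposite order, since the signs of the antisymmetric `c` cancel
in pairs. The definition averages `2 n + 2` equal expansions. -/
theorem pairSumAux_succ (n : ℕ) (S : Finset ι) (hS : S.card = 2 * n + 2) (x : ι) (hx : x ∈ S) :
    pairSumAux m c (n + 1) S = ∑ y ∈ S.erase x,
      m x y * (∏ z ∈ (S.erase x).erase y, c x z * c y z) *
        pairSumAux m c n ((S.erase x).erase y) := by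
  induction n using Nat.strong_induction_on generalizing S x with
  | _ n ih =>
  have key : ∀ x' ∈ S, ∑ y ∈ S.erase x',
      m x' y * (∏ z ∈ (S.erase x').erase y, c x' z * c y z) *
        pairSumAux m c n ((S.erase x').erase y) = ∑ y ∈ S.erase x,
      m x y * (∏ z ∈ (S.erase x).erase y, c x z * c y z) *
        pairSumAux m c n ((S.erase x).erase y) := by
    have expand : ∀ x ∈ S, ∀ x' ∈ S.erase x, ∑ y ∈ S.erase x,
        m x y * (∏ z ∈ (S.erase x).erase y, c x z * c y z) *
        pairSumAux m c n ((S.erase x).erase y) =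
        m x x' * (∏ z ∈ (S.erase x).erase x', c x z * c x' z) *
          pairSumAux m c n ((S.erase x).erase x') +
        ∑ y ∈ (S.erase x).erase x', ∑ w ∈ ((S.erase x).erase x').erase y,
          m x y * m x' w * (c x x' * c y x' * (c x w * c y w)) *
            (∏ z ∈ (((S.erase x).erase x').erase y).erase w, c x z * c y z * (c x' z * c w z)) *
            pairSumAux m c (n - 1) ((((S.erase x).erase x').erase y).erase w) := by
      intro x hx x' hx'
      rw [← Finset.add_sum_erase _ _ hx']
      congr 1
      refine Finset.sum_congr rfl fun y hy => ?_
      have h1 := Finset.card_erase_add_one hx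
      have h2 := Finset.card_erase_add_one hx'
      have h3 := Finset.card_erase_add_one hy
      have hyx' := Finset.mem_erase.mp hy
      have h4 := Finset.card_erase_add_one hyx'.2
      have hx'' : x' ∈ (S.erase x).erase y := Finset.mem_erase.mpr ⟨hyx'.1.symm, hx'⟩
      -- The elements `x`, `x'`, `y` of `S` are distinct, so `n` is positive; for `n = 0` the double
      -- sum is empty and the truncated `n - 1` plays no role.
      obtain ⟨k, rfl⟩ : ∃ k, n = k + 1 := ⟨n - 1, by omega⟩
      rw [ih k (by omega) _ (by omega) x' hx'', Finset.mul_sum, Nat.add_sub_cancel,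
        Finset.erase_right_comm (a := y)]
      refine Finset.sum_congr rfl fun w hw => ?_
      rw [← Finset.mul_prod_erase _ _ hx'', Finset.erase_right_comm (a := y),
        ← Finset.mul_prod_erase _ _ hw]
      simp only [Finset.prod_mul_distrib]
      ring
    intro x' hx'
    rcases eq_or_ne x x' with rfl | hne
    · rfl
    rw [expand x hx x' (Finset.mem_erase.mpr ⟨hne.symm, hx'⟩),
      expand x' hx' x (Finset.mem_erase.mpr ⟨hne, hx⟩), sum_erase_comm,
      Finset.erase_right_comm (a := x')]
    congr 1
    · rw [hm x' x]
      simp only [mul_comm]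
    · refine Finset.sum_congr rfl fun y hy => Finset.sum_congr rfl fun w hw => ?_
      rw [Finset.erase_right_comm (a := w), hc x' x, hc w x, hc x' y, hc w y]
      simp only [Finset.prod_mul_distrib]
      ring
  rw [pairSumAux, Finset.sum_congr rfl key, Finset.sum_const, hS, nsmul_eq_mul, ← mul_assoc]
  have : (2 * ((n : ℂ) + 1)) ≠ 0 := by
    have : (n : ℂ) + 1 ≠ 0 := by exact_mod_cast Nat.succ_ne_zero n
    simpa using this
  push_cast
  rw [show (2 * (n : ℂ) + 2) = 2 * (n + 1) by ring, one_div, inv_mul_cancel₀ this, one_mul]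

omit hm hc in
theorem pairSum_empty : pairSum m c ∅ = 1 := by simp [pairSum, pairSumAux]

omit hm hc in
theorem pairSum_odd {S : Finset ι} (hS : ¬ Even S.card) : pairSum m c S = 0 := by
  rw [pairSum, pairSumAux_odd]
  intro h
  exact hS (h ▸ even_two_mul _)

/-- Expansion along an element. -/
theorem pairSum_insert (S : Finset ι) (x : ι) (hx : x ∉ S) :
    pairSum m c (insert x S) = ∑ y ∈ S, m x y * (∏ z ∈ S.erase y, c x z * c y z) *
      pairSum m c (S.erase y) := by
  have h1 := Finset.card_insert_of_notMem hx
  by_cases hS : Even (insert x S).card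
  · obtain ⟨n, hn⟩ : ∃ n, (insert x S).card = 2 * n + 2 := by
      obtain ⟨k, hk⟩ := hS
      exact ⟨k - 1, by omega⟩
    rw [pairSum, show (insert x S).card / 2 = n + 1 by omega,
      pairSumAux_succ hm hc n _ hn x (Finset.mem_insert_self _ _), Finset.erase_insert hx]
    refine Finset.sum_congr rfl fun y hy => ?_
    have h2 := Finset.card_erase_add_one hy
    rw [pairSum, show (S.erase y).card / 2 = n by omega]
  · rw [pairSum_odd hS, Finset.sum_eq_zero]
    intro y hy
    rw [pairSum_odd, mul_zero]
    have h2 := Finset.card_erase_add_one hy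
    rw [h1] at hS
    intro h3
    apply hS
    rw [← h2]
    obtain ⟨k, hk⟩ := h3
    exact ⟨k + 1, by omega⟩

/-- The expansion along a repeated element vanishes. -/
theorem pairSum_repeated (R : Finset ι) (y : ι) (hy : y ∉ R) :
    ∑ w ∈ R, m y w * (∏ z ∈ R.erase w, c y z * c w z) * c w y *
      pairSum m c (insert y (R.erase w)) = 0 := by
  have e : ∀ w ∈ R, m y w * (∏ z ∈ R.erase w, c y z * c w z) * c w y *
      pairSum m c (insert y (R.erase w)) = ∑ v ∈ R.erase w,
        m y w * m y v * (c y v * c w v * c w y) *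
          (∏ z ∈ (R.erase w).erase v, c y z * c w z * (c y z * c v z)) *
          pairSum m c ((R.erase w).erase v) := by
    intro w hw
    rw [pairSum_insert hm hc _ _ (fun h => hy (Finset.mem_of_mem_erase h)), Finset.mul_sum]
    refine Finset.sum_congr rfl fun v hv => ?_
    rw [← Finset.mul_prod_erase _ _ hv]
    simp only [Finset.prod_mul_distrib]
    ring
  rw [Finset.sum_congr rfl e]
  -- Exchanging `w` and `v` reverses the sign of `c y v * c w v * c w y` and preserves everything
  -- else, so the double sum equals its negative.
  refine self_eq_neg.mp ?_
  conv_lhs => rw [sum_erase_comm]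
  rw [← Finset.sum_neg_distrib]
  refine Finset.sum_congr rfl fun w _ => ?_
  rw [← Finset.sum_neg_distrib]
  refine Finset.sum_congr rfl fun v _ => ?_
  rw [Finset.erase_right_comm (a := v), hc y w, hc v w, hc v y]
  simp only [Finset.prod_mul_distrib]
  ring

/-- Every element belongs to exactly one pair of a perfect matching, so each factor `g x` occurs
once. -/
theorem pairSum_mul {m' : ι → ι → ℂ} (hm' : ∀ x y, m' x y = m' y x) (g : ι → ℂ) (S : Finset ι)
    (h : ∀ x ∈ S, ∀ y ∈ S, x ≠ y → m' x y = g x * g y * m x y) :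
    pairSum m' c S = (∏ x ∈ S, g x) * pairSum m c S := by
  induction S using Finset.strongInduction with
  | H S ih =>
  rcases S.eq_empty_or_nonempty with rfl | ⟨x, hx⟩
  · simp [pairSum_empty]
  · rw [← Finset.insert_erase hx, pairSum_insert hm hc _ _ (Finset.notMem_erase _ _),
      pairSum_insert hm' hc _ _ (Finset.notMem_erase _ _), Finset.mul_sum,
      Finset.prod_insert (Finset.notMem_erase _ _)]
    refine Finset.sum_congr rfl fun y hy => ?_
    have hy' := Finset.mem_erase.mp hy
    have hsub : (S.erase x).erase y ⊆ S := (Finset.erase_subset _ _).trans (Finset.erase_subset _ _)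
    rw [ih _ ((Finset.erase_ssubset hy).trans (Finset.erase_ssubset hx))
      (fun a ha b hb => h a (hsub ha) b (hsub hb)), h x hx y hy'.2 hy'.1.symm,
      ← Finset.mul_prod_erase _ _ hy]
    ring

theorem pairSum_congr {m' : ι → ι → ℂ} (hm' : ∀ x y, m' x y = m' y x) (S : Finset ι)
    (h : ∀ x ∈ S, ∀ y ∈ S, x ≠ y → m' x y = m x y) : pairSum m' c S = pairSum m c S := by
  simpa using pairSum_mul hm hc hm' (fun _ => 1) S (by simpa using h)

omit hm [DecidableEq ι] in
theorem continuous_pairSum [DecidableEq ι] {m : ℂ → ι → ι → ℂ} (hm : ∀ s x y, m s x y = m s y x)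
    (h : ∀ x y, Continuous fun s => m s x y) (S : Finset ι) :
    Continuous fun s => pairSum (m s) c S := by
  induction S using Finset.strongInduction with
  | H S ih =>
  rcases S.eq_empty_or_nonempty with rfl | ⟨x, hx⟩
  · simpa only [pairSum_empty] using continuous_const
  · have : (fun s => pairSum (m s) c S) = fun s => ∑ y ∈ S.erase x, m s x y *
        (∏ z ∈ (S.erase x).erase y, c x z * c y z) * pairSum (m s) c ((S.erase x).erase y) := by
      funext s
      rw [← pairSum_insert (hm s) hc _ _ (Finset.notMem_erase _ _), Finset.insert_erase hx]
    rw [this]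
    exact continuous_finsetSum _ fun y hy => ((h x y).mul continuous_const).mul
      (ih _ ((Finset.erase_ssubset hy).trans (Finset.erase_ssubset hx)))

theorem pairSum_map {κ : Type*} [DecidableEq κ] (e : κ ↪ ι) (S : Finset κ) :
    pairSum (fun i j => m (e i) (e j)) (fun i j => c (e i) (e j)) S =
      pairSum m c (S.map e) := by
  induction S using Finset.strongInduction with
  | H S ih =>
  rcases S.eq_empty_or_nonempty with rfl | ⟨x, hx⟩
  · simp [pairSum_empty]
  · have hx' : e x ∉ (S.erase x).map e := by simp
    rw [← Finset.insert_erase hx, Finset.map_insert, pairSum_insert hm hc _ _ hx',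
      pairSum_insert (fun _ _ => hm _ _) (fun _ _ => hc _ _) _ _ (Finset.notMem_erase _ _),
      Finset.sum_map]
    refine Finset.sum_congr rfl fun y hy => ?_
    rw [ih _ ((Finset.erase_ssubset hy).trans (Finset.erase_ssubset hx)), ← Finset.map_erase,
      Finset.prod_map]

end PairSum

/-! ### The Pfaffian as a sum over perfect matchings -/

section Pfaffian

variable {ι : Type*} [DecidableEq ι] [Fintype ι]

/-- The sum of `W` over the injective maps from `Fin k` to `S`. -/
def injSum (k : ℕ) (S : Finset ι) (W : (Fin k → ι) → ℂ) : ℂ :=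
  ∑ f : Fin k → ι, if Function.Injective f ∧ ∀ i, f i ∈ S then W f else 0

theorem injSum_zero (S : Finset ι) (W : (Fin 0 → ι) → ℂ) : injSum 0 S W = W Fin.elim0 := by
  rw [injSum, Fintype.sum_unique, if_pos]
  · congr 1
  · exact ⟨Function.injective_of_subsingleton _, fun i => i.elim0⟩

theorem injSum_succ (k : ℕ) (S : Finset ι) (W : (Fin (k + 1) → ι) → ℂ) :
    injSum (k + 1) S W = ∑ x ∈ S, injSum k (S.erase x) fun f => W (Fin.cons x f) := by
  rw [injSum, ← (Fin.consEquiv (fun _ : Fin (k + 1) => ι)).sum_comp, Fintype.sum_prod_type,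
    ← Finset.sum_subset (Finset.subset_univ S)]
  · refine Finset.sum_congr rfl fun x hx => Finset.sum_congr rfl fun f _ => ?_
    refine if_congr ?_ rfl rfl
    simp only [Fin.consEquiv, Equiv.coe_fn_mk]
    rw [Fin.cons_injective_iff, Fin.forall_fin_succ]
    simp only [Fin.cons_zero, Fin.cons_succ, Set.mem_range, not_exists, Finset.mem_erase, hx,
      true_and]
    grind
  · intro x _ hx
    refine Finset.sum_eq_zero fun f _ => if_neg fun h => hx ?_
    simpa [Fin.consEquiv] using h.2 0

/-- The product of `c (f i) (f j)` over `i < j`. -/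
def pairProd (c : ι → ι → ℂ) {k : ℕ} (f : Fin k → ι) : ℂ := ∏ i, ∏ j ∈ Finset.Ioi i, c (f i) (f j)

omit [DecidableEq ι] [Fintype ι] in
theorem pairProd_cons (c : ι → ι → ℂ) {k : ℕ} (x : ι) (f : Fin k → ι) :
    pairProd c (Fin.cons x f : Fin (k + 1) → ι) = (∏ j, c x (f j)) * pairProd c f := by
  rw [pairProd, Fin.prod_univ_succ, Fin.prod_Ioi_zero]
  simp only [Fin.prod_Ioi_succ, Fin.cons_zero, Fin.cons_succ]
  rfl

omit [Fintype ι] in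
theorem prod_eq_of_injective {k : ℕ} {S : Finset ι} (hS : S.card = k) {f : Fin k → ι}
    (hf : Function.Injective f) (hfS : ∀ i, f i ∈ S) (F : ι → ℂ) :
    ∏ j, F (f j) = ∏ z ∈ S, F z := by
  have : S = Finset.univ.image f := by
    refine (Finset.eq_of_subset_of_card_le ?_ ?_).symm
    · intro z hz
      obtain ⟨i, -, rfl⟩ := Finset.mem_image.mp hz
      exact hfS i
    · rw [Finset.card_image_of_injective _ hf, hS, Finset.card_univ, Fintype.card_fin]
  rw [this, Finset.prod_image fun a _ b _ h => hf h]

/-- Removing the first two values of an injective map reproduces the recursion of `pairSumAux`. The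
constant `2 ^ n * n!` counts the orderings of one matching: the order of the pairs and the order
within each pair. -/
theorem injSum_pairProd (ω c : ι → ι → ℂ) (n : ℕ) (S : Finset ι) (hS : S.card = 2 * n) :
    injSum (2 * n) S (fun f => pairProd c f *
      ∏ i : Fin n, ω (f ⟨2 * i, by omega⟩) (f ⟨2 * i + 1, by omega⟩)) =
    2 ^ n * (n.factorial : ℂ) * pairSumAux (fun x y => ω x y * c x y) c n S := by
  induction n generalizing S with
  | zero =>
    have : S = ∅ := by simpa using hS
    subst this
    rw [injSum_zero]
    simp [pairProd, pairSumAux]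
  | succ n ih =>
    have e1 : ∀ W : (Fin (2 * (n + 1)) → ι) → ℂ, injSum (2 * (n + 1)) S W =
        ∑ x ∈ S, ∑ y ∈ S.erase x, injSum (2 * n) ((S.erase x).erase y) fun f =>
          W (Fin.cons x (Fin.cons y f : Fin (2 * n + 1) → ι) : Fin (2 * n + 1 + 1) → ι) := by
      intro W
      refine (injSum_succ (2 * n + 1) S W).trans (Finset.sum_congr rfl fun x _ => ?_)
      exact injSum_succ (2 * n) (S.erase x) _
    have hn : ((n : ℂ) + 1) ≠ 0 := by exact_mod_cast Nat.succ_ne_zero n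
    have hfac : (2 : ℂ) ^ (n + 1) * ((n + 1).factorial : ℂ) * (1 / (2 * (n + 1))) =
        2 ^ n * (n.factorial : ℂ) := by
      rw [Nat.factorial_succ]
      push_cast
      field_simp
      ring
    rw [e1, pairSumAux, ← mul_assoc, hfac, Finset.mul_sum]
    refine Finset.sum_congr rfl fun x hx => ?_
    rw [Finset.mul_sum]
    refine Finset.sum_congr rfl fun y hy => ?_
    have h1 := Finset.card_erase_add_one hx
    have h2 := Finset.card_erase_add_one hy
    have hc2 : ((S.erase x).erase y).card = 2 * n := by omega
    have e2 : 2 ^ n * (n.factorial : ℂ) * (ω x y * c x y *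
        (∏ z ∈ (S.erase x).erase y, c x z * c y z) *
          pairSumAux (fun x y => ω x y * c x y) c n ((S.erase x).erase y)) =
        ω x y * c x y * (∏ z ∈ (S.erase x).erase y, c x z * c y z) *
          (2 ^ n * (n.factorial : ℂ) *
            pairSumAux (fun x y => ω x y * c x y) c n ((S.erase x).erase y)) := by ring
    rw [e2, ← ih _ hc2, injSum, injSum, Finset.mul_sum]
    refine Finset.sum_congr rfl fun f _ => ?_
    split_ifs with hf
    · have e3 := pairProd_cons c x (Fin.cons y f : Fin (2 * n + 1) → ι)
      rw [pairProd_cons c y f, Fin.prod_univ_succ] at e3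
      simp only [Fin.cons_zero, Fin.cons_succ] at e3
      rw [prod_eq_of_injective hc2 hf.1 hf.2, prod_eq_of_injective hc2 hf.1 hf.2] at e3
      rw [Fin.prod_univ_succ]
      refine (congrArg (· * _) e3).trans ?_
      rw [Finset.prod_mul_distrib]
      have e4 : ∀ i : Fin n, ω
          ((Fin.cons x (Fin.cons y f : Fin (2 * n + 1) → ι) : Fin (2 * n + 1 + 1) → ι)
            ⟨2 * (i.succ : Fin (n + 1)), by omega⟩)
          ((Fin.cons x (Fin.cons y f : Fin (2 * n + 1) → ι) : Fin (2 * n + 1 + 1) → ι)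
            ⟨2 * (i.succ : Fin (n + 1)) + 1, by omega⟩) =
          ω (f ⟨2 * i, by omega⟩) (f ⟨2 * i + 1, by omega⟩) := fun i => rfl
      rw [Finset.prod_congr rfl fun i _ => e4 i]
      have e5 : ω
          ((Fin.cons x (Fin.cons y f : Fin (2 * n + 1) → ι) : Fin (2 * n + 1 + 1) → ι)
            ⟨2 * ((0 : Fin (n + 1)) : ℕ), by simp⟩)
          ((Fin.cons x (Fin.cons y f : Fin (2 * n + 1) → ι) : Fin (2 * n + 1 + 1) → ι)
            ⟨2 * ((0 : Fin (n + 1)) : ℕ) + 1, by simp⟩) = ω x y := rfl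
      rw [e5]
      ring
    · simp

/-- The Pfaffian as a sum over perfect matchings without signs. -/
theorem pairProd_mul_pfaffian (n : ℕ) (ω c : Fin (2 * n) → Fin (2 * n) → ℂ)
    (hc : ∀ i j, c i j = -c j i) :
    (∏ i : Fin (2 * n), ∏ j ∈ Finset.Ioi i, c i j) * pfaffian (n := n) (Matrix.of ω) =
      pairSum (fun i j => ω i j * c i j) c Finset.univ := by
  have hcard : (Finset.univ : Finset (Fin (2 * n))).card = 2 * n := by simp
  have h := injSum_pairProd ω c n Finset.univ hcard
  have h0 : (2 : ℂ) ^ n * (n.factorial : ℂ) ≠ 0 :=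
    mul_ne_zero (pow_ne_zero _ two_ne_zero) (Nat.cast_ne_zero.mpr n.factorial_ne_zero)
  rw [pairSum, hcard, show 2 * n / 2 = n by omega]
  refine mul_left_cancel₀ h0 (Eq.trans ?_ h)
  have e1 : ∀ W : (Fin (2 * n) → Fin (2 * n)) → ℂ, injSum (2 * n) Finset.univ W =
      ∑ σ : Equiv.Perm (Fin (2 * n)), W σ := by
    intro W
    rw [injSum, ← Finset.sum_filter]
    symm
    refine Finset.sum_bij (fun σ _ => (σ : Fin (2 * n) → Fin (2 * n))) ?_ ?_ ?_ ?_
    · intro σ _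
      simpa using σ.injective
    · intro σ _ τ _ h
      exact DFunLike.coe_injective h
    · intro f hf
      have hf' : Function.Injective f := by simpa using hf
      exact ⟨Equiv.ofBijective f (Finite.injective_iff_bijective.mp hf'), Finset.mem_univ _, rfl⟩
    · intro σ _
      rfl
  rw [e1, pfaffian, mul_left_comm, ← mul_assoc _ (1 / _), mul_one_div_cancel h0, one_mul,
    Finset.mul_sum]
  refine Finset.sum_congr rfl fun σ _ => ?_
  -- The sign of the permutation is absorbed by reordering the antisymmetric product.
  rw [pairProd, Equiv.Perm.prod_Ioi_comp_eq_sign_mul_prod σ hc]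
  simp only [Matrix.of_apply]
  ring

end Pfaffian

/-! ### Rational functions with simple poles at given points and their inverses -/

open Polynomial in
/-- A function of the form `N / ∏ y ∈ A, (x - y) (1 - x y)` with a polynomial `N` of degree at most
`2 |A|`. -/
def IsTame (A : Finset ℂ) (φ : ℂ → ℂ) : Prop :=
  ∃ N : ℂ[X], N.natDegree ≤ 2 * A.card ∧ ∀ x, x ∉ A → (∀ y ∈ A, 1 - x * y ≠ 0) →
    φ x * ∏ y ∈ A, ((x - y) * (1 - x * y)) = N.eval x

namespace IsTame

theorem congr {A : Finset ℂ} {φ ψ : ℂ → ℂ} (h : IsTame A φ)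
    (e : ∀ x, x ∉ A → (∀ y ∈ A, 1 - x * y ≠ 0) → ψ x = φ x) : IsTame A ψ := by
  obtain ⟨N, h1, h2⟩ := h
  exact ⟨N, h1, fun x hx hx' => by rw [e x hx hx', h2 x hx hx']⟩

theorem add {A : Finset ℂ} {φ ψ : ℂ → ℂ} (h : IsTame A φ) (h' : IsTame A ψ) :
    IsTame A (fun x => φ x + ψ x) := by
  obtain ⟨N, h1, h2⟩ := h
  obtain ⟨N', h1', h2'⟩ := h'
  refine ⟨N + N', (Polynomial.natDegree_add_le _ _).trans (max_le h1 h1'), fun x hx hx' => ?_⟩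
  rw [add_mul, h2 x hx hx', h2' x hx hx', Polynomial.eval_add]

theorem const_mul {A : Finset ℂ} {φ : ℂ → ℂ} (h : IsTame A φ) (c : ℂ) :
    IsTame A (fun x => c * φ x) := by
  obtain ⟨N, h1, h2⟩ := h
  refine ⟨Polynomial.C c * N, (Polynomial.natDegree_C_mul_le _ _).trans h1, fun x hx hx' => ?_⟩
  rw [mul_assoc, h2 x hx hx', Polynomial.eval_mul, Polynomial.eval_C]

theorem sub {A : Finset ℂ} {φ ψ : ℂ → ℂ} (h : IsTame A φ) (h' : IsTame A ψ) :
    IsTame A (fun x => φ x - ψ x) :=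
  (h.add (h'.const_mul (-1))).congr fun x _ _ => by ring

theorem sum {ι : Type*} {A : Finset ℂ} (T : Finset ι) {φ : ι → ℂ → ℂ}
    (h : ∀ i ∈ T, IsTame A (φ i)) : IsTame A (fun x => ∑ i ∈ T, φ i x) := by
  classical
  induction T using Finset.induction_on with
  | empty => exact ⟨0, by simp, fun x _ _ => by simp⟩
  | insert a T ha ih =>
    simp only [Finset.sum_insert ha]
    exact (h a (by simp)).add (ih fun i hi => h i (Finset.mem_insert_of_mem hi))

theorem mul {A B : Finset ℂ} (hAB : Disjoint A B) {φ ψ : ℂ → ℂ} (h : IsTame A φ)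
    (h' : IsTame B ψ) : IsTame (A ∪ B) (fun x => φ x * ψ x) := by
  obtain ⟨N, h1, h2⟩ := h
  obtain ⟨N', h1', h2'⟩ := h'
  refine ⟨N * N', ?_, fun x hx hx' => ?_⟩
  · rw [Finset.card_union_of_disjoint hAB]
    have := Polynomial.natDegree_mul_le (p := N) (q := N')
    omega
  · rw [Finset.mem_union, not_or] at hx
    rw [Finset.prod_union hAB, Polynomial.eval_mul,
      ← h2 x hx.1 fun y hy => hx' y (Finset.mem_union_left _ hy),
      ← h2' x hx.2 fun y hy => hx' y (Finset.mem_union_right _ hy)]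
    ring

theorem prod (A : Finset ℂ) {φ : ℂ → ℂ → ℂ} (h : ∀ y ∈ A, IsTame {y} (φ y)) :
    IsTame A (fun x => ∏ y ∈ A, φ y x) := by
  induction A using Finset.induction_on with
  | empty => exact ⟨1, by simp, fun x _ _ => by simp⟩
  | insert a A ha ih =>
    simp only [Finset.prod_insert ha]
    rw [Finset.insert_eq]
    exact mul (Finset.disjoint_singleton_left.mpr ha) (h a (by simp))
      (ih fun y hy => h y (Finset.mem_insert_of_mem hy))

/-- A function which becomes a quadratic polynomial after multiplication by `(x - y) (1 - x y)`. -/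
theorem singleton (y a b c : ℂ) {φ : ℂ → ℂ}
    (h : ∀ x, x - y ≠ 0 → 1 - x * y ≠ 0 →
      φ x * ((x - y) * (1 - x * y)) = a * x ^ 2 + b * x + c) : IsTame {y} φ := by
  refine ⟨Polynomial.C a * Polynomial.X ^ 2 + Polynomial.C b * Polynomial.X + Polynomial.C c,
    by
      rw [Finset.card_singleton]; exact Polynomial.natDegree_quadratic_le, fun x hx hx' => ?_⟩
  rw [Finset.prod_singleton, h x (sub_ne_zero.mpr (by simpa using hx)) (hx' y (by simp))]
  simp

theorem one (A : Finset ℂ) : IsTame A (fun _ => 1) := by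
  refine (prod A (φ := fun _ _ => 1) fun y _ => ?_).congr fun x _ _ => by simp
  exact singleton y (-y) (1 + y ^ 2) (-y) fun x _ _ => by ring

theorem of_subset {A B : Finset ℂ} (hAB : A ⊆ B) {φ : ℂ → ℂ} (h : IsTame A φ) : IsTame B φ := by
  have := mul Finset.disjoint_sdiff h (one (B \ A))
  rw [Finset.union_sdiff_of_subset hAB] at this
  exact this.congr fun x _ _ => by ring

open Filter Topology in
/-- A tame function whose residues vanish and which has a zero vanishes. -/
theorem eq_zero {A : Finset ℂ} {φ : ℂ → ℂ} (h : IsTame A φ) (h0 : (0 : ℂ) ∉ A)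
    (hA : ∀ x ∈ A, ∀ y ∈ A, 1 - x * y ≠ 0)
    (hres : ∀ y ∈ A, Tendsto (fun x => (x - y) * φ x) (𝓝[≠] y) (𝓝 0))
    (hres' : ∀ y ∈ A, Tendsto (fun x => (1 - x * y) * φ x) (𝓝[≠] y⁻¹) (𝓝 0))
    {a : ℂ} (haA : a ∉ A) (haA' : ∀ y ∈ A, 1 - a * y ≠ 0) (ha : φ a = 0)
    {x : ℂ} (hx : x ∉ A) (hx' : ∀ y ∈ A, 1 - x * y ≠ 0) : φ x = 0 := by
  obtain ⟨N, h1, h2⟩ := h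
  have hinv : ∀ y ∈ A, ∀ z ∈ A, y⁻¹ ≠ z := by
    rintro y hy z hz rfl
    exact hA _ hy _ hz (by rw [mul_inv_cancel₀ (fun h => h0 (h ▸ hy)), sub_self])
  have evA : ∀ y, ∀ᶠ x in 𝓝[≠] y, x ∉ A := by
    intro y
    have : (((A : Set ℂ) \ {y})ᶜ) ∈ 𝓝 y :=
      (A.finite_toSet.subset Set.sdiff_subset).isClosed.isOpen_compl.mem_nhds (by simp)
    filter_upwards [nhdsWithin_le_nhds this, self_mem_nhdsWithin] with x hx hxy hxA
    exact hx ⟨hxA, hxy⟩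
  have evI : ∀ y, ∀ᶠ x in 𝓝[≠] y, ∀ z ∈ A, 1 - x * z ≠ 0 := by
    intro y
    have hfin : ((((A.image fun z => z⁻¹ : Finset ℂ) : Set ℂ) \ {y})ᶜ) ∈ 𝓝 y :=
      ((A.image fun z => z⁻¹).finite_toSet.subset Set.sdiff_subset).isClosed.isOpen_compl.mem_nhds
        (by simp)
    filter_upwards [nhdsWithin_le_nhds hfin, self_mem_nhdsWithin] with x hx hxy z hz hxz
    refine hx ⟨?_, hxy⟩
    rw [Finset.mem_coe, Finset.mem_image]
    exact ⟨z, hz, (eq_inv_of_mul_eq_one_left (sub_eq_zero.mp hxz).symm).symm⟩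
  -- The defining relation of `N` is not available at `y ∈ A` itself, so the value of `N` is
  -- obtained as a limit, where the vanishing residue appears as a factor.
  have root1 : ∀ y ∈ A, N.eval y = 0 := by
    intro y hy
    have t1 : Tendsto (fun x => N.eval x) (𝓝[≠] y) (𝓝 (N.eval y)) :=
      (N.continuous.tendsto y).mono_left nhdsWithin_le_nhds
    have t2 : Tendsto (fun x => (x - y) * φ x *
        ((1 - x * y) * ∏ z ∈ A.erase y, ((x - z) * (1 - x * z)))) (𝓝[≠] y)
        (𝓝 (0 * ((1 - y * y) * ∏ z ∈ A.erase y, ((y - z) * (1 - y * z))))) := by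
      refine (hres y hy).mul (Tendsto.mono_left (Continuous.tendsto ?_ y) nhdsWithin_le_nhds)
      fun_prop
    rw [zero_mul] at t2
    refine tendsto_nhds_unique t1 (t2.congr' ?_)
    filter_upwards [evA y, evI y] with x hx hx'
    rw [← h2 x hx hx', ← Finset.mul_prod_erase _ _ hy]
    ring
  have root2 : ∀ y ∈ A, N.eval y⁻¹ = 0 := by
    intro y hy
    have t1 : Tendsto (fun x => N.eval x) (𝓝[≠] y⁻¹) (𝓝 (N.eval y⁻¹)) :=
      (N.continuous.tendsto y⁻¹).mono_left nhdsWithin_le_nhds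
    have t2 : Tendsto (fun x => (1 - x * y) * φ x *
        ((x - y) * ∏ z ∈ A.erase y, ((x - z) * (1 - x * z)))) (𝓝[≠] y⁻¹)
        (𝓝 (0 * ((y⁻¹ - y) * ∏ z ∈ A.erase y, ((y⁻¹ - z) * (1 - y⁻¹ * z))))) := by
      refine (hres' y hy).mul (Tendsto.mono_left (Continuous.tendsto ?_ y⁻¹) nhdsWithin_le_nhds)
      fun_prop
    rw [zero_mul] at t2
    refine tendsto_nhds_unique t1 (t2.congr' ?_)
    filter_upwards [evA y⁻¹, evI y⁻¹] with x hx hx'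
    rw [← h2 x hx hx', ← Finset.mul_prod_erase _ _ hy]
    ring
  have root3 : N.eval a = 0 := by rw [← h2 a haA haA', ha, zero_mul]
  have hdisj : Disjoint A (A.image fun z => z⁻¹) := by
    rw [Finset.disjoint_left]
    intro z hz hz'
    obtain ⟨y, hy, rfl⟩ := Finset.mem_image.mp hz'
    exact hinv y hy _ hz rfl
  have ha' : a ∉ A ∪ A.image fun z => z⁻¹ := by
    rw [Finset.mem_union, not_or]
    refine ⟨haA, fun h => ?_⟩
    obtain ⟨y, hy, rfl⟩ := Finset.mem_image.mp h
    exact haA' y hy (by rw [inv_mul_cancel₀ (fun h => h0 (h ▸ hy)), sub_self])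
  have hN : N = 0 := by
    -- The points of `A`, their inverses and `a` are `2 |A| + 1` distinct roots, one more than the
    -- degree bound.
    refine Polynomial.eq_zero_of_natDegree_lt_card_of_eval_eq_zero' N
      (insert a (A ∪ A.image fun z => z⁻¹)) ?_ ?_
    · intro z hz
      rcases Finset.mem_insert.mp hz with rfl | hz
      · exact root3
      rcases Finset.mem_union.mp hz with hz | hz
      · exact root1 z hz
      · obtain ⟨y, hy, rfl⟩ := Finset.mem_image.mp hz
        exact root2 y hy
    · rw [Finset.card_insert_of_notMem ha', Finset.card_union_of_disjoint hdisj,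
        Finset.card_image_of_injective _ inv_injective]
      omega
  have h3 := h2 x hx hx'
  rw [hN, Polynomial.eval_zero] at h3
  refine (mul_eq_zero.mp h3).resolve_right (Finset.prod_ne_zero_iff.mpr fun y hy => ?_)
  exact mul_ne_zero (sub_ne_zero.mpr fun h => hx (h ▸ hy)) (hx' y hy)

end IsTame

/-! ### Matching sums and column sums as rational functions of one variable -/

/-- The interaction factor `(1 - t x z) / (x - z)`. -/
def crossFactor (t x z : ℂ) : ℂ := (1 - t * x * z) / (x - z)

theorem crossFactor_antisymm (t x z : ℂ) : crossFactor t x z = -crossFactor t z x := by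
  rw [crossFactor, crossFactor, ← neg_sub z x, div_neg, mul_right_comm]

/-- The pair weight `k x y / (1 - x y)`. -/
def pairWeight (k : ℂ → ℂ → ℂ) (x y : ℂ) : ℂ := k x y / (1 - x * y)

theorem pairWeight_symm {k : ℂ → ℂ → ℂ} (hk : ∀ x y, k x y = k y x) (x y : ℂ) :
    pairWeight k x y = pairWeight k y x := by
  rw [pairWeight, pairWeight, hk, mul_comm x y]

/-- The sum over perfect matchings with pair weights `k x y / (1 - x y)`. -/
def matchingSum (t : ℂ) (k : ℂ → ℂ → ℂ) (S : Finset ℂ) : ℂ :=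
  pairSum (pairWeight k) (crossFactor t) S

theorem matchingSum_empty (t : ℂ) (k : ℂ → ℂ → ℂ) : matchingSum t k ∅ = 1 := pairSum_empty

theorem matchingSum_insert (t : ℂ) {k : ℂ → ℂ → ℂ} (hk : ∀ x y, k x y = k y x) {S : Finset ℂ}
    {x : ℂ} (hx : x ∉ S) : matchingSum t k (insert x S) = ∑ y ∈ S, pairWeight k x y *
      (∏ z ∈ S.erase y, crossFactor t x z * crossFactor t y z) * matchingSum t k (S.erase y) :=
  pairSum_insert (pairWeight_symm hk) (crossFactor_antisymm t) S x hx

theorem isTame_hopFactor_left (t y : ℂ) : IsTame {y} (fun x => hopFactor t x y) := by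
  refine IsTame.singleton y (-y) (1 + t * y ^ 2) (-(t * y)) fun x h1 h2 => ?_
  rw [hopFactor]
  field_simp
  ring

theorem isTame_hopFactor_right (t y : ℂ) : IsTame {y} (fun x => hopFactor t y x) := by
  refine IsTame.singleton y (-(t * y)) (t + y ^ 2) (-y) fun x h1 h2 => ?_
  have h3 : y - x ≠ 0 := fun h => h1 (by linear_combination -h)
  rw [hopFactor]
  field_simp
  ring

theorem isTame_crossFactor (t y c : ℂ) : IsTame {y} (fun x => crossFactor t x y * c) := by
  refine IsTame.singleton y (c * t * y ^ 2) (-(c * (1 + t) * y)) c fun x h1 h2 => ?_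
  rw [crossFactor]
  field_simp
  ring

theorem isTame_affine (y a b : ℂ) : IsTame {y} (fun x => (a * x + b) / (1 - x * y)) := by
  refine IsTame.singleton y a (b - a * y) (-(b * y)) fun x h1 h2 => ?_
  field_simp
  ring

/-- In the expansion along `x`, each element of `S` contributes one factor, with a numerator of
degree at most two over `(x - z) (1 - x z)`. This leaves room for an affine `g x * k x y` only: the
constant numerator `1 - t` is used with the prefactor `x - p s` of the column, the shifted numerator
with prefactor `1`. -/
theorem isTame_matchingSum (t : ℂ) {k : ℂ → ℂ → ℂ} (hk : ∀ x y, k x y = k y x) (S : Finset ℂ)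
    (g : ℂ → ℂ) (hg : ∀ y, ∃ a b, ∀ x, g x * k x y = a * x + b) :
    IsTame S (fun x => g x * matchingSum t k (insert x S)) := by
  have : IsTame S (fun x => ∑ y ∈ S, matchingSum t k (S.erase y) * (g x * k x y / (1 - x * y) *
      ∏ z ∈ S.erase y, crossFactor t x z * crossFactor t y z)) := by
    refine IsTame.sum _ fun y hy => IsTame.const_mul ?_ _
    obtain ⟨a, b, hab⟩ := hg y
    simp only [hab]
    have := IsTame.mul (Finset.disjoint_singleton_left.mpr (Finset.notMem_erase y S))
      (isTame_affine y a b) (IsTame.prod (S.erase y)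
        (φ := fun z x => crossFactor t x z * crossFactor t y z)
        fun z _ => isTame_crossFactor t z _)
    rwa [← Finset.insert_eq, Finset.insert_erase hy] at this
  refine this.congr fun x hx _ => ?_
  rw [matchingSum_insert t hk hx, Finset.mul_sum]
  refine Finset.sum_congr rfl fun y _ => ?_
  rw [pairWeight]
  ring

/-- The product of the factors `z - a` of the elements of `J` and of the factors that relate the
elements of `J` to those of `S \ J`. -/
def splitFactor (t a : ℂ) (S J : Finset ℂ) : ℂ :=
  (∏ z ∈ J, (z - a)) * ∏ i ∈ J, ∏ j ∈ S \ J, hopFactor t i j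

theorem splitFactor_insert_left (t a : ℂ) {S J : Finset ℂ} (hJ : J ⊆ S) {x : ℂ} (hx : x ∉ S) :
    splitFactor t a (insert x S) J = splitFactor t a S J * ∏ i ∈ J, hopFactor t i x := by
  have hv' : x ∉ S \ J := fun h => hx (Finset.mem_sdiff.mp h).1
  rw [splitFactor, splitFactor, Finset.insert_sdiff_of_notMem _ fun h => hx (hJ h)]
  simp only [Finset.prod_insert hv', Finset.prod_mul_distrib]
  ring

theorem insert_sdiff_insert_of_notMem {S J : Finset ℂ} {x : ℂ} (hx : x ∉ S) :
    insert x S \ insert x J = S \ J := by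
  ext z
  simp only [Finset.mem_sdiff, Finset.mem_insert]
  constructor
  · tauto
  · rintro ⟨h1, h2⟩
    exact ⟨Or.inr h1, fun h => h.elim (fun h => hx (h ▸ h1)) h2⟩

theorem splitFactor_insert_right (t a : ℂ) {S J : Finset ℂ} (hJ : J ⊆ S) {x : ℂ} (hx : x ∉ S) :
    splitFactor t a (insert x S) (insert x J) =
      (x - a) * splitFactor t a S J * ∏ j ∈ S \ J, hopFactor t x j := by
  have hxJ : x ∉ J := fun h => hx (hJ h)
  rw [splitFactor, splitFactor, insert_sdiff_insert_of_notMem hx, Finset.prod_insert hxJ,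
    Finset.prod_insert hxJ]
  ring

/-- The coefficients of the states of the column with an even number of paths. -/
def evenWeight (t p s : ℂ) (k : ℕ) : ℂ :=
  ∏ j ∈ Finset.range (k / 2), ((1 - p * t ^ (2 * j + 1)) * (1 - p * s ^ 2 * t ^ (2 * j)))

/-- The contribution of a column with the matching sum to its right. -/
def columnSum (t p s : ℂ) (S : Finset ℂ) : ℂ :=
  ∑ J ∈ S.powerset, evenWeight t p s (S \ J).card * splitFactor t (p * s) S J *
    matchingSum t (fun _ _ => 1 - t) J

theorem columnSum_insert (t p s : ℂ) {S : Finset ℂ} {x : ℂ} (hx : x ∉ S) :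
    columnSum t p s (insert x S) = ∑ J ∈ S.powerset,
      (evenWeight t p s ((S \ J).card + 1) * (splitFactor t (p * s) S J *
        ∏ i ∈ J, hopFactor t i x) * matchingSum t (fun _ _ => 1 - t) J +
      evenWeight t p s (S \ J).card * ((x - p * s) * splitFactor t (p * s) S J *
        ∏ j ∈ S \ J, hopFactor t x j) * matchingSum t (fun _ _ => 1 - t) (insert x J)) := by
  rw [columnSum, Finset.sum_powerset_insert hx, ← Finset.sum_add_distrib]
  refine Finset.sum_congr rfl fun J hJ => ?_
  have hJ' := Finset.mem_powerset.mp hJ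
  rw [splitFactor_insert_left t _ hJ' hx, splitFactor_insert_right t _ hJ' hx,
    insert_sdiff_insert_of_notMem hx, Finset.insert_sdiff_of_notMem _ fun h => hx (hJ' h),
    Finset.card_insert_of_notMem fun h => hx (Finset.mem_sdiff.mp h).1]

theorem columnSum_insert_insert (t p s : ℂ) {S : Finset ℂ} {x y : ℂ} (hx : x ∉ insert y S)
    (hy : y ∉ S) :
    columnSum t p s (insert x (insert y S)) = ∑ J ∈ S.powerset,
      ((evenWeight t p s ((S \ J).card + 2) * (splitFactor t (p * s) S J *
        (∏ i ∈ J, hopFactor t i y) * ∏ i ∈ J, hopFactor t i x) *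
          matchingSum t (fun _ _ => 1 - t) J +
      evenWeight t p s ((S \ J).card + 1) * ((x - p * s) * (splitFactor t (p * s) S J *
        ∏ i ∈ J, hopFactor t i y) * (hopFactor t x y * ∏ j ∈ S \ J, hopFactor t x j)) *
          matchingSum t (fun _ _ => 1 - t) (insert x J)) +
      (evenWeight t p s ((S \ J).card + 1) * ((y - p * s) * splitFactor t (p * s) S J *
        (∏ j ∈ S \ J, hopFactor t y j) * (hopFactor t y x * ∏ i ∈ J, hopFactor t i x)) *
          matchingSum t (fun _ _ => 1 - t) (insert y J) +
      evenWeight t p s (S \ J).card * ((x - p * s) * ((y - p * s) * splitFactor t (p * s) S J *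
        ∏ j ∈ S \ J, hopFactor t y j) * ∏ j ∈ S \ J, hopFactor t x j) *
          matchingSum t (fun _ _ => 1 - t) (insert x (insert y J)))) := by
  rw [columnSum_insert t p s hx, Finset.sum_powerset_insert hy, ← Finset.sum_add_distrib]
  refine Finset.sum_congr rfl fun J hJ => ?_
  have hJ' := Finset.mem_powerset.mp hJ
  have h1 : y ∉ S \ J := fun h => hy (Finset.mem_sdiff.mp h).1
  rw [splitFactor_insert_left t _ hJ' hy, splitFactor_insert_right t _ hJ' hy,
    insert_sdiff_insert_of_notMem hy, Finset.insert_sdiff_of_notMem _ fun h => hy (hJ' h),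
    Finset.card_insert_of_notMem h1, Finset.prod_insert h1,
    Finset.prod_insert fun h => hy (hJ' h)]

theorem isTame_columnSum (t p s : ℂ) (S : Finset ℂ) :
    IsTame S (fun x => columnSum t p s (insert x S)) := by
  have h1 : ∀ J ∈ S.powerset, IsTame S (fun x => ∏ i ∈ J, hopFactor t i x) := fun J hJ =>
    (IsTame.prod J (φ := fun i x => hopFactor t i x)
      fun y _ => isTame_hopFactor_right t y).of_subset (Finset.mem_powerset.mp hJ)
  have h2 : ∀ J ∈ S.powerset, IsTame S (fun x => ((x - p * s) *
      matchingSum t (fun _ _ => 1 - t) (insert x J)) * ∏ j ∈ S \ J, hopFactor t x j) := by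
    intro J hJ
    have := IsTame.mul Finset.disjoint_sdiff
      (isTame_matchingSum t (k := fun _ _ => 1 - t) (fun _ _ => rfl) J (fun x => x - p * s)
        fun y => ⟨1 - t, -(p * s * (1 - t)), fun x => by ring⟩)
      (IsTame.prod (S \ J) (φ := fun j x => hopFactor t x j)
        fun y _ => isTame_hopFactor_left t y)
    rwa [Finset.union_sdiff_of_subset (Finset.mem_powerset.mp hJ)] at this
  refine IsTame.congr (IsTame.sum S.powerset fun J hJ =>
    ((h1 J hJ).const_mul (evenWeight t p s ((S \ J).card + 1) * splitFactor t (p * s) S J *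
      matchingSum t (fun _ _ => 1 - t) J)).add
    ((h2 J hJ).const_mul (evenWeight t p s (S \ J).card * splitFactor t (p * s) S J)))
    fun x hx _ => ?_
  rw [columnSum_insert t p s hx]
  refine Finset.sum_congr rfl fun J _ => ?_
  ring

/-! ### Limits and residues of matching sums -/

section Limits

open Filter Topology

theorem continuousAt_crossFactor {t y z : ℂ} (h : y ≠ z) :
    ContinuousAt (fun x => crossFactor t x z) y := by
  have : y - z ≠ 0 := sub_ne_zero.mpr h
  unfold crossFactor
  fun_prop (disch := assumption)

theorem continuousAt_hopFactor_left {t y z : ℂ} (h : y ≠ z) :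
    ContinuousAt (fun x => hopFactor t x z) y := by
  have : y - z ≠ 0 := sub_ne_zero.mpr h
  unfold hopFactor
  fun_prop (disch := assumption)

theorem continuousAt_hopFactor_right {t y z : ℂ} (h : y ≠ z) :
    ContinuousAt (fun x => hopFactor t z x) y := by
  have : z - y ≠ 0 := sub_ne_zero.mpr h.symm
  unfold hopFactor
  fun_prop (disch := assumption)

theorem continuousAt_pairWeight {k : ℂ → ℂ → ℂ} {z : ℂ} (hk : Continuous fun x => k x z) {y : ℂ}
    (h : 1 - y * z ≠ 0) : ContinuousAt (fun x => pairWeight k x z) y := by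
  unfold pairWeight
  fun_prop (disch := assumption)

theorem eventually_notMem (S : Finset ℂ) (y : ℂ) : ∀ᶠ x in 𝓝[≠] y, x ∉ S := by
  have : (((S : Set ℂ) \ {y})ᶜ) ∈ 𝓝 y :=
    (S.finite_toSet.subset Set.sdiff_subset).isClosed.isOpen_compl.mem_nhds (by simp)
  filter_upwards [nhdsWithin_le_nhds this, self_mem_nhdsWithin] with x hx hxy hxA
  exact hx ⟨hxA, hxy⟩

variable (t : ℂ) {k : ℂ → ℂ → ℂ} (hk : ∀ x y, k x y = k y x) (hkc : ∀ y, Continuous fun x => k x y)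

include hk hkc

theorem tendsto_matchingSum {S : Finset ℂ} {y : ℂ} (hy : y ∉ S) (h : ∀ z ∈ S, 1 - y * z ≠ 0) :
    Tendsto (fun x => matchingSum t k (insert x S)) (𝓝[≠] y)
      (𝓝 (matchingSum t k (insert y S))) := by
  have hc : ContinuousAt (fun x => ∑ w ∈ S, pairWeight k x w *
      (∏ z ∈ S.erase w, crossFactor t x z * crossFactor t w z) * matchingSum t k (S.erase w)) y := by
    refine tendsto_finsetSum _ fun w hw => ?_
    refine ((continuousAt_pairWeight (hkc w) (h w hw)).mul ?_).mul continuousAt_const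
    refine tendsto_finsetProd _ fun z hz => ?_
    exact (continuousAt_crossFactor (by
      rintro rfl; exact hy (Finset.mem_of_mem_erase hz))).mul continuousAt_const
  rw [matchingSum_insert t hk hy]
  refine (hc.tendsto.mono_left nhdsWithin_le_nhds).congr' ?_
  filter_upwards [eventually_notMem S y] with x hx
  rw [matchingSum_insert t hk hx]

/-- The matching sum has no pole where two variables coincide. -/
theorem tendsto_sub_mul_matchingSum {S : Finset ℂ} {y : ℂ} (hy : y ∉ S)
    (h : ∀ z ∈ insert y S, 1 - y * z ≠ 0) :
    Tendsto (fun x => (x - y) * matchingSum t k (insert x (insert y S))) (𝓝[≠] y) (𝓝 0) := by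
  have hne : ∀ z ∈ S, y ≠ z := fun z hz e => hy (e ▸ hz)
  have hc : ContinuousAt (fun x =>
      (x - y) * (pairWeight k x y * (∏ z ∈ S, crossFactor t x z * crossFactor t y z) *
        matchingSum t k S) +
      ∑ w ∈ S, (1 - t * x * y) * (pairWeight k x w *
        (∏ z ∈ S.erase w, crossFactor t x z * crossFactor t w z) * crossFactor t w y *
        matchingSum t k (insert y (S.erase w)))) y := by
    refine ContinuousAt.add ?_ (tendsto_finsetSum _ fun w hw => ?_)
    · refine ContinuousAt.mul (by fun_prop) (((continuousAt_pairWeight (hkc y)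
        (h y (by simp))).mul (tendsto_finsetProd _ fun z hz => ?_)).mul continuousAt_const)
      exact (continuousAt_crossFactor (hne z hz)).mul continuousAt_const
    · refine ContinuousAt.mul (by fun_prop) ((((continuousAt_pairWeight (hkc w)
        (h w (Finset.mem_insert_of_mem hw))).mul
          (tendsto_finsetProd _ fun z hz => ?_)).mul continuousAt_const).mul continuousAt_const)
      exact (continuousAt_crossFactor (hne z (Finset.mem_of_mem_erase hz))).mul continuousAt_const
  have h0 : (y - y) * (pairWeight k y y * (∏ z ∈ S, crossFactor t y z * crossFactor t y z) *
        matchingSum t k S) +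
      ∑ w ∈ S, (1 - t * y * y) * (pairWeight k y w *
        (∏ z ∈ S.erase w, crossFactor t y z * crossFactor t w z) * crossFactor t w y *
        matchingSum t k (insert y (S.erase w))) = 0 := by
    rw [sub_self, zero_mul, zero_add, ← Finset.mul_sum]
    exact mul_eq_zero_of_right _
      (pairSum_repeated (pairWeight_symm hk) (crossFactor_antisymm t) S y hy)
  have hc' := hc.tendsto
  simp only [h0] at hc'
  refine (hc'.mono_left nhdsWithin_le_nhds).congr' ?_
  filter_upwards [eventually_notMem (insert y S) y] with x hx
  have hxy : x - y ≠ 0 := sub_ne_zero.mpr fun e => hx (e ▸ Finset.mem_insert_self _ _)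
  rw [matchingSum_insert t hk hx, Finset.sum_insert hy, Finset.erase_insert hy, mul_add,
    Finset.mul_sum]
  congr 1
  refine Finset.sum_congr rfl fun w hw => ?_
  have hyw : y ∉ S.erase w := fun h => hy (Finset.mem_of_mem_erase h)
  rw [Finset.erase_insert_of_ne (hne w hw), Finset.prod_insert hyw]
  have : (x - y) * crossFactor t x y = 1 - t * x * y := by
    rw [crossFactor]
    field_simp
  rw [← this]
  ring

/-- The residue of the matching sum where the product of two variables is `1`. -/
theorem tendsto_one_sub_mul_matchingSum {S : Finset ℂ} {y : ℂ} (hy : y ∉ S) (hy0 : y ≠ 0)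
    (h : ∀ z ∈ insert y S, 1 - y * z ≠ 0) :
    Tendsto (fun x => (1 - x * y) * matchingSum t k (insert x (insert y S))) (𝓝[≠] y⁻¹)
      (𝓝 (k y⁻¹ y * (∏ z ∈ S, crossFactor t y⁻¹ z * crossFactor t y z) * matchingSum t k S)) := by
  have hne : ∀ z ∈ insert y S, y⁻¹ ≠ z := by
    rintro z hz rfl
    exact h _ hz (by rw [mul_inv_cancel₀ hy0, sub_self])
  have hne' : ∀ z ∈ S, 1 - y⁻¹ * z ≠ 0 := by
    intro z hz e
    have : y = z := by
      have := sub_eq_zero.mp e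
      field_simp at this
      exact this
    exact hy (this ▸ hz)
  have hc : ContinuousAt (fun x =>
      k x y * (∏ z ∈ S, crossFactor t x z * crossFactor t y z) * matchingSum t k S +
      (1 - x * y) * ∑ w ∈ S, pairWeight k x w *
        (∏ z ∈ (insert y S).erase w, crossFactor t x z * crossFactor t w z) *
        matchingSum t k ((insert y S).erase w)) y⁻¹ := by
    refine ContinuousAt.add (((hkc y).continuousAt.mul
      (tendsto_finsetProd _ fun z hz => ?_)).mul continuousAt_const)
      (ContinuousAt.mul (by fun_prop) (tendsto_finsetSum _ fun w hw => ?_))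
    · exact (continuousAt_crossFactor (hne z (Finset.mem_insert_of_mem hz))).mul continuousAt_const
    · refine ((continuousAt_pairWeight (hkc w) (hne' w hw)).mul
        (tendsto_finsetProd _ fun z hz => ?_)).mul continuousAt_const
      exact (continuousAt_crossFactor (hne z (Finset.mem_of_mem_erase hz))).mul continuousAt_const
  have hc' := hc.tendsto
  simp only [inv_mul_cancel₀ hy0, sub_self, zero_mul, add_zero] at hc'
  refine (hc'.mono_left nhdsWithin_le_nhds).congr' ?_
  filter_upwards [eventually_notMem (insert y S) y⁻¹, self_mem_nhdsWithin] with x hx hxy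
  have hxy : 1 - x * y ≠ 0 := fun e => hxy (eq_inv_of_mul_eq_one_left (sub_eq_zero.mp e).symm)
  rw [matchingSum_insert t hk hx, Finset.sum_insert hy, Finset.erase_insert hy, mul_add]
  congr 1
  rw [pairWeight]
  field_simp

end Limits

/-! ### Limits and residues of column sums -/

section ColumnLimits

open Filter Topology

variable (t p s : ℂ)

theorem tendsto_of_tendsto_of_eq {f : ℂ → ℂ} {l : Filter ℂ} {a b : ℂ} (h : Tendsto f l (𝓝 a))
    (e : a = b) : Tendsto f l (𝓝 b) := e ▸ h

theorem tendsto_prod_hopFactor_left {J : Finset ℂ} {y : ℂ} (hy : y ∉ J) :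
    Tendsto (fun x => ∏ j ∈ J, hopFactor t x j) (𝓝[≠] y) (𝓝 (∏ j ∈ J, hopFactor t y j)) :=
  (tendsto_finsetProd _ fun j hj => (continuousAt_hopFactor_left (by
    rintro rfl; exact hy hj)).tendsto).mono_left nhdsWithin_le_nhds

theorem tendsto_prod_hopFactor_right {J : Finset ℂ} {y : ℂ} (hy : y ∉ J) :
    Tendsto (fun x => ∏ j ∈ J, hopFactor t j x) (𝓝[≠] y) (𝓝 (∏ j ∈ J, hopFactor t j y)) :=
  (tendsto_finsetProd _ fun j hj => (continuousAt_hopFactor_right (by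
    rintro rfl; exact hy hj)).tendsto).mono_left nhdsWithin_le_nhds

/-- The column sum has no pole where two variables coincide. -/
theorem tendsto_sub_mul_columnSum {S : Finset ℂ} {y : ℂ} (hy : y ∉ S)
    (h : ∀ z ∈ insert y S, 1 - y * z ≠ 0) :
    Tendsto (fun x => (x - y) * columnSum t p s (insert x (insert y S))) (𝓝[≠] y) (𝓝 0) := by
  have hid : Tendsto (fun x : ℂ => x) (𝓝[≠] y) (𝓝 y) := tendsto_id.mono_left nhdsWithin_le_nhds
  have hsum : Tendsto (fun x => ∑ J ∈ S.powerset,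
      (((x - y) * (evenWeight t p s ((S \ J).card + 2) * (splitFactor t (p * s) S J *
        (∏ i ∈ J, hopFactor t i y) * ∏ i ∈ J, hopFactor t i x) *
          matchingSum t (fun _ _ => 1 - t) J) +
      evenWeight t p s ((S \ J).card + 1) * ((x - p * s) * (splitFactor t (p * s) S J *
        ∏ i ∈ J, hopFactor t i y) * ((x - t * y) * ∏ j ∈ S \ J, hopFactor t x j)) *
          matchingSum t (fun _ _ => 1 - t) (insert x J)) +
      (evenWeight t p s ((S \ J).card + 1) * ((y - p * s) * splitFactor t (p * s) S J *
        (∏ j ∈ S \ J, hopFactor t y j) * ((t * x - y) * ∏ i ∈ J, hopFactor t i x)) *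
          matchingSum t (fun _ _ => 1 - t) (insert y J) +
      evenWeight t p s (S \ J).card * ((x - p * s) * ((y - p * s) * splitFactor t (p * s) S J *
        ∏ j ∈ S \ J, hopFactor t y j) * ∏ j ∈ S \ J, hopFactor t x j) *
          ((x - y) * matchingSum t (fun _ _ => 1 - t) (insert x (insert y J))))))
      (𝓝[≠] y) (𝓝 (∑ J ∈ S.powerset, 0)) := by
    refine tendsto_finsetSum _ fun J hJ => ?_
    have hJ' := Finset.mem_powerset.mp hJ
    have hyJ : y ∉ J := fun h => hy (hJ' h)
    have hyJ' : y ∉ S \ J := fun h => hy (Finset.mem_sdiff.mp h).1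
    have tA := tendsto_prod_hopFactor_right t hyJ
    have tB := tendsto_prod_hopFactor_left t hyJ'
    have tC := tendsto_matchingSum t (k := fun _ _ => 1 - t) (fun _ _ => rfl)
      (fun _ => continuous_const) hyJ fun z hz => h z (Finset.mem_insert_of_mem (hJ' hz))
    have tD := tendsto_sub_mul_matchingSum t (k := fun _ _ => 1 - t) (fun _ _ => rfl)
      (fun _ => continuous_const) hyJ fun z hz => h z (Finset.insert_subset_insert y hJ' hz)
    have := (((hid.sub_const y).mul ((tA.const_mul (splitFactor t (p * s) S J *
        ∏ i ∈ J, hopFactor t i y)).const_mul (evenWeight t p s ((S \ J).card + 2)) |>.mul_const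
          (matchingSum t (fun _ _ => 1 - t) J))).add
      (((((hid.sub_const (p * s)).mul_const (splitFactor t (p * s) S J *
        ∏ i ∈ J, hopFactor t i y)).mul ((hid.sub_const (t * y)).mul tB)).const_mul
          (evenWeight t p s ((S \ J).card + 1))).mul tC)).add
      ((((((hid.const_mul t).sub_const y).mul tA).const_mul ((y - p * s) *
        splitFactor t (p * s) S J * (∏ j ∈ S \ J, hopFactor t y j))).const_mul
          (evenWeight t p s ((S \ J).card + 1)) |>.mul_const
            (matchingSum t (fun _ _ => 1 - t) (insert y J))).add
      (((((hid.sub_const (p * s)).mul_const ((y - p * s) * splitFactor t (p * s) S J *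
        ∏ j ∈ S \ J, hopFactor t y j)).mul tB).const_mul
          (evenWeight t p s (S \ J).card)).mul tD))
    -- The terms in which exactly one of `x`, `y` leaves to the right cancel, because `x - t y` and
    -- `t x - y` have opposite limits; the other two kinds of terms tend to zero separately.
    refine tendsto_of_tendsto_of_eq this ?_
    ring
  rw [Finset.sum_const_zero] at hsum
  refine hsum.congr' ?_
  filter_upwards [eventually_notMem (insert y S) y] with x hx
  have hxy : x - y ≠ 0 := sub_ne_zero.mpr fun e => hx (e ▸ Finset.mem_insert_self _ _)
  have hyx : y - x ≠ 0 := fun e => hxy (by linear_combination -e)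
  have e1 : (x - t * y) = (x - y) * hopFactor t x y := by
    rw [hopFactor]; field_simp
  have e2 : (t * x - y) = (x - y) * hopFactor t y x := by
    rw [hopFactor]; field_simp; ring
  rw [columnSum_insert_insert t p s hx hy, Finset.mul_sum, e1, e2]
  refine Finset.sum_congr rfl fun J _ => ?_
  ring

/-- The residue of the column sum where the product of two variables is `1`. -/
theorem tendsto_one_sub_mul_columnSum {S : Finset ℂ} {y : ℂ} (hy : y ∉ S) (hy0 : y ≠ 0)
    (h : ∀ z ∈ insert y S, 1 - y * z ≠ 0) :
    Tendsto (fun x => (1 - x * y) * columnSum t p s (insert x (insert y S))) (𝓝[≠] y⁻¹)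
      (𝓝 ((1 - t) * (y⁻¹ - p * s) * (y - p * s) *
        (∏ z ∈ S, crossFactor t y⁻¹ z * crossFactor t y z) * columnSum t p s S)) := by
  have hne : ∀ z ∈ insert y S, y⁻¹ ≠ z := by
    rintro z hz rfl
    exact h _ hz (by rw [mul_inv_cancel₀ hy0, sub_self])
  have hne' : ∀ z ∈ S, 1 - y⁻¹ * z ≠ 0 := by
    intro z hz e
    have : y = z := by
      have := sub_eq_zero.mp e
      field_simp at this
      exact this
    exact hy (this ▸ hz)
  have hid : Tendsto (fun x : ℂ => x) (𝓝[≠] y⁻¹) (𝓝 y⁻¹) :=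
    tendsto_id.mono_left nhdsWithin_le_nhds
  have hz : Tendsto (fun x : ℂ => 1 - x * y) (𝓝[≠] y⁻¹) (𝓝 0) :=
    tendsto_of_tendsto_of_eq ((hid.mul_const y).const_sub 1)
      (by rw [inv_mul_cancel₀ hy0, sub_self])
  have hyy : y⁻¹ ≠ y := hne y (by simp)
  have tE : Tendsto (fun x => hopFactor t x y) (𝓝[≠] y⁻¹) (𝓝 (hopFactor t y⁻¹ y)) :=
    (continuousAt_hopFactor_left hyy).tendsto.mono_left nhdsWithin_le_nhds
  have tF : Tendsto (fun x => hopFactor t y x) (𝓝[≠] y⁻¹) (𝓝 (hopFactor t y y⁻¹)) :=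
    (continuousAt_hopFactor_right hyy).tendsto.mono_left nhdsWithin_le_nhds
  have hsum : Tendsto (fun x => ∑ J ∈ S.powerset,
      ((1 - x * y) * ((evenWeight t p s ((S \ J).card + 2) * (splitFactor t (p * s) S J *
        (∏ i ∈ J, hopFactor t i y) * ∏ i ∈ J, hopFactor t i x) *
          matchingSum t (fun _ _ => 1 - t) J +
      evenWeight t p s ((S \ J).card + 1) * ((x - p * s) * (splitFactor t (p * s) S J *
        ∏ i ∈ J, hopFactor t i y) * (hopFactor t x y * ∏ j ∈ S \ J, hopFactor t x j)) *
          matchingSum t (fun _ _ => 1 - t) (insert x J)) +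
      (evenWeight t p s ((S \ J).card + 1) * ((y - p * s) * splitFactor t (p * s) S J *
        (∏ j ∈ S \ J, hopFactor t y j) * (hopFactor t y x * ∏ i ∈ J, hopFactor t i x)) *
          matchingSum t (fun _ _ => 1 - t) (insert y J))) +
      evenWeight t p s (S \ J).card * ((x - p * s) * ((y - p * s) * splitFactor t (p * s) S J *
        ∏ j ∈ S \ J, hopFactor t y j) * ∏ j ∈ S \ J, hopFactor t x j) *
          ((1 - x * y) * matchingSum t (fun _ _ => 1 - t) (insert x (insert y J)))))
      (𝓝[≠] y⁻¹) (𝓝 (∑ J ∈ S.powerset, (1 - t) * (y⁻¹ - p * s) * (y - p * s) *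
        (∏ z ∈ S, crossFactor t y⁻¹ z * crossFactor t y z) *
        (evenWeight t p s (S \ J).card * splitFactor t (p * s) S J *
          matchingSum t (fun _ _ => 1 - t) J))) := by
    refine tendsto_finsetSum _ fun J hJ => ?_
    have hJ' := Finset.mem_powerset.mp hJ
    have hyJ : y ∉ J := fun h => hy (hJ' h)
    have hyJ1 : y⁻¹ ∉ J := fun h => hne _ (Finset.mem_insert_of_mem (hJ' h)) rfl
    have hyJ2 : y⁻¹ ∉ S \ J := fun h =>
      hne _ (Finset.mem_insert_of_mem (Finset.mem_sdiff.mp h).1) rfl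
    have tA := tendsto_prod_hopFactor_right t hyJ1
    have tB := tendsto_prod_hopFactor_left t hyJ2
    have tC := tendsto_matchingSum t (k := fun _ _ => 1 - t) (fun _ _ => rfl)
      (fun _ => continuous_const) hyJ1 fun z hz => hne' z (hJ' hz)
    have tD := tendsto_one_sub_mul_matchingSum t (k := fun _ _ => 1 - t) (fun _ _ => rfl)
      (fun _ => continuous_const) hyJ hy0 fun z hz => h z (Finset.insert_subset_insert y hJ' hz)
    have := (hz.mul ((((tA.const_mul (splitFactor t (p * s) S J *
        ∏ i ∈ J, hopFactor t i y)).const_mul (evenWeight t p s ((S \ J).card + 2)) |>.mul_const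
          (matchingSum t (fun _ _ => 1 - t) J))).add
      (((((hid.sub_const (p * s)).mul_const (splitFactor t (p * s) S J *
        ∏ i ∈ J, hopFactor t i y)).mul (tE.mul tB)).const_mul
          (evenWeight t p s ((S \ J).card + 1))).mul tC) |>.add
      (((tF.mul tA).const_mul ((y - p * s) *
        splitFactor t (p * s) S J * (∏ j ∈ S \ J, hopFactor t y j))).const_mul
          (evenWeight t p s ((S \ J).card + 1)) |>.mul_const
            (matchingSum t (fun _ _ => 1 - t) (insert y J))))).add
      (((((hid.sub_const (p * s)).mul_const ((y - p * s) * splitFactor t (p * s) S J *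
        ∏ j ∈ S \ J, hopFactor t y j)).mul tB).const_mul
          (evenWeight t p s (S \ J).card)).mul tD)
    refine tendsto_of_tendsto_of_eq this ?_
    -- Only the terms in which both `x` and `y` leave to the right have a residue. Since `(y - t z)
    -- (y⁻¹ - t z) = (1 - t y⁻¹ z) (1 - t y z)`, the elements of `S \ J` contribute the same factors
    -- as those of `J`, and the prefactor no longer depends on `J`.
    have e1 : (∏ j ∈ S \ J, hopFactor t y j) * (∏ j ∈ S \ J, hopFactor t y⁻¹ j) =
        ∏ z ∈ S \ J, crossFactor t y⁻¹ z * crossFactor t y z := by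
      rw [← Finset.prod_mul_distrib]
      refine Finset.prod_congr rfl fun z hz => ?_
      have hzS := (Finset.mem_sdiff.mp hz).1
      have a1 : y - z ≠ 0 := sub_ne_zero.mpr fun e => hy (e ▸ hzS)
      have a2 : y⁻¹ - z ≠ 0 := sub_ne_zero.mpr (hne z (Finset.mem_insert_of_mem hzS))
      have a3 := h z (Finset.mem_insert_of_mem hzS)
      rw [hopFactor, hopFactor, crossFactor, crossFactor]
      field_simp
    rw [← Finset.prod_sdiff hJ', ← e1]
    ring
  rw [← Finset.mul_sum] at hsum
  refine hsum.congr' ?_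
  filter_upwards [eventually_notMem (insert y S) y⁻¹] with x hx
  rw [columnSum_insert_insert t p s hx hy, Finset.mul_sum]
  refine Finset.sum_congr rfl fun J _ => ?_
  ring

end ColumnLimits

/-! ### The identity between column sums and matching sums -/

/-- The numerator of the pair weights of the partition function with a shifted column. -/
def shiftedNumerator (t p s x y : ℂ) : ℂ :=
  (1 - t) * (x - p * s) * (y - p * s) + (1 - p * t) * (1 - p * s ^ 2) * (1 - x * y)

theorem shiftedNumerator_symm (t p s x y : ℂ) :
    shiftedNumerator t p s x y = shiftedNumerator t p s y x := by
  rw [shiftedNumerator, shiftedNumerator]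
  ring

/-- The factor `x - p s` excludes the sets that contain `p s`, and `hopFactor t (t p s) (p s) = 0`
excludes those that contain only `t p s`. Thus both variables stay in the column: they split off the
first factor of `evenWeight`, and their hop factors turn each `z - p s` into `z - p t ^ 2 s`. -/
theorem columnSum_special (t p s : ℂ) {S : Finset ℂ} (h1 : p * s ∉ insert (t * (p * s)) S)
    (h2 : t * (p * s) ∉ S) :
    columnSum t p s (insert (p * s) (insert (t * (p * s)) S)) =
      (1 - p * t) * (1 - p * s ^ 2) * columnSum t (p * t ^ 2) s S := by
  rw [columnSum_insert_insert t p s h1 h2, columnSum, Finset.mul_sum]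
  refine Finset.sum_congr rfl fun J hJ => ?_
  have hJ' := Finset.mem_powerset.mp hJ
  have e1 : hopFactor t (t * (p * s)) (p * s) = 0 := by rw [hopFactor, sub_self, zero_div]
  have e2 : ∀ k, evenWeight t p s (k + 2) =
      (1 - p * t) * (1 - p * s ^ 2) * evenWeight t (p * t ^ 2) s k := by
    intro k
    rw [evenWeight, evenWeight, Nat.add_div_right k two_pos, Finset.prod_range_succ']
    rw [mul_comm]
    congr 1
    · simp
    · refine Finset.prod_congr rfl fun j _ => ?_
      ring
  have e3 : splitFactor t (p * s) S J * (∏ i ∈ J, hopFactor t i (t * (p * s))) *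
      ∏ i ∈ J, hopFactor t i (p * s) = splitFactor t (p * t ^ 2 * s) S J := by
    have : ∏ z ∈ J, (z - p * t ^ 2 * s) = (∏ z ∈ J, (z - p * s)) *
        (∏ i ∈ J, hopFactor t i (t * (p * s))) * ∏ i ∈ J, hopFactor t i (p * s) := by
      rw [← Finset.prod_mul_distrib, ← Finset.prod_mul_distrib]
      refine Finset.prod_congr rfl fun z hz => ?_
      have a1 : z - p * s ≠ 0 := sub_ne_zero.mpr fun e =>
        h1 (e ▸ Finset.mem_insert_of_mem (hJ' hz))
      have a2 : z - t * (p * s) ≠ 0 := sub_ne_zero.mpr fun e => h2 (e ▸ hJ' hz)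
      have a3 : z - p * t * s ≠ 0 := fun e => a2 (by linear_combination e)
      rw [hopFactor, hopFactor]
      field_simp
    rw [splitFactor, splitFactor, this]
    ring
  rw [e1, e2, e3]
  ring

-- This is an entry of the Schur complement of the `2 × 2` block of the parameters `a` and `t a`.
-- For `a = p s` and `B = (1 - p t) (1 - p s ^ 2)`, the coefficient on the right is `(1 - p t ^ 3)
-- (1 - p t ^ 2 s ^ 2)`, so the right-hand side is the pair weight with shift `p t ^ 2`.
set_option maxRecDepth 20000 in
set_option maxHeartbeats 1000000 in
theorem schur_scalar_identity (t a B z w : ℂ) (hab : a - t * a ≠ 0)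
    (hza : z - a ≠ 0) (hzb : z - t * a ≠ 0) (hwa : w - a ≠ 0) (hwb : w - t * a ≠ 0)
    (hzw : z - w ≠ 0) (h1 : 1 - z * w ≠ 0) (h2 : 1 - t * a * z ≠ 0) (h3 : 1 - t * a * w ≠ 0) :
    ((1 - t) * (z - a) * (w - a) + B * (1 - z * w)) / (1 - z * w) *
        (crossFactor t z a * crossFactor t w a * (crossFactor t z (t * a) *
          crossFactor t w (t * a))) -
      ((1 - t) * (t * a - a) * (w - a) + B * (1 - t * a * w)) / (1 - t * a * w) *
        (crossFactor t z (t * a) * crossFactor t a (t * a) * crossFactor t w a *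
          crossFactor t z w) -
      ((1 - t) * (z - a) * (t * a - a) + B * (1 - z * (t * a))) / (1 - z * (t * a)) *
        (crossFactor t z a * crossFactor t (t * a) a * crossFactor t w (t * a) *
          crossFactor t z w) =
    ((1 - t) * (z - a * t ^ 2) * (w - a * t ^ 2) +
      (1 - t ^ 2 + t ^ 2 * B + a ^ 2 * t ^ 3 * (t ^ 2 - 1)) * (1 - z * w)) / (1 - z * w) := by
  have hab' : t * a - a ≠ 0 := fun e => hab (by linear_combination -e)
  have h2' : 1 - z * (t * a) ≠ 0 := fun e => h2 (by linear_combination e)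
  have h4 : 1 - t * z * a ≠ 0 := fun e => h2 (by linear_combination e)
  have h5 : 1 - t * w * a ≠ 0 := fun e => h3 (by linear_combination e)
  have ht : t - 1 ≠ 0 := fun e => hab (by linear_combination -a * e)
  have ha : a ≠ 0 := fun e => hab (by rw [e]; ring)
  have ht' : 1 - t ≠ 0 := fun e => ht (by linear_combination -e)
  have e1 : crossFactor t a (t * a) = (1 - t ^ 2 * a ^ 2) / (a * (1 - t)) := by
    rw [crossFactor]; congr 1 <;> ring
  have e2 : crossFactor t (t * a) a = -((1 - t ^ 2 * a ^ 2) / (a * (1 - t))) := by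
    rw [crossFactor_antisymm, e1]
  have e3 : crossFactor t z (t * a) = (1 - t ^ 2 * a * z) / (z - t * a) := by
    rw [crossFactor]; congr 1; ring
  have e4 : crossFactor t w (t * a) = (1 - t ^ 2 * a * w) / (w - t * a) := by
    rw [crossFactor]; congr 1; ring
  have e5 : crossFactor t z a = (1 - t * a * z) / (z - a) := by
    rw [crossFactor]; congr 1; ring
  have e6 : crossFactor t w a = (1 - t * a * w) / (w - a) := by
    rw [crossFactor]; congr 1; ring
  have e7 : 1 - z * (t * a) = 1 - t * a * z := by ring
  rw [e1, e2, e3, e4, e5, e6, e7, crossFactor]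
  field_simp
  ring

/-- The spectral parameters for which the shift of the column increases by two. -/
theorem matchingSum_special {t p s a : ℂ} (ha : a = p * s) {S : Finset ℂ}
    (haS : a ∉ S) (hbS : t * a ∉ S) (hab : a ≠ t * a) (hab' : 1 - a * (t * a) ≠ 0)
    (h1 : ∀ z ∈ S, 1 - a * z ≠ 0) (h2 : ∀ z ∈ S, 1 - t * a * z ≠ 0)
    (h3 : ∀ z ∈ S, 1 - t * (t * a) * z ≠ 0) (hS : ∀ z ∈ S, ∀ w ∈ S, 1 - z * w ≠ 0) :
    matchingSum t (shiftedNumerator t p s) (insert a (insert (t * a) S)) =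
      (1 - p * t) * (1 - p * s ^ 2) * matchingSum t (shiftedNumerator t (p * t ^ 2) s) S := by
  set k := shiftedNumerator t p s with hk
  have hks : ∀ x y, k x y = k y x := shiftedNumerator_symm t p s
  have hks' : ∀ x y, shiftedNumerator t (p * t ^ 2) s x y = shiftedNumerator t (p * t ^ 2) s y x :=
    shiftedNumerator_symm t (p * t ^ 2) s
  set B := (1 - p * t) * (1 - p * s ^ 2) with hB
  have hka : ∀ z, 1 - a * z ≠ 0 → pairWeight k a z = B := by
    intro z hz
    rw [pairWeight, hk, shiftedNumerator, ← ha, sub_self, mul_zero, zero_mul, zero_add,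
      mul_div_assoc, div_self hz, mul_one]
  -- All pair weights along `a` equal `B`, so both sides vanish with `B`. Otherwise `B` can be
  -- cancelled in `t2`.
  rcases eq_or_ne B 0 with hB0 | hB0
  · rw [matchingSum_insert t hks (by simp [hab, haS]), hB0, zero_mul]
    refine Finset.sum_eq_zero fun y hy => ?_
    rw [hka y, hB0, zero_mul, zero_mul]
    rcases Finset.mem_insert.mp hy with rfl | hy
    · exact hab'
    · exact h1 y hy
  induction S using Finset.strongInduction with
  | H S ih =>
  rcases S.eq_empty_or_nonempty with rfl | ⟨z, hz⟩
  · rw [matchingSum_insert t hks (by simpa using hab), matchingSum_empty, ← hka _ hab']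
    simp [matchingSum_empty]
  obtain ⟨R, hzR, rfl⟩ : ∃ R, z ∉ R ∧ S = insert z R :=
    ⟨S.erase z, Finset.notMem_erase _ _, (Finset.insert_erase hz).symm⟩
  simp only [Finset.mem_insert, forall_eq_or_imp, not_or] at haS hbS h1 h2 h3 hS
  have hzb : z ∉ insert (t * a) R := by simp [hzR, Ne.symm hbS.1]
  have hzab : z ∉ insert a (insert (t * a) R) := by simp [hzR, Ne.symm hbS.1, Ne.symm haS.1]
  have haR : a ∉ insert (t * a) R := by simp [hab, haS.2]
  have hbR : t * a ∉ insert a R := by simp [hab.symm, hbS.2]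
  have nea : ∀ w ∈ R, a ≠ w := fun w hw e => haS.2 (e ▸ hw)
  have neb : ∀ w ∈ R, t * a ≠ w := fun w hw e => hbS.2 (e ▸ hw)
  have haE : ∀ w, a ∉ R.erase w := fun w h => haS.2 (Finset.mem_of_mem_erase h)
  have hbE : ∀ w, t * a ∉ R.erase w := fun w h => hbS.2 (Finset.mem_of_mem_erase h)
  have ih' : ∀ w ∈ R, B * matchingSum t (shiftedNumerator t (p * t ^ 2) s) (R.erase w) =
      matchingSum t k (insert a (insert (t * a) (R.erase w))) := by
    intro w hw
    have hsub := Finset.erase_subset w R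
    refine (ih (R.erase w) ?_ (haE w) (hbE w) (fun v hv => h1.2 v (hsub hv))
      (fun v hv => h2.2 v (hsub hv)) (fun v hv => h3.2 v (hsub hv))
      fun v hv v' hv' => (hS.2 v (hsub hv)).2 v' (hsub hv')).symm
    exact lt_of_lt_of_le (Finset.erase_ssubset hw) (Finset.subset_insert _ _)
  have cb : ∀ w ∈ R, crossFactor t (t * a) w ≠ 0 := fun w hw =>
    div_ne_zero (h3.2 w hw) (sub_ne_zero.mpr (neb w hw))
  have ca : ∀ w ∈ R, crossFactor t a w ≠ 0 := fun w hw =>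
    div_ne_zero (h2.2 w hw) (sub_ne_zero.mpr (nea w hw))
  -- The vanishing expansion with `t * a` repeated, and below the one with `a` repeated, express the
  -- matching sums that lack one of the two parameters through those that contain both.
  have repb : B * (∏ v ∈ R, crossFactor t (t * a) v * crossFactor t a v) *
      crossFactor t a (t * a) * matchingSum t k (insert (t * a) R) +
      ∑ w ∈ R, pairWeight k (t * a) w * (crossFactor t (t * a) a * crossFactor t w a *
        ∏ v ∈ R.erase w, crossFactor t (t * a) v * crossFactor t w v) * crossFactor t w (t * a) *
        matchingSum t k (insert a (insert (t * a) (R.erase w))) = 0 := by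
    have h := pairSum_repeated (pairWeight_symm hks) (crossFactor_antisymm t) (insert a R)
      (t * a) hbR
    rw [Finset.sum_insert haS.2, Finset.erase_insert haS.2, pairWeight_symm hks, hka _ hab'] at h
    rw [← h]
    congr 1
    refine Finset.sum_congr rfl fun w hw => ?_
    rw [Finset.erase_insert_of_ne (nea w hw), Finset.prod_insert (haE w), Finset.insert_comm,
      matchingSum]
  have repa : B * (∏ v ∈ R, crossFactor t a v * crossFactor t (t * a) v) *
      crossFactor t (t * a) a * matchingSum t k (insert a R) +
      ∑ w ∈ R, B * (crossFactor t a (t * a) * crossFactor t w (t * a) *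
        ∏ v ∈ R.erase w, crossFactor t a v * crossFactor t w v) * crossFactor t w a *
        matchingSum t k (insert a (insert (t * a) (R.erase w))) = 0 := by
    have h := pairSum_repeated (pairWeight_symm hks) (crossFactor_antisymm t)
      (insert (t * a) R) a haR
    rw [Finset.sum_insert hbS.2, Finset.erase_insert hbS.2, hka _ hab'] at h
    rw [← h]
    congr 1
    refine Finset.sum_congr rfl fun w hw => ?_
    rw [Finset.erase_insert_of_ne (neb w hw), Finset.prod_insert (hbE w),
      hka w (h1.2 w hw), matchingSum]
  have t1 : pairWeight k z a * (∏ v ∈ insert (t * a) R, crossFactor t z v * crossFactor t a v) *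
      matchingSum t k (insert (t * a) R) = ∑ w ∈ R, -(pairWeight k (t * a) w *
        (crossFactor t z (t * a) * crossFactor t a (t * a) * crossFactor t w a *
          crossFactor t z w)) * (∏ v ∈ R.erase w, crossFactor t z v * crossFactor t w v) *
        matchingSum t k (insert a (insert (t * a) (R.erase w))) := by
    have hP : ∏ v ∈ R, crossFactor t (t * a) v ≠ 0 := Finset.prod_ne_zero_iff.mpr cb
    refine mul_left_cancel₀ hP ?_
    rw [pairWeight_symm hks, hka z h1.1, Finset.prod_insert hbS.2, Finset.mul_sum]
    have e : ∀ w ∈ R, (∏ v ∈ R, crossFactor t (t * a) v) * (-(pairWeight k (t * a) w *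
        (crossFactor t z (t * a) * crossFactor t a (t * a) * crossFactor t w a *
          crossFactor t z w)) * (∏ v ∈ R.erase w, crossFactor t z v * crossFactor t w v) *
        matchingSum t k (insert a (insert (t * a) (R.erase w)))) =
        -(crossFactor t z (t * a) * ∏ v ∈ R, crossFactor t z v) *
        (pairWeight k (t * a) w * (crossFactor t (t * a) a * crossFactor t w a *
        (∏ v ∈ R.erase w, crossFactor t (t * a) v * crossFactor t w v)) * crossFactor t w (t * a) *
        matchingSum t k (insert a (insert (t * a) (R.erase w)))) := by
      intro w hw
      rw [← Finset.mul_prod_erase R _ hw, ← Finset.mul_prod_erase R _ hw,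
        crossFactor_antisymm t (t * a) w, crossFactor_antisymm t (t * a) a]
      simp only [Finset.prod_mul_distrib]
      ring
    rw [Finset.sum_congr rfl e, ← Finset.mul_sum]
    simp only [Finset.prod_mul_distrib] at repb ⊢
    linear_combination crossFactor t z (t * a) * (∏ v ∈ R, crossFactor t z v) * repb
  have t2 : pairWeight k z (t * a) * (∏ v ∈ insert a R, crossFactor t z v *
      crossFactor t (t * a) v) * matchingSum t k (insert a R) =
      ∑ w ∈ R, -(pairWeight k z (t * a) *
        (crossFactor t z a * crossFactor t (t * a) a * crossFactor t w (t * a) *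
          crossFactor t z w)) * (∏ v ∈ R.erase w, crossFactor t z v * crossFactor t w v) *
        matchingSum t k (insert a (insert (t * a) (R.erase w))) := by
    have hP : B * ∏ v ∈ R, crossFactor t a v ≠ 0 :=
      mul_ne_zero hB0 (Finset.prod_ne_zero_iff.mpr ca)
    refine mul_left_cancel₀ hP ?_
    rw [Finset.prod_insert haS.2, Finset.mul_sum]
    have e : ∀ w ∈ R, (B * ∏ v ∈ R, crossFactor t a v) * (-(pairWeight k z (t * a) *
        (crossFactor t z a * crossFactor t (t * a) a * crossFactor t w (t * a) *
          crossFactor t z w)) * (∏ v ∈ R.erase w, crossFactor t z v * crossFactor t w v) *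
        matchingSum t k (insert a (insert (t * a) (R.erase w)))) =
        -(pairWeight k z (t * a) * crossFactor t z a * ∏ v ∈ R, crossFactor t z v) *
        (B * (crossFactor t a (t * a) * crossFactor t w (t * a) *
        ∏ v ∈ R.erase w, crossFactor t a v * crossFactor t w v) * crossFactor t w a *
        matchingSum t k (insert a (insert (t * a) (R.erase w)))) := by
      intro w hw
      rw [← Finset.mul_prod_erase R _ hw, ← Finset.mul_prod_erase R _ hw,
        crossFactor_antisymm t a w, crossFactor_antisymm t (t * a) a]
      simp only [Finset.prod_mul_distrib]
      ring
    rw [Finset.sum_congr rfl e, ← Finset.mul_sum]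
    simp only [Finset.prod_mul_distrib] at repa ⊢
    linear_combination pairWeight k z (t * a) * crossFactor t z a *
      (∏ v ∈ R, crossFactor t z v) * repa
  have hcomm : insert a (insert (t * a) (insert z R)) = insert z (insert a (insert (t * a) R)) := by
    ext v
    simp only [Finset.mem_insert]
    tauto
  rw [hcomm, matchingSum_insert t hks hzab, Finset.sum_insert haR, Finset.erase_insert haR,
    Finset.sum_insert hbS.2, Finset.erase_insert_of_ne hab, Finset.erase_insert hbS.2, t1, t2,
    matchingSum_insert t hks' hzR, Finset.mul_sum, ← Finset.sum_add_distrib,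
    ← Finset.sum_add_distrib]
  -- All terms of the expansion along `z` are now multiples of the matching sums of `a`, `t a` and
  -- `R.erase w`, so the claim can be compared for each `w` separately.
  refine Finset.sum_congr rfl fun w hw => ?_
  have hzw : z ≠ w := fun e => hzR (e ▸ hw)
  have key := schur_scalar_identity t a B z w (sub_ne_zero.mpr hab)
    (sub_ne_zero.mpr (Ne.symm haS.1)) (sub_ne_zero.mpr (Ne.symm hbS.1))
    (sub_ne_zero.mpr (nea w hw).symm) (sub_ne_zero.mpr (neb w hw).symm) (sub_ne_zero.mpr hzw)
    (hS.1.2 w hw) h2.1 (h2.2 w hw)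
  have e1 : pairWeight (shiftedNumerator t (p * t ^ 2) s) z w =
      ((1 - t) * (z - a * t ^ 2) * (w - a * t ^ 2) +
      (1 - t ^ 2 + t ^ 2 * B + a ^ 2 * t ^ 3 * (t ^ 2 - 1)) * (1 - z * w)) / (1 - z * w) := by
    rw [pairWeight, shiftedNumerator, hB, ha]
    congr 1
    ring
  have e2 : pairWeight k z w = ((1 - t) * (z - a) * (w - a) + B * (1 - z * w)) / (1 - z * w) := by
    rw [pairWeight, hk, shiftedNumerator, ← ha, hB]
  have e3 : pairWeight k (t * a) w =
      ((1 - t) * (t * a - a) * (w - a) + B * (1 - t * a * w)) / (1 - t * a * w) := by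
    rw [pairWeight, hk, shiftedNumerator, ← ha, hB]
  have e4 : pairWeight k z (t * a) =
      ((1 - t) * (z - a) * (t * a - a) + B * (1 - z * (t * a))) / (1 - z * (t * a)) := by
    rw [pairWeight, hk, shiftedNumerator, ← ha, hB]
  rw [← e1, ← e2, ← e3, ← e4] at key
  have e5 : (insert a (insert (t * a) R)).erase w = insert a (insert (t * a) (R.erase w)) := by
    rw [Finset.erase_insert_of_ne (nea w hw), Finset.erase_insert_of_ne (neb w hw)]
  have e6 : a ∉ insert (t * a) (R.erase w) := by simp [hab, haE w]
  rw [e5, Finset.prod_insert e6, Finset.prod_insert (hbE w)]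
  linear_combination (∏ v ∈ R.erase w, crossFactor t z v * crossFactor t w v) *
    matchingSum t k (insert a (insert (t * a) (R.erase w))) * key - (pairWeight (shiftedNumerator t (p * t ^ 2) s) z w) *
    (∏ v ∈ R.erase w, crossFactor t z v * crossFactor t w v) * ih' w hw

theorem continuous_shiftedNumerator (t p s y : ℂ) :
    Continuous fun x => shiftedNumerator t p s x y := by
  unfold shiftedNumerator
  fun_prop

/-- If the identity for fewer variables holds, then it holds for `n + 2` variables as soon as it
holds for one special value of one of them. -/
theorem columnSum_eq_of_special {t p s : ℂ} {n : ℕ}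
    (ih : ∀ S : Finset ℂ, S.card = 2 * n → (∀ x ∈ S, ∀ y ∈ S, 1 - x * y ≠ 0) →
      columnSum t p s S = matchingSum t (shiftedNumerator t p s) S)
    {A : Finset ℂ} (hA : A.card = 2 * n + 1) (h0 : (0 : ℂ) ∉ A)
    (hA' : ∀ x ∈ A, ∀ y ∈ A, 1 - x * y ≠ 0) {a : ℂ} (ha : a ∉ A) (ha' : ∀ y ∈ A, 1 - a * y ≠ 0)
    (h : columnSum t p s (insert a A) = matchingSum t (shiftedNumerator t p s) (insert a A))
    {x : ℂ} (hx : x ∉ A) (hx' : ∀ y ∈ A, 1 - x * y ≠ 0) :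
    columnSum t p s (insert x A) = matchingSum t (shiftedNumerator t p s) (insert x A) := by
  have hk := shiftedNumerator_symm t p s
  have hkc := continuous_shiftedNumerator t p s
  have tame : IsTame A (fun x => columnSum t p s (insert x A) -
      matchingSum t (shiftedNumerator t p s) (insert x A)) := by
    refine (isTame_columnSum t p s A).sub ((isTame_matchingSum t hk A (fun _ => 1) fun y =>
      ⟨(1 - t) * (y - p * s) - (1 - p * t) * (1 - p * s ^ 2) * y,
        -(p * s) * (1 - t) * (y - p * s) + (1 - p * t) * (1 - p * s ^ 2), fun x => ?_⟩).congr
        fun x _ _ => (one_mul _).symm)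
    rw [shiftedNumerator]
    ring
  refine sub_eq_zero.mp (tame.eq_zero h0 hA' ?_ ?_ ha ha' (sub_eq_zero.mpr h) hx hx')
  · intro y hy
    have hy' := Finset.insert_erase hy
    have hg : ∀ z ∈ insert y (A.erase y), 1 - y * z ≠ 0 := fun z hz => hA' y hy z (hy' ▸ hz)
    have h1 := tendsto_sub_mul_columnSum t p s (Finset.notMem_erase y A) hg
    have h2 := tendsto_sub_mul_matchingSum t hk hkc (Finset.notMem_erase y A) hg
    rw [hy'] at h1 h2
    simpa only [mul_sub, sub_zero] using h1.sub h2
  · intro y hy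
    have hy' := Finset.insert_erase hy
    have hy0 : y ≠ 0 := fun e => h0 (e ▸ hy)
    have hg : ∀ z ∈ insert y (A.erase y), 1 - y * z ≠ 0 := fun z hz => hA' y hy z (hy' ▸ hz)
    have h1 := tendsto_one_sub_mul_columnSum t p s (Finset.notMem_erase y A) hy0 hg
    have h2 := tendsto_one_sub_mul_matchingSum t hk hkc (Finset.notMem_erase y A) hy0 hg
    have hcard := Finset.card_erase_add_one hy
    rw [hy', ih (A.erase y) (by omega) fun x hx z hz =>
      hA' x (Finset.mem_of_mem_erase hx) z (Finset.mem_of_mem_erase hz)] at h1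
    rw [hy'] at h2
    have h3 := h1.sub h2
    simp only [← mul_sub] at h3
    refine tendsto_of_tendsto_of_eq h3 ?_
    -- At `x = y⁻¹` the second summand of `shiftedNumerator` vanishes; the first is the coefficient
    -- in the residue of the column sum.
    rw [shiftedNumerator, inv_mul_cancel₀ hy0]
    ring

/-- The identity between the column sum and the matching sum, for generic `s`. -/
theorem columnSum_eq_of_generic {t : ℂ} {n : ℕ}
    (ih : ∀ p : ℂ, p ≠ 0 → ∀ s : ℂ, ∀ S : Finset ℂ, S.card = 2 * n →
      (∀ x ∈ S, ∀ y ∈ S, 1 - x * y ≠ 0) →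
      columnSum t p s S = matchingSum t (shiftedNumerator t p s) S)
    (ht0 : t ≠ 0) {p s x y : ℂ} (hp : p ≠ 0) {R : Finset ℂ} (hR : R.card = 2 * n)
    (hxy : x ∉ insert y R) (hy : y ∉ R) (h0 : (0 : ℂ) ∉ insert y R)
    (hgood : ∀ z ∈ insert x (insert y R), ∀ w ∈ insert x (insert y R), 1 - z * w ≠ 0)
    (ha0 : p * s ≠ 0) (haR : p * s ∉ insert y R) (hbR : t * (p * s) ∉ insert y R)
    (hab : p * s ≠ t * (p * s)) (haa : 1 - (p * s) * (p * s) ≠ 0)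
    (hab' : 1 - (p * s) * (t * (p * s)) ≠ 0) (h1 : ∀ z ∈ insert y R, 1 - p * s * z ≠ 0)
    (h2 : ∀ z ∈ insert y R, 1 - t * (p * s) * z ≠ 0)
    (h3 : ∀ z ∈ insert y R, 1 - t * (t * (p * s)) * z ≠ 0) :
    columnSum t p s (insert x (insert y R)) =
      matchingSum t (shiftedNumerator t p s) (insert x (insert y R)) := by
  set a := p * s with ha
  have hgood' : ∀ z ∈ insert y R, ∀ w ∈ insert y R, 1 - z * w ≠ 0 := fun z hz w hw =>
    hgood z (Finset.mem_insert_of_mem hz) w (Finset.mem_insert_of_mem hw)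
  have hgoodR : ∀ z ∈ R, ∀ w ∈ R, 1 - z * w ≠ 0 := fun z hz w hw =>
    hgood' z (Finset.mem_insert_of_mem hz) w (Finset.mem_insert_of_mem hw)
  have haR' : a ∉ R := fun h => haR (Finset.mem_insert_of_mem h)
  have hbR' : t * a ∉ R := fun h => hbR (Finset.mem_insert_of_mem h)
  have hay : a ≠ y := fun h => haR (h ▸ Finset.mem_insert_self _ _)
  -- Here the shift changes to `p t ^ 2`, which is why the induction hypothesis ranges over all
  -- nonzero shifts.
  have special : columnSum t p s (insert (t * a) (insert a R)) =
      matchingSum t (shiftedNumerator t p s) (insert (t * a) (insert a R)) := by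
    rw [Finset.insert_comm, matchingSum_special ha haR' hbR' hab hab'
      (fun z hz => h1 z (Finset.mem_insert_of_mem hz))
      (fun z hz => h2 z (Finset.mem_insert_of_mem hz))
      (fun z hz => h3 z (Finset.mem_insert_of_mem hz)) hgoodR,
      ← ih (p * t ^ 2) (mul_ne_zero hp (pow_ne_zero _ ht0)) s R hR hgoodR]
    exact columnSum_special t p s (by simp [← ha, hab, haR']) hbR'
  have goodA : ∀ z ∈ insert a R, ∀ w ∈ insert a R, 1 - z * w ≠ 0 := by
    intro z hz w hw
    rcases Finset.mem_insert.mp hz with rfl | hz <;> rcases Finset.mem_insert.mp hw with rfl | hw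
    · exact haa
    · exact h1 w (Finset.mem_insert_of_mem hw)
    · rw [mul_comm]
      exact h1 z (Finset.mem_insert_of_mem hz)
    · exact hgoodR z hz w hw
  -- The pair `t a`, `a` is deformed into `x`, `y` one variable at a time: here `t a` is replaced by
  -- `y` with `a` fixed, and afterwards `a` by `x` with `y` fixed.
  have step1 : columnSum t p s (insert a (insert y R)) =
      matchingSum t (shiftedNumerator t p s) (insert a (insert y R)) := by
    rw [Finset.insert_comm]
    refine columnSum_eq_of_special (ih p hp s) (by rw [Finset.card_insert_of_notMem haR', hR])
      ?_ goodA (by simp [hab.symm, hbR']) ?_ special (by simp [hay.symm, hy]) ?_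
    · rw [Finset.mem_insert, not_or]
      exact ⟨ha0.symm, fun h => h0 (Finset.mem_insert_of_mem h)⟩
    · intro z hz
      rcases Finset.mem_insert.mp hz with rfl | hz
      · rwa [mul_comm]
      · exact h2 z (Finset.mem_insert_of_mem hz)
    · intro z hz
      rcases Finset.mem_insert.mp hz with rfl | hz
      · rw [mul_comm]
        exact h1 y (Finset.mem_insert_self _ _)
      · exact hgood' y (Finset.mem_insert_self _ _) z (Finset.mem_insert_of_mem hz)
  exact columnSum_eq_of_special (ih p hp s) (by rw [Finset.card_insert_of_notMem hy, hR]) h0 hgood'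
    haR h1 step1 hxy fun z hz => hgood x (Finset.mem_insert_self _ _) z (Finset.mem_insert_of_mem hz)

theorem continuous_columnSum (t p : ℂ) (S : Finset ℂ) : Continuous fun s => columnSum t p s S := by
  unfold columnSum evenWeight splitFactor
  fun_prop

theorem continuous_matchingSum_shiftedNumerator (t p : ℂ) (S : Finset ℂ) :
    Continuous fun s => matchingSum t (shiftedNumerator t p s) S := by
  refine continuous_pairSum (crossFactor_antisymm t)
    (m := fun s => pairWeight (shiftedNumerator t p s))
    (fun s => pairWeight_symm (shiftedNumerator_symm t p s)) (fun x y => ?_) S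
  unfold pairWeight shiftedNumerator
  fun_prop

-- Each of the conditions excludes only finitely many `σ`.
open Filter Topology in
theorem eventually_generic {t p : ℂ} (ht0 : t ≠ 0) (ht1 : t ≠ 1) (hp : p ≠ 0) (s : ℂ)
    (A : Finset ℂ) : ∀ᶠ σ in 𝓝[≠] s, p * σ ≠ 0 ∧ p * σ ∉ A ∧ t * (p * σ) ∉ A ∧
      p * σ ≠ t * (p * σ) ∧ 1 - (p * σ) * (p * σ) ≠ 0 ∧ 1 - (p * σ) * (t * (p * σ)) ≠ 0 ∧
      (∀ z ∈ A, 1 - p * σ * z ≠ 0) ∧ (∀ z ∈ A, 1 - t * (p * σ) * z ≠ 0) ∧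
      ∀ z ∈ A, 1 - t * (t * (p * σ)) * z ≠ 0 := by
  have mul_ev : ∀ c : ℂ, c ≠ 0 → ∀ᶠ σ in 𝓝[≠] s, c * σ ∉ A := by
    intro c hc
    filter_upwards [eventually_notMem (A.image fun z => z / c) s] with σ hσ h
    exact hσ (Finset.mem_image.mpr ⟨_, h, by field_simp⟩)
  have inv_ev : ∀ c : ℂ, ∀ᶠ σ in 𝓝[≠] s, ∀ z ∈ A, 1 - σ * (c * z) ≠ 0 := by
    intro c
    filter_upwards [eventually_notMem (A.image fun z => (c * z)⁻¹) s] with σ hσ z hz h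
    exact hσ (Finset.mem_image.mpr ⟨z, hz,
      (eq_inv_of_mul_eq_one_left (sub_eq_zero.mp h).symm).symm⟩)
  have sq_ev : ∀ c : ℂ, c ≠ 0 → ∀ᶠ σ in 𝓝[≠] s, 1 - c * σ ^ 2 ≠ 0 := by
    intro c hc
    filter_upwards [eventually_notMem (Polynomial.nthRoots 2 (1 / c)).toFinset s] with σ hσ h
    refine hσ (Multiset.mem_toFinset.mpr ((Polynomial.mem_nthRoots two_pos).mpr ?_))
    field_simp
    linear_combination -h
  have zero_ev : ∀ᶠ σ in 𝓝[≠] s, σ ≠ 0 := by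
    filter_upwards [eventually_notMem {0} s] with σ hσ
    simpa using hσ
  filter_upwards [zero_ev, mul_ev p hp, mul_ev (t * p) (mul_ne_zero ht0 hp),
    sq_ev (p ^ 2) (pow_ne_zero _ hp), sq_ev (t * p ^ 2) (mul_ne_zero ht0 (pow_ne_zero _ hp)),
    inv_ev p, inv_ev (t * p), inv_ev (t * t * p)] with σ h0 h1 h2 h3 h4 h5 h6 h7
  refine ⟨mul_ne_zero hp h0, h1, by rwa [← mul_assoc], fun e => ?_, fun e => h3 ?_, fun e => h4 ?_,
    fun z hz e => h5 z hz ?_, fun z hz e => h6 z hz ?_, fun z hz e => h7 z hz ?_⟩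
  · have : (p * σ) * (t - 1) = 0 := by linear_combination -e
    exact (mul_ne_zero (mul_ne_zero hp h0) (sub_ne_zero.mpr ht1)) this
  all_goals linear_combination e

-- Both sides are continuous in `s` when the set is fixed, so it suffices to treat `σ` in a
-- punctured neighbourhood of `s`, where the generic case applies. The condition `t ≠ 0` keeps `p t
-- ^ 2` nonzero, and `t ≠ 1` separates `p σ` from `t p σ`.
open Filter Topology in
theorem columnSum_eq_matchingSum {t : ℂ} (ht0 : t ≠ 0) (ht1 : t ≠ 1) {p : ℂ} (hp : p ≠ 0) (s : ℂ)
    {S : Finset ℂ} (hS : Even S.card) (hgood : ∀ x ∈ S, ∀ y ∈ S, 1 - x * y ≠ 0) :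
    columnSum t p s S = matchingSum t (shiftedNumerator t p s) S := by
  obtain ⟨n, hn⟩ := hS
  rw [← two_mul] at hn
  induction n generalizing p s S with
  | zero =>
    have : S = ∅ := by simpa using hn
    subst this
    simp [columnSum, evenWeight, splitFactor, matchingSum_empty]
  | succ n ih =>
    -- The variables kept fixed must have inverses, so a possible zero is chosen as the last
    -- variable `x` to be moved.
    obtain ⟨x, hx, hx0⟩ : ∃ x ∈ S, (0 : ℂ) ∉ S.erase x := by
      by_cases h : (0 : ℂ) ∈ S
      · exact ⟨0, h, Finset.notMem_erase _ _⟩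
      · obtain ⟨x, hx⟩ : S.Nonempty := Finset.card_pos.mp (by omega)
        exact ⟨x, hx, fun h' => h (Finset.mem_of_mem_erase h')⟩
    have hc1 := Finset.card_erase_add_one hx
    obtain ⟨y, hy⟩ : (S.erase x).Nonempty := Finset.card_pos.mp (by omega)
    have hc2 := Finset.card_erase_add_one hy
    have ey := Finset.insert_erase hy
    have ex := Finset.insert_erase hx
    set R := (S.erase x).erase y with hR
    have hyR : y ∉ R := Finset.notMem_erase _ _
    have hxR : x ∉ insert y R := by rw [ey]; exact Finset.notMem_erase _ _
    have hSe : S = insert x (insert y R) := by rw [ey, ex]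
    have hx0' : (0 : ℂ) ∉ insert y R := by rwa [ey]
    clear_value R
    subst hSe
    have ev : ∀ᶠ σ in 𝓝[≠] s, columnSum t p σ (insert x (insert y R)) =
        matchingSum t (shiftedNumerator t p σ) (insert x (insert y R)) := by
      filter_upwards [eventually_generic ht0 ht1 hp s (insert y R)] with σ hσ
      obtain ⟨h0, h1, h2, h3, h4, h5, h6, h7, h8⟩ := hσ
      rw [Finset.card_insert_of_notMem hxR, Finset.card_insert_of_notMem hyR] at hn
      exact columnSum_eq_of_generic (fun p hp s S hS hg => ih hp s hg hS) ht0 hp (by omega) hxR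
        hyR hx0' hgood h0 h1 h2 h3 h4 h5 h6 h7 h8
    have t1 := ((continuous_columnSum t p (insert x (insert y R))).tendsto s).mono_left
      (nhdsWithin_le_nhds (s := {s}ᶜ))
    have t2 := ((continuous_matchingSum_shiftedNumerator t p (insert x (insert y R))).tendsto s
      ).mono_left (nhdsWithin_le_nhds (s := {s}ᶜ))
    exact tendsto_nhds_unique (t1.congr' ev) t2

/-! ### Sums over even states and their recursion over columns -/

/-- The coefficient of a state with `2 k` paths in a column. -/
def columnCoeff (t κ s₀ : ℂ) (k : ℕ) : ℂ :=
  ∏ j ∈ Finset.Icc 1 k, (1 - s₀ ^ 2 * κ * t ^ (2 * j - 2)) / (1 - κ * t ^ (2 * j))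

/-- The weighted sum of `φ` over the lists of length `L` with even entries at most `2 n`. -/
def evenSum (t : ℂ) (n : ℕ) : ℂ → (ℕ → ℂ) → ℕ → (List ℕ → ℂ) → ℂ
  | _, _, 0, φ => φ []
  | κ, s, L + 1, φ => ∑ k ∈ Finset.range (n + 1), columnCoeff t κ (s 0) k *
      evenSum t n 1 (fun x => s (x + 1)) L fun ν => φ (2 * k :: ν)

/-- The sum of the absolute values of the terms of `evenSum`. -/
def evenAbsSum (t : ℂ) (n : ℕ) : ℂ → (ℕ → ℂ) → ℕ → (List ℕ → ℂ) → ℝ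
  | _, _, 0, φ => ‖φ []‖
  | κ, s, L + 1, φ => ∑ k ∈ Finset.range (n + 1), ‖columnCoeff t κ (s 0) k‖ *
      evenAbsSum t n 1 (fun x => s (x + 1)) L fun ν => φ (2 * k :: ν)

theorem evenSum_sum {ι : Type*} (t : ℂ) (n : ℕ) (κ : ℂ) (s : ℕ → ℂ) (L : ℕ) (A : Finset ι)
    (c : ι → ℂ) (φ : ι → List ℕ → ℂ) :
    evenSum t n κ s L (fun ν => ∑ i ∈ A, c i * φ i ν) = ∑ i ∈ A, c i * evenSum t n κ s L (φ i) := by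
  induction L generalizing κ s φ with
  | zero => rfl
  | succ L ih =>
    simp only [evenSum, ih, Finset.mul_sum]
    rw [Finset.sum_comm]
    exact Finset.sum_congr rfl fun i _ => Finset.sum_congr rfl fun k _ => by ring

theorem evenAbsSum_nonneg (t : ℂ) (n : ℕ) (κ : ℂ) (s : ℕ → ℂ) (L : ℕ) (φ : List ℕ → ℂ) :
    0 ≤ evenAbsSum t n κ s L φ := by
  induction L generalizing κ s φ with
  | zero => exact norm_nonneg _
  | succ L ih => exact Finset.sum_nonneg fun k _ => mul_nonneg (norm_nonneg _) (ih _ _ _)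

theorem evenAbsSum_sum_le {ι : Type*} (t : ℂ) (n : ℕ) (κ : ℂ) (s : ℕ → ℂ) (L : ℕ) (A : Finset ι)
    (c : ι → ℂ) (φ : ι → List ℕ → ℂ) :
    evenAbsSum t n κ s L (fun ν => ∑ i ∈ A, c i * φ i ν) ≤
      ∑ i ∈ A, ‖c i‖ * evenAbsSum t n κ s L (φ i) := by
  induction L generalizing κ s φ with
  | zero =>
    refine (norm_sum_le _ _).trans (Finset.sum_le_sum fun i _ => ?_)
    rw [norm_mul]
    rfl
  | succ L ih =>
    simp only [evenAbsSum, Finset.mul_sum]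
    rw [Finset.sum_comm]
    refine Finset.sum_le_sum fun k _ => ?_
    refine (mul_le_mul_of_nonneg_left (ih _ _ _) (norm_nonneg _)).trans ?_
    rw [Finset.mul_sum]
    exact Finset.sum_le_sum fun i _ => le_of_eq (by ring)

/-- The weight of a column in terms of sets of spectral parameters, summed with the coefficients of
the even states. -/
def columnWeight (t κ s₀ : ℂ) (S J : Finset ℂ) : ℂ :=
  if Even (S \ J).card then
    evenWeight t κ s₀ (S \ J).card * (∏ x ∈ S, (1 - s₀ * x)⁻¹) * splitFactor t (κ * s₀) S J
  else 0

/-- The denominators of the coefficient cancel the even powers of `t` among the factors `1 - κ t ^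
i` of the kernel, which leaves a polynomial weight. -/
theorem columnCoeff_mul_prod (t κ s₀ : ℂ) (k : ℕ)
    (h : ∀ j, 1 ≤ j → j ≤ k → 1 - κ * t ^ (2 * j) ≠ 0) :
    columnCoeff t κ s₀ k * ∏ j ∈ Finset.range (2 * k), (1 - κ * t ^ (j + 1)) =
      evenWeight t κ s₀ (2 * k) := by
  rw [evenWeight, Nat.mul_div_cancel_left k two_pos]
  induction k with
  | zero => simp [columnCoeff]
  | succ k ih =>
    have ih' := ih fun j h1 h2 => h j h1 (by omega)
    have h' := h (k + 1) (by omega) le_rfl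
    rw [columnCoeff] at ih' ⊢
    rw [Finset.prod_Icc_succ_top (by omega), show 2 * (k + 1) = 2 * k + 1 + 1 by ring,
      Finset.prod_range_succ, Finset.prod_range_succ, Finset.prod_range_succ _ k, ← ih']
    rw [show 2 * k + 1 + 1 - 2 = 2 * k by omega]
    rw [show 2 * (k + 1) = 2 * k + 1 + 1 by ring] at h'
    field_simp

theorem columnCoeff_mul_columnKernel {t κ s₀ : ℂ} {k : ℕ}
    (h : ∀ j, 1 ≤ j → j ≤ k → 1 - κ * t ^ (2 * j) ≠ 0) {S J : Finset ℂ}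
    (hk : (S \ J).card = 2 * k) :
    columnCoeff t κ s₀ k * columnKernel t κ s₀ S J = columnWeight t κ s₀ S J := by
  rw [columnWeight, if_pos (hk ▸ even_two_mul k), columnKernel, splitFactor, hk,
    ← columnCoeff_mul_prod t κ s₀ k h]
  ring

/-- At most one occupation number, `2 k = |S \ J|`, contributes. The general `G` serves the sums and
the sums of norms alike. -/
theorem sum_columnCoeff {M : Type*} [AddCommMonoid M] (G : ℂ → M) (hG : G 0 = 0) (t : ℂ) {n : ℕ}
    {κ : ℂ} (hκ : ∀ j, 1 ≤ j → j ≤ n → 1 - κ * t ^ (2 * j) ≠ 0) (s₀ : ℂ) {S : Finset ℂ}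
    (J : Finset ℂ) (hS : S.card ≤ 2 * n) :
    ∑ k ∈ Finset.range (n + 1), G (columnCoeff t κ s₀ k *
      (if (S \ J).card = 2 * k then columnKernel t κ s₀ S J else 0)) =
    G (columnWeight t κ s₀ S J) := by
  have hcard : (S \ J).card ≤ 2 * n := (Finset.card_le_card Finset.sdiff_subset).trans hS
  by_cases he : Even (S \ J).card
  · obtain ⟨k, hk⟩ := he
    rw [← two_mul] at hk
    rw [Finset.sum_eq_single k]
    · rw [if_pos hk, columnCoeff_mul_columnKernel (fun j h1 h2 => hκ j h1 (by omega)) hk]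
    · intro b _ hb
      rw [if_neg (by omega), mul_zero, hG]
    · intro hb
      exact absurd (Finset.mem_range.mpr (by omega)) hb
  · rw [columnWeight, if_neg he, hG]
    refine Finset.sum_eq_zero fun k _ => ?_
    rw [if_neg fun e => he (by rw [e]; exact even_two_mul k), mul_zero, hG]

theorem rowsOp_cons' {t κ : ℂ} {s : ℕ → ℂ} {us : List ℂ} (hus : us.Nodup)
    (h : ∀ u ∈ us, ∀ x, 1 - s x * u ≠ 0) (k : ℕ) : (fun ν => rowsOp t κ s us (k :: ν)) =
    fun ν => ∑ J ∈ us.toFinset.powerset,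
      (if (us.toFinset \ J).card = k then columnKernel t κ (s 0) us.toFinset J else 0) *
        rowsSet t (fun x => s (x + 1)) J ν := by
  funext ν
  rw [rowsOp_cons t κ s us hus h]
  refine Finset.sum_congr rfl fun J _ => ?_
  rw [ite_mul, zero_mul]

/-- The recursion of the partial sums of the partition function with respect to the columns. -/
theorem evenSum_rowsOp {t κ : ℂ} {n : ℕ} (hκ : ∀ j, 1 ≤ j → j ≤ n → 1 - κ * t ^ (2 * j) ≠ 0)
    {s : ℕ → ℂ} {us : List ℂ} (hus : us.Nodup) (h : ∀ u ∈ us, ∀ x, 1 - s x * u ≠ 0)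
    (hn : us.toFinset.card ≤ 2 * n) (L : ℕ) :
    evenSum t n κ s (L + 1) (rowsOp t κ s us) = ∑ J ∈ us.toFinset.powerset,
      columnWeight t κ (s 0) us.toFinset J *
        evenSum t n 1 (fun x => s (x + 1)) L (rowsSet t (fun x => s (x + 1)) J) := by
  simp only [evenSum, rowsOp_cons' hus h, evenSum_sum, Finset.mul_sum]
  rw [Finset.sum_comm]
  refine Finset.sum_congr rfl fun J _ => ?_
  have e := sum_columnCoeff (fun c => c) rfl t hκ (s 0) J hn
  beta_reduce at e
  rw [← e, Finset.sum_mul]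
  exact Finset.sum_congr rfl fun k _ => (mul_assoc _ _ _).symm

theorem evenAbsSum_rowsOp_le {t κ : ℂ} {n : ℕ}
    (hκ : ∀ j, 1 ≤ j → j ≤ n → 1 - κ * t ^ (2 * j) ≠ 0)
    {s : ℕ → ℂ} {us : List ℂ} (hus : us.Nodup) (h : ∀ u ∈ us, ∀ x, 1 - s x * u ≠ 0)
    (hn : us.toFinset.card ≤ 2 * n) (L : ℕ) :
    evenAbsSum t n κ s (L + 1) (rowsOp t κ s us) ≤ ∑ J ∈ us.toFinset.powerset,
      ‖columnWeight t κ (s 0) us.toFinset J‖ *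
        evenAbsSum t n 1 (fun x => s (x + 1)) L (rowsSet t (fun x => s (x + 1)) J) := by
  simp only [evenAbsSum, rowsOp_cons' hus h]
  refine (Finset.sum_le_sum fun k _ => mul_le_mul_of_nonneg_left
    (evenAbsSum_sum_le t n 1 _ L _ _ _) (norm_nonneg _)).trans (le_of_eq ?_)
  simp only [Finset.mul_sum]
  rw [Finset.sum_comm]
  refine Finset.sum_congr rfl fun J _ => ?_
  rw [← sum_columnCoeff (fun c => ‖c‖) norm_zero t hκ (s 0) J hn, Finset.sum_mul]
  exact Finset.sum_congr rfl fun k _ => by rw [norm_mul, mul_assoc]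

theorem rowsSet_eq_rowsOp (t : ℂ) (s : ℕ → ℂ) (K : Finset ℂ) :
    rowsSet t s K = rowsOp t 1 s K.toList := by
  rw [rowsOp_one t s _ K.nodup_toList, Finset.toList_toFinset]

theorem one_sub_ofReal_pow_ne_zero {t : ℝ} (ht0 : 0 < t) (ht1 : t < 1) {j : ℕ} (hj : 1 ≤ j) :
    1 - 1 * (t : ℂ) ^ (2 * j) ≠ 0 := by
  rw [one_mul, sub_ne_zero]
  have : t ^ (2 * j) < 1 := pow_lt_one₀ ht0.le ht1 (by omega)
  intro h
  have h' : (1 : ℝ) = t ^ (2 * j) := by exact_mod_cast h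
  linarith

/-! ### Convergence of the recursion -/

/-- The condition that ensures the convergence of the partition function. -/
def Admissible (U : Finset ℂ) (q : ℝ) (s : ℕ → ℂ) : Prop :=
  ∀ u ∈ U, ∀ x, 1 - s x * u ≠ 0 ∧ ‖(u - s x) / (1 - s x * u)‖ ≤ q

theorem Admissible.shift {U : Finset ℂ} {q : ℝ} {s : ℕ → ℂ} (h : Admissible U q s) :
    Admissible U q (fun x => s (x + 1)) := fun u hu x => h u hu (x + 1)

/-- If `u v = 1`, the numbers `(u - s) / (1 - s u)` and `(v - s) / (1 - s v)` are inverse to each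
other and cannot both have norm below one. -/
theorem Admissible.one_sub_mul_ne_zero {U : Finset ℂ} {q : ℝ} (hq : q < 1) {s : ℕ → ℂ}
    (h : Admissible U q s) {u v : ℂ} (hu : u ∈ U) (hv : v ∈ U) : 1 - u * v ≠ 0 := by
  intro e
  obtain ⟨h1, h2⟩ := h u hu 0
  obtain ⟨h3, h4⟩ := h v hv 0
  have e1 : (u - s 0) / (1 - s 0 * u) * ((v - s 0) / (1 - s 0 * v)) = 1 := by
    rw [div_mul_div_comm, div_eq_one_iff_eq (mul_ne_zero h1 h3)]
    linear_combination (s 0 ^ 2 - 1) * e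
  have e2 := congrArg norm e1
  rw [norm_mul, norm_one] at e2
  have := norm_nonneg ((u - s 0) / (1 - s 0 * u))
  have := norm_nonneg ((v - s 0) / (1 - s 0 * v))
  nlinarith

section Convergence

variable {t : ℝ} (ht0 : 0 < t) (ht1 : t < 1) {n : ℕ} {U : Finset ℂ} (hn : U.card ≤ 2 * n) {q : ℝ}
  (hq0 : 0 ≤ q) (hq1 : q < 1)

theorem columnWeight_self (t κ s₀ : ℂ) (K : Finset ℂ) :
    columnWeight t κ s₀ K K = ∏ x ∈ K, (x - κ * s₀) / (1 - s₀ * x) := by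
  rw [columnWeight, if_pos (by simp)]
  simp [evenWeight, splitFactor, div_eq_mul_inv, Finset.prod_mul_distrib, mul_comm]

include ht0 ht1

theorem evenSum_rowsSet {s : ℕ → ℂ} {K : Finset ℂ} (hK : K.card ≤ 2 * n)
    (h : ∀ u ∈ K, ∀ x, 1 - s x * u ≠ 0) (L : ℕ) :
    evenSum t n 1 s (L + 1) (rowsSet t s K) = ∑ J ∈ K.powerset,
      columnWeight t 1 (s 0) K J *
        evenSum t n 1 (fun x => s (x + 1)) L (rowsSet t (fun x => s (x + 1)) J) := by
  have := evenSum_rowsOp (t := t) (κ := 1) (n := n)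
    (fun j h1 _ => one_sub_ofReal_pow_ne_zero ht0 ht1 h1) (s := s) K.nodup_toList
    (by simpa using h) (by simpa using hK) L
  rwa [← rowsSet_eq_rowsOp, Finset.toList_toFinset] at this

theorem evenAbsSum_rowsSet_le {s : ℕ → ℂ} {K : Finset ℂ} (hK : K.card ≤ 2 * n)
    (h : ∀ u ∈ K, ∀ x, 1 - s x * u ≠ 0) (L : ℕ) :
    evenAbsSum t n 1 s (L + 1) (rowsSet t s K) ≤ ∑ J ∈ K.powerset,
      ‖columnWeight t 1 (s 0) K J‖ *
        evenAbsSum t n 1 (fun x => s (x + 1)) L (rowsSet t (fun x => s (x + 1)) J) := by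
  have := evenAbsSum_rowsOp_le (t := t) (κ := 1) (n := n)
    (fun j h1 _ => one_sub_ofReal_pow_ne_zero ht0 ht1 h1) (s := s) K.nodup_toList
    (by simpa using h) (by simpa using hK) L
  rwa [← rowsSet_eq_rowsOp, Finset.toList_toFinset] at this

/-- A crude bound whose exponent is `m`, so that it can be distributed as one factor for each
element of `K \ J`. -/
theorem norm_evenWeight_le (s₀ : ℂ) (m : ℕ) :
    ‖evenWeight t 1 s₀ m‖ ≤ (2 * (1 + ‖s₀‖)) ^ m := by
  have hs := norm_nonneg s₀
  have h1 : ∀ k : ℕ, ‖(t : ℂ) ^ k‖ ≤ 1 := by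
    intro k
    rw [norm_pow, Complex.norm_real, Real.norm_of_nonneg ht0.le]
    exact pow_le_one₀ ht0.le ht1.le
  calc ‖evenWeight t 1 s₀ m‖ ≤ ∏ j ∈ Finset.range (m / 2), (2 * (1 + ‖s₀‖)) ^ 2 := by
        rw [evenWeight, norm_prod]
        refine Finset.prod_le_prod (fun _ _ => norm_nonneg _) fun j _ => ?_
        rw [norm_mul, one_mul, one_mul]
        have a1 : ‖1 - (t : ℂ) ^ (2 * j + 1)‖ ≤ 2 := by
          refine (norm_sub_le _ _).trans ?_
          rw [norm_one]
          linarith [h1 (2 * j + 1)]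
        have a2 : ‖1 - s₀ ^ 2 * (t : ℂ) ^ (2 * j)‖ ≤ 1 + ‖s₀‖ ^ 2 := by
          refine (norm_sub_le _ _).trans ?_
          rw [norm_one, norm_mul, norm_pow]
          have := mul_le_mul_of_nonneg_left (h1 (2 * j)) (sq_nonneg ‖s₀‖)
          linarith
        calc _ ≤ 2 * (1 + ‖s₀‖ ^ 2) := mul_le_mul a1 a2 (norm_nonneg _) two_pos.le
          _ ≤ _ := by nlinarith
    _ = (2 * (1 + ‖s₀‖)) ^ (2 * (m / 2)) := by
        rw [Finset.prod_const, Finset.card_range, pow_mul]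
    _ ≤ _ := pow_le_pow_right₀ (by linarith) (Nat.mul_div_le m 2)

include hq1 in
/-- The weights of the columns are bounded uniformly in the inhomogeneity. -/
theorem exists_bound_columnWeight {K : Finset ℂ} (hK : K ⊆ U) (J : Finset ℂ) (hJ : J ⊆ K) :
    ∃ B : ℝ, 0 ≤ B ∧ ∀ s : ℕ → ℂ, Admissible U q s → ‖columnWeight t 1 (s 0) K J‖ ≤ B := by
  refine ⟨(∏ x ∈ K \ J, 2 * (2 * (1 + ‖x‖) / ‖1 - x * x‖)) *
    ‖∏ i ∈ J, ∏ j ∈ K \ J, hopFactor t i j‖, by positivity, fun s hs => ?_⟩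
  rw [columnWeight]
  split_ifs with he
  swap
  · rw [norm_zero]
    positivity
  have e : evenWeight t 1 (s 0) (K \ J).card * (∏ x ∈ K, (1 - s 0 * x)⁻¹) *
      splitFactor t (1 * s 0) K J = (evenWeight t 1 (s 0) (K \ J).card *
        ∏ x ∈ K \ J, (1 - s 0 * x)⁻¹) * (∏ x ∈ J, (x - s 0) / (1 - s 0 * x)) *
        ∏ i ∈ J, ∏ j ∈ K \ J, hopFactor t i j := by
    rw [← Finset.prod_sdiff hJ, splitFactor, one_mul]
    simp only [div_eq_mul_inv, Finset.prod_mul_distrib]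
    ring
  rw [e, norm_mul, norm_mul]
  refine mul_le_mul_of_nonneg_right ?_ (norm_nonneg _)
  have h1 : ‖∏ x ∈ J, (x - s 0) / (1 - s 0 * x)‖ ≤ 1 := by
    rw [norm_prod]
    exact Finset.prod_le_one (fun _ _ => norm_nonneg _) fun x hx =>
      ((hs x (hK (hJ hx)) 0).2).trans hq1.le
  refine (mul_le_of_le_one_right (norm_nonneg _) h1).trans ?_
  rw [norm_mul, norm_prod]
  refine (mul_le_mul_of_nonneg_right (norm_evenWeight_le ht0 ht1 (s 0) _)
    (Finset.prod_nonneg fun _ _ => norm_nonneg _)).trans ?_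
  rw [← Finset.prod_const, ← Finset.prod_mul_distrib]
  refine Finset.prod_le_prod (fun _ _ => by positivity) fun x hx => ?_
  have hx' := hK (Finset.mem_sdiff.mp hx).1
  obtain ⟨h2, h3⟩ := hs x hx' 0
  have h4 := hs.one_sub_mul_ne_zero hq1 hx' hx'
  set v := (x - s 0) / (1 - s 0 * x) with hv
  have h4' : 1 - x ^ 2 ≠ 0 := fun e => h4 (by linear_combination e)
  -- The inhomogeneities need not be bounded. In terms of `v`, which has norm at most one, both `(1
  -- - s x)⁻¹` and `s (1 - s x)⁻¹` are bounded independently of `s`.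
  have h5 : (1 - s 0 * x)⁻¹ = (1 - x * v) / (1 - x * x) := by
    rw [hv]
    field_simp
    ring
  have h6 : s 0 * (1 - s 0 * x)⁻¹ = (x - v) / (1 - x * x) := by
    rw [hv]
    field_simp
    ring
  have hv1 : ‖v‖ ≤ 1 := h3.trans hq1.le
  have h7 : ‖(1 - s 0 * x)⁻¹‖ ≤ (1 + ‖x‖) / ‖1 - x * x‖ := by
    rw [h5, norm_div]
    refine div_le_div_of_nonneg_right ((norm_sub_le _ _).trans ?_) (norm_nonneg _)
    rw [norm_one, norm_mul]
    have := mul_le_mul_of_nonneg_left hv1 (norm_nonneg x)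
    linarith
  have h8 : ‖s 0‖ * ‖(1 - s 0 * x)⁻¹‖ ≤ (1 + ‖x‖) / ‖1 - x * x‖ := by
    rw [← norm_mul, h6, norm_div]
    refine div_le_div_of_nonneg_right ((norm_sub_le _ _).trans ?_) (norm_nonneg _)
    linarith
  calc 2 * (1 + ‖s 0‖) * ‖(1 - s 0 * x)⁻¹‖ =
      2 * (‖(1 - s 0 * x)⁻¹‖ + ‖s 0‖ * ‖(1 - s 0 * x)⁻¹‖) := by ring
    _ ≤ 2 * ((1 + ‖x‖) / ‖1 - x * x‖ + (1 + ‖x‖) / ‖1 - x * x‖) := by gcongr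
    _ = _ := by ring

omit ht0 ht1 in
include hq0 in
theorem norm_columnWeight_self_le {K : Finset ℂ} (hK : K ⊆ U) (hne : K.Nonempty) (hq1 : q < 1)
    {s : ℕ → ℂ} (hs : Admissible U q s) : ‖columnWeight t 1 (s 0) K K‖ ≤ q := by
  rw [columnWeight_self, norm_prod]
  obtain ⟨x, hx⟩ := hne
  rw [← Finset.mul_prod_erase _ _ hx]
  have h1 : ∀ y ∈ K, ‖(y - 1 * s 0) / (1 - s 0 * y)‖ ≤ q := fun y hy => by
    rw [one_mul]
    exact (hs y (hK hy) 0).2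
  calc _ ≤ q * 1 := mul_le_mul (h1 x hx) (Finset.prod_le_one (fun _ _ => norm_nonneg _)
        fun y hy => (h1 y (Finset.mem_of_mem_erase hy)).trans hq1.le)
        (Finset.prod_nonneg fun _ _ => norm_nonneg _) hq0
    _ = q := mul_one q

omit ht0 ht1 in
theorem rowsSet_nil (t : ℂ) (s : ℕ → ℂ) (K : Finset ℂ) :
    rowsSet t s K [] = if K = ∅ then 1 else 0 := by
  rcases K.eq_empty_or_nonempty with rfl | ⟨x, hx⟩
  · rw [if_pos rfl]
    rfl
  · rw [if_neg (Finset.ne_empty_of_mem hx), ← Finset.insert_erase hx,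
      rowsSet_insert t s (Finset.notMem_erase _ _)]
    rfl

include hn hq0 hq1

/-- By induction over subsets, the terms with `J ≠ K` contribute at most a constant `E`, while the
term `J = K` is multiplied by at most `q`; the inequality `a (L + 1) ≤ q a L + E` keeps the sums
below `1 + E / (1 - q)`. The bound is uniform in `s` because each column shifts the sequence. The
empty set, whose diagonal weight is `1`, is separate. -/
theorem exists_bound_evenAbsSum {K : Finset ℂ} (hK : K ⊆ U) : ∃ C : ℝ, 0 ≤ C ∧
    ∀ s : ℕ → ℂ, Admissible U q s → ∀ L, evenAbsSum t n 1 s L (rowsSet t s K) ≤ C := by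
  induction K using Finset.strongInduction with
  | H K ih =>
  have hKn : K.card ≤ 2 * n := (Finset.card_le_card hK).trans hn
  have hbase : ∀ s : ℕ → ℂ, evenAbsSum t n 1 s 0 (rowsSet t s K) ≤ 1 := by
    intro s
    rw [evenAbsSum, rowsSet_nil]
    split_ifs <;> simp
  rcases K.eq_empty_or_nonempty with rfl | hne
  · refine ⟨1, zero_le_one, fun s hs L => ?_⟩
    induction L generalizing s with
    | zero => exact hbase s
    | succ L ihL =>
      refine (evenAbsSum_rowsSet_le ht0 ht1 hKn (by simp) L).trans ?_
      rw [Finset.powerset_empty, Finset.sum_singleton, columnWeight_self, Finset.prod_empty,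
        norm_one, one_mul]
      exact ihL _ hs.shift
  have hsub : ∀ J ∈ K.powerset.erase K, J ⊂ K := fun J hJ =>
    lt_of_le_of_ne (Finset.mem_powerset.mp (Finset.mem_of_mem_erase hJ)) (Finset.ne_of_mem_erase hJ)
  have hJ : ∀ J : Finset ℂ, ∃ D : ℝ, 0 ≤ D ∧ (J ∈ K.powerset.erase K → ∀ s : ℕ → ℂ,
      Admissible U q s → ∀ L, ‖columnWeight t 1 (s 0) K J‖ *
        evenAbsSum t n 1 (fun x => s (x + 1)) L (rowsSet t (fun x => s (x + 1)) J) ≤ D) := by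
    intro J
    by_cases hJ : J ∈ K.powerset.erase K
    · obtain ⟨B, hB0, hB⟩ := exists_bound_columnWeight ht0 ht1 hq1 hK J (hsub J hJ).subset
      obtain ⟨C, hC0, hC⟩ := ih J (hsub J hJ) ((hsub J hJ).subset.trans hK)
      exact ⟨B * C, mul_nonneg hB0 hC0, fun _ s hs L => mul_le_mul (hB s hs)
        (hC _ hs.shift L) (evenAbsSum_nonneg _ _ _ _ _ _) hB0⟩
    · exact ⟨0, le_rfl, fun h => absurd h hJ⟩
  choose D hD0 hD using hJ
  set E := ∑ J ∈ K.powerset.erase K, D J with hE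
  have hE0 : 0 ≤ E := Finset.sum_nonneg fun J _ => hD0 J
  have hq : 0 < 1 - q := sub_pos.mpr hq1
  refine ⟨1 + E / (1 - q), by positivity, fun s hs L => ?_⟩
  induction L generalizing s with
  | zero => exact (hbase s).trans (le_add_of_nonneg_right (by positivity))
  | succ L ihL =>
    refine (evenAbsSum_rowsSet_le ht0 ht1 hKn (fun u hu x => (hs u (hK hu) x).1) L).trans ?_
    rw [← Finset.add_sum_erase _ _ (Finset.mem_powerset_self K)]
    have h1 := mul_le_mul (norm_columnWeight_self_le (t := t) hq0 hK hne hq1 hs) (ihL _ hs.shift)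
      (evenAbsSum_nonneg _ _ _ _ _ _) hq0
    have h2 := Finset.sum_le_sum fun J hJ => hD J hJ s hs L
    refine (add_le_add h1 h2).trans ?_
    rw [← hE]
    have : E / (1 - q) * (1 - q) = E := div_mul_cancel₀ _ hq.ne'
    nlinarith

end Convergence

/-- The matching sums with constant numerator are a fixed point of the recursion of the columns. -/
theorem sum_columnWeight_mul_matchingSum {t : ℂ} (ht0 : t ≠ 0) (ht1 : t ≠ 1) {κ : ℂ} (hκ : κ ≠ 0)
    (s₀ : ℂ) {K : Finset ℂ} (hK : Even K.card) (hgood : ∀ x ∈ K, ∀ y ∈ K, 1 - x * y ≠ 0) :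
    ∑ J ∈ K.powerset, columnWeight t κ s₀ K J * matchingSum t (fun _ _ => 1 - t) J =
      (∏ x ∈ K, (1 - s₀ * x)⁻¹) * matchingSum t (shiftedNumerator t κ s₀) K := by
  rw [← columnSum_eq_matchingSum ht0 ht1 hκ s₀ hK hgood, columnSum, Finset.mul_sum]
  refine Finset.sum_congr rfl fun J hJ => ?_
  rw [columnWeight]
  split_ifs with he
  · ring
  -- For even `K`, the sets `K \ J` and `J` are odd together: the term that `columnWeight` omits is
  -- absent from the column sum because the matching sum of `J` vanishes.
  · rw [matchingSum, pairSum_odd, zero_mul, mul_zero, mul_zero]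
    intro hJe
    refine he ?_
    rw [Finset.card_sdiff_of_subset (Finset.mem_powerset.mp hJ),
      Nat.even_sub (Finset.card_le_card (Finset.mem_powerset.mp hJ))]
    tauto

/-- For `p = 1` the numerator is `(1 - t) (1 - s x) (1 - s y)`, and `pairSum_mul` extracts the
factors `1 - s x`. -/
theorem prod_inv_mul_matchingSum_one (t : ℂ) (s₀ : ℂ) {K : Finset ℂ}
    (h : ∀ x ∈ K, 1 - s₀ * x ≠ 0) :
    (∏ x ∈ K, (1 - s₀ * x)⁻¹) * matchingSum t (shiftedNumerator t 1 s₀) K =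
      matchingSum t (fun _ _ => 1 - t) K := by
  have e := pairSum_mul (m := pairWeight fun _ _ => 1 - t) (c := crossFactor t)
    (m' := pairWeight (shiftedNumerator t 1 s₀)) (pairWeight_symm fun _ _ => rfl)
    (crossFactor_antisymm t) (pairWeight_symm (shiftedNumerator_symm t 1 s₀))
    (fun x => 1 - s₀ * x) K (fun x _ y _ _ => by
      simp only [pairWeight, shiftedNumerator]
      ring)
  rw [matchingSum, e, ← mul_assoc, ← Finset.prod_mul_distrib,
    Finset.prod_congr rfl fun x hx => inv_mul_cancel₀ (h x hx), Finset.prod_const_one, one_mul,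
    matchingSum]

section Convergence

variable {t : ℝ} (ht0 : 0 < t) (ht1 : t < 1) {n : ℕ} {U : Finset ℂ} (hn : U.card ≤ 2 * n) {q : ℝ}
  (hq0 : 0 ≤ q) (hq1 : q < 1)

include ht0 ht1 hn hq0 hq1

/-- Subtracting the fixed point turns the recursion into a homogeneous one for the errors. The
diagonal contracts by `q`, and the errors of proper subsets already decay like `r ^ L`; the gap `r -
q` absorbs them. -/
theorem exists_bound_evenSum_sub {r : ℝ} (hqr : q < r) {K : Finset ℂ} (hK : K ⊆ U)
    (heven : Even K.card) : ∃ C : ℝ, 0 ≤ C ∧ ∀ s : ℕ → ℂ, Admissible U q s → ∀ L,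
      ‖evenSum t n 1 s L (rowsSet t s K) - matchingSum t (fun _ _ => 1 - (t : ℂ)) K‖ ≤
        C * r ^ L := by
  have ht0' : (t : ℂ) ≠ 0 := by exact_mod_cast ht0.ne'
  have ht1' : (t : ℂ) ≠ 1 := by exact_mod_cast ht1.ne
  have hr0 : 0 ≤ r := hq0.trans hqr.le
  induction K using Finset.strongInduction with
  | H K ih =>
  have hKn : K.card ≤ 2 * n := (Finset.card_le_card hK).trans hn
  set M := fun J : Finset ℂ => matchingSum t (fun _ _ => 1 - (t : ℂ)) J with hM
  have hrec : ∀ s : ℕ → ℂ, Admissible U q s → ∀ L,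
      evenSum t n 1 s (L + 1) (rowsSet t s K) - M K = ∑ J ∈ K.powerset,
        columnWeight t 1 (s 0) K J *
          (evenSum t n 1 (fun x => s (x + 1)) L (rowsSet t (fun x => s (x + 1)) J) - M J) := by
    intro s hs L
    simp only [mul_sub, Finset.sum_sub_distrib, hM]
    rw [evenSum_rowsSet ht0 ht1 hKn (fun u hu x => (hs u (hK hu) x).1),
      sum_columnWeight_mul_matchingSum ht0' ht1' one_ne_zero (s 0) heven
        (fun x hx y hy => hs.one_sub_mul_ne_zero hq1 (hK hx) (hK hy)),
      prod_inv_mul_matchingSum_one _ _ (fun x hx => (hs x (hK hx) 0).1)]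
  rcases K.eq_empty_or_nonempty with rfl | hne
  · refine ⟨0, le_rfl, fun s hs L => ?_⟩
    rw [zero_mul]
    refine le_of_eq (norm_eq_zero.mpr ?_)
    induction L generalizing s with
    | zero => rw [evenSum, rowsSet_nil, if_pos rfl, matchingSum_empty, sub_self]
    | succ L ihL =>
      have := hrec s hs L
      rw [Finset.powerset_empty, Finset.sum_singleton] at this
      simp only [hM] at this
      rw [this, ihL _ hs.shift, mul_zero]
  have hsub : ∀ J ∈ K.powerset.erase K, J ⊂ K := fun J hJ =>
    lt_of_le_of_ne (Finset.mem_powerset.mp (Finset.mem_of_mem_erase hJ)) (Finset.ne_of_mem_erase hJ)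
  have hJ : ∀ J : Finset ℂ, ∃ D : ℝ, 0 ≤ D ∧ (J ∈ K.powerset.erase K → ∀ s : ℕ → ℂ,
      Admissible U q s → ∀ L, ‖columnWeight t 1 (s 0) K J *
        (evenSum t n 1 (fun x => s (x + 1)) L (rowsSet t (fun x => s (x + 1)) J) - M J)‖ ≤
          D * r ^ L) := by
    intro J
    by_cases hJ : J ∈ K.powerset.erase K
    · by_cases hev : Even (K \ J).card
      · have hJe : Even J.card := by
          rw [Finset.card_sdiff_of_subset (hsub J hJ).subset,
            Nat.even_sub (Finset.card_le_card (hsub J hJ).subset)] at hev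
          tauto
        obtain ⟨B, hB0, hB⟩ := exists_bound_columnWeight ht0 ht1 hq1 hK J (hsub J hJ).subset
        obtain ⟨C, hC0, hC⟩ := ih J (hsub J hJ) ((hsub J hJ).subset.trans hK) hJe
        refine ⟨B * C, mul_nonneg hB0 hC0, fun _ s hs L => ?_⟩
        rw [norm_mul, mul_assoc]
        exact mul_le_mul (hB s hs) (hC _ hs.shift L) (norm_nonneg _) hB0
      · refine ⟨0, le_rfl, fun _ s _ L => ?_⟩
        rw [columnWeight, if_neg hev, zero_mul, norm_zero, zero_mul]
    · exact ⟨0, le_rfl, fun h => absurd h hJ⟩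
  choose D hD0 hD using hJ
  set E := ∑ J ∈ K.powerset.erase K, D J with hE
  have hE0 : 0 ≤ E := Finset.sum_nonneg fun J _ => hD0 J
  have hrq : 0 < r - q := sub_pos.mpr hqr
  have hC0 : 0 ≤ ‖M K‖ + E / (r - q) := by positivity
  -- The first summand covers `L = 0`, where the error is `-M K`; the second gives `q C + E ≤ r C`.
  refine ⟨‖M K‖ + E / (r - q), hC0, fun s hs L => ?_⟩
  induction L generalizing s with
  | zero =>
    rw [evenSum, rowsSet_nil, if_neg hne.ne_empty, zero_sub, norm_neg, pow_zero, mul_one]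
    exact le_add_of_nonneg_right (by positivity)
  | succ L ihL =>
    have e := hrec s hs L
    simp only [hM] at e
    rw [e, ← Finset.add_sum_erase _ _ (Finset.mem_powerset_self K)]
    refine (norm_add_le _ _).trans ?_
    have h1 := mul_le_mul (norm_columnWeight_self_le (t := t) hq0 hK hne hq1 hs) (ihL _ hs.shift)
      (norm_nonneg _) hq0
    have h2 := (norm_sum_le _ _).trans (Finset.sum_le_sum fun J hJ => hD J hJ s hs L)
    rw [← Finset.sum_mul, ← hE] at h2
    rw [← norm_mul] at h1
    refine (add_le_add h1 h2).trans ?_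
    have h3 : E / (r - q) * (r - q) = E := div_mul_cancel₀ _ hrq.ne'
    have h4 : 0 ≤ ‖M K‖ * (r - q) := by positivity
    rw [pow_succ]
    calc _ = (q * (‖M K‖ + E / (r - q)) + E) * r ^ L := by ring
      _ ≤ ((‖M K‖ + E / (r - q)) * r) * r ^ L :=
        mul_le_mul_of_nonneg_right (by linarith) (pow_nonneg hr0 L)
      _ = _ := by ring

theorem tendsto_evenSum_rowsSet {K : Finset ℂ} (hK : K ⊆ U) (heven : Even K.card) {s : ℕ → ℂ}
    (hs : Admissible U q s) : Filter.Tendsto (fun L => evenSum t n 1 s L (rowsSet t s K))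
      Filter.atTop (nhds (matchingSum t (fun _ _ => 1 - (t : ℂ)) K)) := by
  obtain ⟨r, hqr, hr1⟩ := exists_between hq1
  obtain ⟨C, -, hC⟩ := exists_bound_evenSum_sub ht0 ht1 hn hq0 hq1 hqr hK heven
  rw [tendsto_iff_norm_sub_tendsto_zero]
  refine squeeze_zero (fun _ => norm_nonneg _) (fun L => hC s hs L) ?_
  simpa using (tendsto_pow_atTop_nhds_zero_of_lt_one (hq0.trans hqr.le) hr1).const_mul C

/-- The limit of the partial sums of the partition function. -/
theorem tendsto_evenSum_rowsOp {κ : ℂ} (hκ0 : κ ≠ 0)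
    (hκ : ∀ j, 1 ≤ j → j ≤ n → 1 - κ * (t : ℂ) ^ (2 * j) ≠ 0) {s : ℕ → ℂ} {us : List ℂ}
    (hus : us.Nodup) (hU : us.toFinset = U) (heven : Even U.card) (hs : Admissible U q s) :
    Filter.Tendsto (fun L => evenSum t n κ s L (rowsOp t κ s us)) Filter.atTop
      (nhds ((∏ x ∈ U, (1 - s 0 * x)⁻¹) * matchingSum t (shiftedNumerator t κ (s 0)) U)) := by
  subst hU
  have ht0' : (t : ℂ) ≠ 0 := by exact_mod_cast ht0.ne'
  have ht1' : (t : ℂ) ≠ 1 := by exact_mod_cast ht1.ne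
  -- The index is shifted by one to split off the first column, the only one with shift `κ`.
  rw [← Filter.tendsto_add_atTop_iff_nat 1, ← sum_columnWeight_mul_matchingSum ht0' ht1' hκ0 (s 0)
    heven (fun x hx y hy => hs.one_sub_mul_ne_zero hq1 hx hy)]
  have e := evenSum_rowsOp hκ hus (fun u hu x => (hs u (List.mem_toFinset.mpr hu) x).1) hn
  simp only [e]
  refine tendsto_finsetSum _ fun J hJ => ?_
  by_cases hev : Even (us.toFinset \ J).card
  · have hJU := Finset.mem_powerset.mp hJ
    have hJe : Even J.card := by
      rw [Finset.card_sdiff_of_subset hJU, Nat.even_sub (Finset.card_le_card hJU)] at hev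
      tauto
    exact (tendsto_evenSum_rowsSet ht0 ht1 hn hq0 hq1 hJU hJe hs.shift).const_mul _
  · simp only [columnWeight, if_neg hev, zero_mul]
    exact tendsto_const_nhds

theorem exists_bound_evenAbsSum_rowsOp {κ : ℂ}
    (hκ : ∀ j, 1 ≤ j → j ≤ n → 1 - κ * (t : ℂ) ^ (2 * j) ≠ 0) {s : ℕ → ℂ} {us : List ℂ}
    (hus : us.Nodup) (hU : us.toFinset = U) (hs : Admissible U q s) :
    ∃ C : ℝ, ∀ L, evenAbsSum t n κ s (L + 1) (rowsOp t κ s us) ≤ C := by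
  subst hU
  have hJ : ∀ J : Finset ℂ, ∃ C : ℝ, J ⊆ us.toFinset → ∀ s : ℕ → ℂ,
      Admissible us.toFinset q s → ∀ L, evenAbsSum t n 1 s L (rowsSet t s J) ≤ C := by
    intro J
    by_cases hJ : J ⊆ us.toFinset
    · obtain ⟨C, -, hC⟩ := exists_bound_evenAbsSum ht0 ht1 hn hq0 hq1 hJ
      exact ⟨C, fun _ => hC⟩
    · exact ⟨0, fun h => absurd h hJ⟩
  choose C hC using hJ
  refine ⟨∑ J ∈ us.toFinset.powerset, ‖columnWeight t κ (s 0) us.toFinset J‖ * C J, fun L => ?_⟩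
  refine (evenAbsSum_rowsOp_le hκ hus (fun u hu x => (hs u (List.mem_toFinset.mpr hu) x).1) hn
    L).trans (Finset.sum_le_sum fun J hJ => mul_le_mul_of_nonneg_left ?_ (norm_nonneg _))
  exact hC J (Finset.mem_powerset.mp hJ) _ hs.shift L

end Convergence

/-! ### Finitely supported states, lists and sets of horizontal edges -/

/-- The state with `g` paths in column `0`, followed by the state `ν`. -/
def consState (g : ℕ) (ν : ℕ →₀ ℕ) : ℕ →₀ ℕ :=
  Finsupp.single 0 g + ν.embDomain ⟨Nat.succ, Nat.succ_injective⟩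

@[simp]
theorem consState_zero (g : ℕ) (ν : ℕ →₀ ℕ) : consState g ν 0 = g := by
  rw [consState, Finsupp.add_apply, Finsupp.single_eq_same, Finsupp.embDomain_of_notMem_range]
  · rfl
  · rintro ⟨x, hx⟩
    exact Nat.succ_ne_zero x hx

@[simp]
theorem consState_succ (g : ℕ) (ν : ℕ →₀ ℕ) (x : ℕ) : consState g ν (x + 1) = ν x := by
  rw [consState, Finsupp.add_apply, Finsupp.single_eq_of_ne (Nat.succ_ne_zero x), zero_add]
  exact Finsupp.embDomain_apply_self ⟨Nat.succ, Nat.succ_injective⟩ ν x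

theorem consState_injective (g : ℕ) : Function.Injective (consState g) := by
  intro μ ν h
  ext x
  rw [← consState_succ g μ x, h, consState_succ]

theorem exists_eq_consState (μ : ℕ →₀ ℕ) : ∃ ν, μ = consState (μ 0) ν := by
  refine ⟨μ.comapDomain Nat.succ Nat.succ_injective.injOn, ?_⟩
  ext x
  rcases x with _ | x
  · rw [consState_zero]
  · rw [consState_succ]
    rfl

theorem consState_zero_zero : consState 0 0 = 0 := by
  ext x
  rcases x with _ | x
  · exact consState_zero 0 0
  · exact consState_succ 0 0 x

/-- The state with the occupation numbers of a list, followed by empty columns. -/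
def ofList : List ℕ → ℕ →₀ ℕ
  | [] => 0
  | g :: ν => consState g (ofList ν)

/-- The set of occupied horizontal edges obtained by inserting a first edge. -/
def consSet (b : Bool) (H : Finset ℕ) : Finset ℕ :=
  (if b then {0} else ∅) ∪ H.map ⟨Nat.succ, Nat.succ_injective⟩

theorem zero_mem_consSet (b : Bool) (H : Finset ℕ) : 0 ∈ consSet b H ↔ b := by
  cases b <;> simp [consSet]

theorem succ_mem_consSet (b : Bool) (H : Finset ℕ) (x : ℕ) : x + 1 ∈ consSet b H ↔ x ∈ H := by
  cases b <;> simp [consSet]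

theorem consSet_injective (b : Bool) : Function.Injective (consSet b) := by
  intro H K h
  ext x
  rw [← succ_mem_consSet b H, h, succ_mem_consSet]

theorem exists_eq_consSet (H : Finset ℕ) : ∃ K, H = consSet (decide (0 ∈ H)) K := by
  refine ⟨H.preimage Nat.succ Nat.succ_injective.injOn, ?_⟩
  ext x
  rcases x with _ | x
  · simp [zero_mem_consSet]
  · simp [succ_mem_consSet]

/-! ### The row transfer matrix as a row operator -/

/-- The product of the weights of a row with given horizontal edges. -/
def edgeWeight (t κ : ℂ) (s : ℕ → ℂ) (u : ℂ) (μ ν : ℕ →₀ ℕ) (H : Finset ℕ) : ℂ :=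
  ∏ᶠ x : ℕ, vertexWeight t (columnShift κ x) (s x) u
    (μ x) (decide (x ∈ H)) (ν x) (decide (x + 1 ∈ H))

/-- The matrix element of a row with left edge occupied according to `b`. -/
def partialRowWeight (t κ : ℂ) (b : Bool) (s : ℕ → ℂ) (u : ℂ) (μ ν : ℕ →₀ ℕ) : ℂ :=
  ∑ᶠ H : Finset ℕ, if decide (0 ∈ H) = b then edgeWeight t κ s u μ ν H else 0

theorem rowWeight_eq (t γ : ℂ) (s : ℕ → ℂ) (u : ℂ) (μ ν : ℕ →₀ ℕ) :
    rowWeight t γ s u μ ν = partialRowWeight t γ true s u μ ν := by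
  simp only [rowWeight, partialRowWeight, edgeWeight, decide_eq_true_eq]

theorem vertexWeight_ne_zero {t κ s u : ℂ} {i₁ i₂ : ℕ} {j₁ j₂ : Bool}
    (h : vertexWeight t κ s u i₁ j₁ i₂ j₂ ≠ 0) : i₁ + j₁.toNat = i₂ + j₂.toNat := by
  cases j₁ <;> cases j₂ <;> simp only [vertexWeight] at h <;>
    have := (ite_ne_right_iff.mp h).1 <;> simpa

theorem vertexWeight_empty {t s u : ℂ} (h : 1 - s * u ≠ 0) :
    vertexWeight t 1 s u 0 false 0 false = 1 := by
  simp only [vertexWeight, if_true, pow_zero, mul_one]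
  exact div_self h

theorem exists_apply_ne_zero {α : Type*} {f : α → ℂ} (h : ∑ᶠ x, f x ≠ 0) : ∃ x, f x ≠ 0 := by
  by_contra! hf
  exact h (finsum_eq_zero_of_forall_eq_zero hf)

section Rows

variable {t κ u : ℂ} {s : ℕ → ℂ}

/-- Far away from the occupied edges all the vertices are empty. -/
theorem exists_edgeWeight_eq_prod (h : ∀ x, 1 - s x * u ≠ 0) (μ ν : ℕ →₀ ℕ) (H : Finset ℕ) :
    ∃ N₀, ∀ N, N₀ ≤ N → edgeWeight t κ s u μ ν H = ∏ x ∈ Finset.range N,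
      vertexWeight t (columnShift κ x) (s x) u
        (μ x) (decide (x ∈ H)) (ν x) (decide (x + 1 ∈ H)) := by
  -- Inserting `0` keeps the shifted column inside the range: an empty vertex is known to have
  -- weight one only in an unshifted column.
  obtain ⟨N₀, hN₀⟩ := (insert 0 (μ.support ∪ ν.support ∪ H)).exists_nat_subset_range
  refine ⟨N₀, fun N hN => finprod_eq_prod_of_mulSupport_subset _ ?_⟩
  intro x hx
  by_contra hxN
  have hxN' : N ≤ x := by simpa using hxN
  have hlarge : ∀ y ∈ insert 0 (μ.support ∪ ν.support ∪ H), y < x := fun y hy =>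
    (Finset.mem_range.mp (hN₀ hy)).trans_le (hN.trans hxN')
  have hx0 : 0 < x := hlarge 0 (by simp)
  have h1 : μ x = 0 := by
    by_contra hne
    exact lt_irrefl x (hlarge x (by simp [hne]))
  have h2 : ν x = 0 := by
    by_contra hne
    exact lt_irrefl x (hlarge x (by simp [hne]))
  have h3 : x ∉ H := fun hH => lt_irrefl x (hlarge x (by simp [hH]))
  have h4 : x + 1 ∉ H := fun hH => absurd (hlarge (x + 1) (by simp [hH])) (by omega)
  refine hx ?_
  simp only [h1, h2, h3, h4, decide_false, columnShift, hx0.ne', if_false]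
  exact vertexWeight_empty (h x)

theorem edgeWeight_conservation (h : ∀ x, 1 - s x * u ≠ 0) {μ ν : ℕ →₀ ℕ} {H : Finset ℕ}
    (hH : edgeWeight t κ s u μ ν H ≠ 0) (x : ℕ) :
    μ x + (decide (x ∈ H)).toNat = ν x + (decide (x + 1 ∈ H)).toNat := by
  obtain ⟨N₀, hN₀⟩ := exists_edgeWeight_eq_prod (t := t) (κ := κ) h μ ν H
  rw [hN₀ (max N₀ (x + 1)) (le_max_left _ _)] at hH
  exact vertexWeight_ne_zero (Finset.prod_ne_zero_iff.mp hH x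
    (Finset.mem_range.mpr ((Nat.lt_succ_self x).trans_le (le_max_right _ _))))

/-- Conservation determines the horizontal edges from left to right, so at most one `H` contributes.
-/
theorem edgeWeight_support_finite (h : ∀ x, 1 - s x * u ≠ 0) (b : Bool) (μ ν : ℕ →₀ ℕ) :
    (Function.support fun H : Finset ℕ =>
      if decide (0 ∈ H) = b then edgeWeight t κ s u μ ν H else 0).Finite := by
  refine Set.Subsingleton.finite fun H hH K hK => ?_
  obtain ⟨h1, h2⟩ := ite_ne_right_iff.mp hH
  obtain ⟨h3, h4⟩ := ite_ne_right_iff.mp hK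
  ext x
  have key : decide (x ∈ H) = decide (x ∈ K) := by
    induction x with
    | zero => rw [h1, h3]
    | succ x ih =>
      have e1 := edgeWeight_conservation h h2 x
      have e2 := edgeWeight_conservation h h4 x
      rw [ih] at e1
      have e3 : (decide (x + 1 ∈ H)).toNat = (decide (x + 1 ∈ K)).toNat := by omega
      by_cases a : x + 1 ∈ H <;> by_cases c : x + 1 ∈ K <;> simp [a, c] at e3 ⊢
  simpa using key

theorem edgeWeight_cons (h : ∀ x, 1 - s x * u ≠ 0) (m g : ℕ) (μ ν : ℕ →₀ ℕ) (b : Bool)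
    (H : Finset ℕ) :
    edgeWeight t κ s u (consState m μ) (consState g ν) (consSet b H) =
      vertexWeight t κ (s 0) u m b g (decide (0 ∈ H)) *
        edgeWeight t 1 (fun x => s (x + 1)) u μ ν H := by
  obtain ⟨N₁, h1⟩ := exists_edgeWeight_eq_prod (t := t) (κ := κ) h (consState m μ)
    (consState g ν) (consSet b H)
  obtain ⟨N₂, h2⟩ := exists_edgeWeight_eq_prod (t := t) (κ := 1) (s := fun x => s (x + 1))
    (fun x => h (x + 1)) μ ν H
  rw [h1 (max N₁ N₂ + 1) (by omega), h2 (max N₁ N₂) (le_max_right _ _), Finset.prod_range_succ',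
    mul_comm]
  simp [columnShift, zero_mem_consSet, succ_mem_consSet]

theorem finsum_eq_finsum_comp {α β : Type*} {f : β → ℂ} {g : α → β} (hg : Function.Injective g)
    (hf : ∀ y, f y ≠ 0 → y ∈ Set.range g) : ∑ᶠ y, f y = ∑ᶠ x, f (g x) := by
  rw [← finsum_mem_range hg, ← finsum_mem_univ f]
  refine (finsum_mem_inter_support_eq f _ _ ?_)
  ext y
  simp only [Set.mem_inter_iff, Set.mem_univ, true_and, Function.mem_support]
  exact ⟨fun hy => ⟨hf y hy, hy⟩, fun hy => hy.2⟩

theorem partialRowWeight_cons (h : ∀ x, 1 - s x * u ≠ 0) (m g : ℕ) (μ ν : ℕ →₀ ℕ) (b : Bool) :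
    partialRowWeight t κ b s u (consState m μ) (consState g ν) =
      vertexWeight t κ (s 0) u m b g false *
          partialRowWeight t 1 false (fun x => s (x + 1)) u μ ν +
        vertexWeight t κ (s 0) u m b g true *
          partialRowWeight t 1 true (fun x => s (x + 1)) u μ ν := by
  have hs := fun x => h (x + 1)
  rw [partialRowWeight, finsum_eq_finsum_comp (consSet_injective b)]
  · simp only [edgeWeight_cons h]
    rw [partialRowWeight, partialRowWeight, mul_finsum, mul_finsum, ← finsum_add_distrib]
    · refine finsum_congr fun H => ?_
      rw [if_pos (by simp [zero_mem_consSet])]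
      by_cases h0 : 0 ∈ H <;> simp [h0]
    · exact (edgeWeight_support_finite hs _ _ _).subset (Function.support_mul_subset_right _ _)
    · exact (edgeWeight_support_finite hs _ _ _).subset (Function.support_mul_subset_right _ _)
  · intro H hH
    obtain ⟨K, hK⟩ := exists_eq_consSet H
    rw [(ite_ne_right_iff.mp hH).1] at hK
    exact ⟨K, hK.symm⟩

theorem exists_of_partialRowWeight_ne_zero (h : ∀ x, 1 - s x * u ≠ 0) {b : Bool} {μ ν : ℕ →₀ ℕ}
    (hne : partialRowWeight t κ b s u μ ν ≠ 0) : ∃ H : Finset ℕ, decide (0 ∈ H) = b ∧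
      ∀ x, μ x + (decide (x ∈ H)).toNat = ν x + (decide (x + 1 ∈ H)).toNat := by
  obtain ⟨H, hH⟩ := exists_apply_ne_zero hne
  obtain ⟨h1, h2⟩ := ite_ne_right_iff.mp hH
  exact ⟨H, h1, edgeWeight_conservation h h2⟩

theorem finset_eq_empty_of_succ_mem {H : Finset ℕ} (h : ∀ x ∈ H, x + 1 ∈ H) : H = ∅ := by
  rw [← Finset.not_nonempty_iff_eq_empty]
  intro hne
  have := H.le_max' _ (h _ (H.max'_mem hne))
  omega

/-- Without exits at the top, a path on a horizontal edge would occupy all later edges, which the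
finiteness of `H` forbids. -/
theorem partialRowWeight_zero_right (h : ∀ x, 1 - s x * u ≠ 0) {b : Bool} {μ : ℕ →₀ ℕ}
    (hne : partialRowWeight t κ b s u μ 0 ≠ 0) : b = false ∧ μ = 0 := by
  obtain ⟨H, rfl, hH⟩ := exists_of_partialRowWeight_ne_zero h hne
  have hH0 : H = ∅ := finset_eq_empty_of_succ_mem fun x hx => by
    have := hH x
    by_contra hx'
    simp [hx, hx'] at this
  subst hH0
  refine ⟨by simp, ?_⟩
  ext x
  simpa using hH x

theorem partialRowWeight_empty (h : ∀ x, 1 - s x * u ≠ 0) :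
    partialRowWeight t 1 false s u 0 0 = 1 := by
  rw [partialRowWeight, finsum_eq_single _ ∅]
  · rw [if_pos (by simp), edgeWeight]
    refine finprod_eq_one_of_forall_eq_one fun x => ?_
    simp only [columnShift, ite_self, Finsupp.coe_zero, Pi.zero_apply, Finset.notMem_empty,
      decide_false]
    exact vertexWeight_empty (h x)
  · intro H hH
    by_contra hne
    refine hH (finset_eq_empty_of_succ_mem fun x hx => ?_)
    have := edgeWeight_conservation h (ite_ne_right_iff.mp hne).2 x
    by_contra hx'
    simp [hx, hx'] at this

theorem partialRowWeight_support_finite (h : ∀ x, 1 - s x * u ≠ 0) (b : Bool) (ν : List ℕ) :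
    (Function.support fun μ => partialRowWeight t κ b s u μ (ofList ν)).Finite := by
  induction ν generalizing κ b s with
  | nil =>
    refine (Set.finite_singleton (0 : ℕ →₀ ℕ)).subset fun μ hμ => ?_
    exact (partialRowWeight_zero_right h hμ).2
  | cons g ν ih =>
    have hs := fun x => h (x + 1)
    have hfin := ((ih (κ := 1) hs false).union (ih (κ := 1) hs true))
    refine ((Set.finite_Iic (g + 1)).image2 consState hfin).subset fun μ hμ => ?_
    obtain ⟨μ', hμ'⟩ := exists_eq_consState μ
    have hμ2 : partialRowWeight t κ b s u μ (consState g (ofList ν)) ≠ 0 := hμ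
    rw [hμ', partialRowWeight_cons h] at hμ2
    refine ⟨μ 0, ?_, μ', ?_, hμ'.symm⟩
    · by_contra hlt
      have hv : ∀ b', vertexWeight t κ (s 0) u (μ 0) b g b' = 0 := by
        intro b'
        by_contra hne
        have e := vertexWeight_ne_zero hne
        have := Bool.toNat_le b'
        simp only [Set.mem_Iic] at hlt
        omega
      rw [hv, hv, zero_mul, zero_mul, add_zero] at hμ2
      exact hμ2 rfl
    · by_contra hnot
      simp only [Set.mem_union, Function.mem_support, not_or, not_not] at hnot
      rw [hnot.1, hnot.2, mul_zero, mul_zero, add_zero] at hμ2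
      exact hμ2 rfl

theorem finsum_vertexWeight_mul {φ ψ : (ℕ →₀ ℕ) → ℂ} {w : ℕ → ℂ} {m : ℕ}
    (hw : ∀ k, k ≠ m → w k = 0) {F : (ℕ →₀ ℕ) → ℂ}
    (hF : ∀ k μ, F (consState k μ) = φ (consState k μ) * (w k * ψ μ)) :
    ∑ᶠ μ, F μ = w m * ∑ᶠ μ, φ (consState m μ) * ψ μ := by
  rw [finsum_eq_finsum_comp (consState_injective m)]
  · rw [← smul_eq_mul, smul_finsum]
    refine finsum_congr fun μ => ?_
    rw [hF, smul_eq_mul]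
    ring
  · intro μ hμ
    obtain ⟨μ', hμ'⟩ := exists_eq_consState μ
    rw [hμ', hF] at hμ
    by_cases hm : μ 0 = m
    · exact ⟨μ', by rw [← hm, ← hμ']⟩
    · rw [hw _ hm, zero_mul, mul_zero] at hμ
      exact absurd rfl hμ

/-- The first column of a row. -/
theorem finsum_mul_partialRowWeight_cons (h : ∀ x, 1 - s x * u ≠ 0) (φ : (ℕ →₀ ℕ) → ℂ) (b : Bool)
    (g : ℕ) (ν : List ℕ) {m₀ m₁ : ℕ} (hm₀ : ∀ k, k ≠ m₀ → vertexWeight t κ (s 0) u k b g false = 0)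
    (hm₁ : ∀ k, k ≠ m₁ → vertexWeight t κ (s 0) u k b g true = 0) :
    ∑ᶠ μ, φ μ * partialRowWeight t κ b s u μ (ofList (g :: ν)) =
      vertexWeight t κ (s 0) u m₀ b g false * ∑ᶠ μ, φ (consState m₀ μ) *
          partialRowWeight t 1 false (fun x => s (x + 1)) u μ (ofList ν) +
        vertexWeight t κ (s 0) u m₁ b g true * ∑ᶠ μ, φ (consState m₁ μ) *
          partialRowWeight t 1 true (fun x => s (x + 1)) u μ (ofList ν) := by
  have hs := fun x => h (x + 1)
  -- A chosen tail lets the two contributions be defined as functions of the whole state, so that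
  -- the sum can be split before it is reindexed.
  set tl : (ℕ →₀ ℕ) → ℕ →₀ ℕ := fun μ => (exists_eq_consState μ).choose with htl
  have htl' : ∀ k μ, tl (consState k μ) = μ := by
    intro k μ
    have e := (exists_eq_consState (consState k μ)).choose_spec
    refine (consState_injective k (e.trans ?_)).symm
    exact congrArg (fun j => consState j _) (consState_zero k μ)
  set F : Bool → (ℕ →₀ ℕ) → ℂ := fun b' μ => φ μ * (vertexWeight t κ (s 0) u (μ 0) b g b' *
    partialRowWeight t 1 b' (fun x => s (x + 1)) u (tl μ) (ofList ν)) with hF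
  have hF' : ∀ b' k μ, F b' (consState k μ) = φ (consState k μ) *
      (vertexWeight t κ (s 0) u k b g b' *
        partialRowWeight t 1 b' (fun x => s (x + 1)) u μ (ofList ν)) := by
    intro b' k μ
    simp only [hF, htl', consState_zero]
  have hfin : ∀ b', (Function.support (F b')).Finite := by
    intro b'
    refine ((Set.finite_Iic (g + 1)).image2 consState
      (partialRowWeight_support_finite (t := t) (κ := 1) hs b' ν)).subset fun μ hμ => ?_
    obtain ⟨μ', hμ'⟩ := exists_eq_consState μ
    have hμ2 : F b' μ ≠ 0 := hμ
    rw [hμ', hF'] at hμ2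
    have h1 := right_ne_zero_of_mul hμ2
    refine ⟨μ 0, ?_, μ', right_ne_zero_of_mul h1, hμ'.symm⟩
    have := vertexWeight_ne_zero (left_ne_zero_of_mul h1)
    have := Bool.toNat_le b'
    simp only [Set.mem_Iic]
    omega
  rw [← finsum_vertexWeight_mul hm₀ (hF' false), ← finsum_vertexWeight_mul hm₁ (hF' true),
    ← finsum_add_distrib (hfin false) (hfin true)]
  refine finsum_congr fun μ => ?_
  obtain ⟨μ', hμ'⟩ := exists_eq_consState μ
  rw [hμ', hF', hF', ofList, partialRowWeight_cons h]
  ring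

theorem finsum_mul_partialRowWeight_step (h : ∀ x, 1 - s x * u ≠ 0) (φ : (ℕ →₀ ℕ) → ℂ) (b : Bool)
    (g : ℕ) (ν : List ℕ)
    (ih : ∀ (φ : (ℕ →₀ ℕ) → ℂ) (b : Bool), ∑ᶠ μ, φ μ *
      partialRowWeight t 1 b (fun x => s (x + 1)) u μ (ofList ν) =
        rowOp t 1 b (fun x => s (x + 1)) u (fun l => φ (ofList l)) ν) :
    ∑ᶠ μ, φ μ * partialRowWeight t κ b s u μ (ofList (g :: ν)) =
      rowOp t κ b s u (fun l => φ (ofList l)) (g :: ν) := by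
  cases b with
  | false =>
    rw [finsum_mul_partialRowWeight_cons h φ false g ν (m₀ := g) (m₁ := g + 1)
      (fun k hk => if_neg hk) (fun k hk => if_neg hk), ih fun μ => φ (consState g μ),
      ih fun μ => φ (consState (g + 1) μ)]
    simp only [vertexWeight, if_true, rowOp]
    rfl
  | true =>
    -- For `g = 0` the truncated `g - 1` is harmless: the weight of this vertex vanishes for every
    -- occupation below it.
    rw [finsum_mul_partialRowWeight_cons h φ true g ν (m₀ := g - 1) (m₁ := g)
      (fun k hk => if_neg (by omega)) (fun k hk => if_neg hk), ih fun μ => φ (consState g μ),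
      ih fun μ => φ (consState (g - 1) μ)]
    simp only [vertexWeight, if_true, rowOp]
    rw [add_comm]
    congr 2
    rcases g with _ | g
    · simp
    · simp

theorem finsum_mul_partialRowWeight (h : ∀ x, 1 - s x * u ≠ 0) (φ : (ℕ →₀ ℕ) → ℂ) (b : Bool)
    (ν : List ℕ) : ∑ᶠ μ, φ μ * partialRowWeight t 1 b s u μ (ofList ν) =
      rowOp t 1 b s u (fun l => φ (ofList l)) ν := by
  induction ν generalizing s φ b with
  | nil =>
    rw [finsum_eq_single _ 0]
    · cases b with
      | false =>
        rw [ofList, partialRowWeight_empty h, mul_one]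
        rfl
      | true =>
        have : partialRowWeight t 1 true s u 0 (ofList []) = 0 := by
          by_contra hne
          exact absurd (partialRowWeight_zero_right h hne).1 (by simp)
        rw [this, mul_zero]
        rfl
    · intro μ hμ
      by_contra hne
      exact hμ (partialRowWeight_zero_right h (right_ne_zero_of_mul hne)).2
  | cons g ν ih =>
    exact finsum_mul_partialRowWeight_step h φ b g ν fun φ b => ih (fun x => h (x + 1)) φ b

/-- The row transfer matrix acts as `rowOp`. -/
theorem finsum_mul_rowWeight (h : ∀ x, 1 - s x * u ≠ 0) (φ : (ℕ →₀ ℕ) → ℂ) (ν : List ℕ) :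
    ∑ᶠ μ, φ μ * rowWeight t κ s u μ (ofList ν) =
      rowOp t κ true s u (fun l => φ (ofList l)) ν := by
  simp only [rowWeight_eq]
  rcases ν with _ | ⟨g, ν⟩
  · have : ∀ μ, partialRowWeight t κ true s u μ (ofList []) = 0 := by
      intro μ
      by_contra hne
      exact absurd (partialRowWeight_zero_right h hne).1 (by simp)
    simp only [this, mul_zero, finsum_zero]
    rfl
  · exact finsum_mul_partialRowWeight_step h φ true g ν fun φ b =>
      finsum_mul_partialRowWeight (fun x => h (x + 1)) φ b ν

end Rows

theorem ofList_eq_zero_iff (ν : List ℕ) : (if ofList ν = 0 then 1 else 0) = emptyState ν := by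
  induction ν with
  | nil => simp [ofList, emptyState]
  | cons g ν ih =>
    rw [emptyState, ← ih, ofList]
    by_cases hg : g = 0
    · subst hg
      rw [if_pos rfl]
      refine if_congr ⟨fun e => ?_, fun e => ?_⟩ rfl rfl
      · exact consState_injective 0 (e.trans consState_zero_zero.symm)
      · rw [e, consState_zero_zero]
    · rw [if_neg hg, if_neg]
      intro e
      have := DFunLike.congr_fun e 0
      rw [consState_zero] at this
      exact hg this

/-- The list is reversed because the head of the list in `rowsOp` is the top row, which carries the
last parameter. -/
theorem latticeF_ofList {t γ : ℂ} {s : ℕ → ℂ} {N : ℕ} {u : Fin N → ℂ}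
    (h : ∀ i x, 1 - s x * u i ≠ 0) (ν : List ℕ) :
    latticeF t γ s N u (ofList ν) = rowsOp t γ s (List.ofFn u).reverse ν := by
  induction N generalizing ν with
  | zero => simpa [latticeF, rowsOp] using ofList_eq_zero_iff ν
  | succ N ih =>
    rw [latticeF, finsum_mul_rowWeight (h _), List.ofFn_succ', List.concat_eq_append,
      List.reverse_append]
    have e := funext fun l => ih (fun i x => h i.castSucc x) l
    rw [e]
    rfl

/-- Conservation summed over the columns before `M` telescopes: the path that enters on the left has
either left through the top or contributes to the flow through edge `M`, which is empty for large
`M`. -/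
theorem rowWeight_degree {t κ u : ℂ} {s : ℕ → ℂ} (h : ∀ x, 1 - s x * u ≠ 0) {μ ν : ℕ →₀ ℕ}
    (hne : rowWeight t κ s u μ ν ≠ 0) : ν.degree = μ.degree + 1 := by
  rw [rowWeight_eq] at hne
  obtain ⟨H, h0, hH⟩ := exists_of_partialRowWeight_ne_zero h hne
  obtain ⟨N, hN⟩ := (μ.support ∪ ν.support ∪ H).exists_nat_subset_range
  have hdeg : ∀ ρ : ℕ →₀ ℕ, ρ.support ⊆ Finset.range N → ρ.degree = ∑ x ∈ Finset.range N, ρ x := by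
    intro ρ hρ
    rw [Finsupp.degree_apply]
    exact Finset.sum_subset hρ fun x _ hx => by simpa using hx
  have key : ∀ M, ∑ x ∈ Finset.range M, μ x + 1 =
      ∑ x ∈ Finset.range M, ν x + (decide (M ∈ H)).toNat := by
    intro M
    induction M with
    | zero => simp [h0]
    | succ M ih =>
      rw [Finset.sum_range_succ, Finset.sum_range_succ]
      have := hH M
      omega
  have hNH : N ∉ H := fun hm => absurd (Finset.mem_range.mp (hN (by simp [hm]))) (lt_irrefl N)
  have hk := key N
  simp only [hNH, decide_false, Bool.toNat_false, add_zero] at hk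
  rw [hdeg μ fun x hx => hN (by simp [Finsupp.mem_support_iff.mp hx]),
    hdeg ν fun x hx => hN (by simp [Finsupp.mem_support_iff.mp hx])]
  exact hk.symm

theorem latticeF_degree {t γ : ℂ} {s : ℕ → ℂ} {N : ℕ} {u : Fin N → ℂ}
    (h : ∀ i x, 1 - s x * u i ≠ 0) {ν : ℕ →₀ ℕ} (hne : latticeF t γ s N u ν ≠ 0) :
    ν.degree = N := by
  induction N generalizing ν with
  | zero =>
    rw [(ite_ne_right_iff.mp hne).1]
    exact map_zero _
  | succ N ih =>
    obtain ⟨μ, hμ⟩ := exists_apply_ne_zero hne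
    rw [rowWeight_degree (h _) (right_ne_zero_of_mul hμ),
      ih (fun i x => h i.castSucc x) (left_ne_zero_of_mul hμ)]

/-! ### Summation over signatures -/

/-- A series is summed by the partial sums over finite sets that eventually contain every index of a
nonzero term, provided that these are absolutely bounded. -/
theorem hasSum_of_tendsto_sum {ι : Type*} {F : ι → ℂ} {B : ℕ → Finset ι} {C : ℝ} {a : ℂ}
    (hC : ∀ᶠ L in Filter.atTop, ∑ i ∈ B L, ‖F i‖ ≤ C)
    (hB : ∀ i, F i ≠ 0 → ∀ᶠ L in Filter.atTop, i ∈ B L)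
    (ha : Filter.Tendsto (fun L => ∑ i ∈ B L, F i) Filter.atTop (nhds a)) : HasSum F a := by
  classical
  have hs : Summable fun i => ‖F i‖ := by
    refine summable_of_sum_le (c := C) (fun _ => norm_nonneg _) fun A => ?_
    -- The sets `B L` need not increase; each finite `A` lies, up to zero terms, in some `B L` for
    -- which the bound holds.
    have h1 : ∀ᶠ L in Filter.atTop, ∀ i ∈ A, F i ≠ 0 → i ∈ B L := by
      rw [Filter.eventually_all_finset]
      intro i _
      by_cases hi : F i = 0
      · exact Filter.Eventually.of_forall fun L h => absurd hi h
      · exact (hB i hi).mono fun L h _ => h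
    obtain ⟨L, h2, h3⟩ := (h1.and hC).exists
    refine le_trans ?_ h3
    rw [← Finset.sum_filter_ne_zero]
    refine Finset.sum_le_sum_of_subset_of_nonneg (fun i hi => ?_) fun _ _ _ => norm_nonneg _
    rw [Finset.mem_filter] at hi
    exact h2 i hi.1 (norm_ne_zero_iff.mp hi.2)
  have hs' : Summable F := hs.of_norm
  have key : Filter.Tendsto (fun L => ∑' i, if i ∈ B L then F i else 0) Filter.atTop
      (nhds (∑' i, F i)) := by
    refine tendsto_tsum_of_dominated_convergence hs (fun i => ?_)
      (Filter.Eventually.of_forall fun L i => ?_)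
    · refine tendsto_const_nhds.congr' ?_
      by_cases hi : F i = 0
      · exact Filter.Eventually.of_forall fun L => by simp [hi]
      · exact (hB i hi).mono fun L h => (if_pos h).symm
    · split_ifs
      · exact le_rfl
      · rw [norm_zero]
        exact norm_nonneg _
  have e : (fun L => ∑' i, if i ∈ B L then F i else 0) = fun L => ∑ i ∈ B L, F i := by
    funext L
    rw [tsum_eq_sum (s := B L) fun i hi => if_neg hi]
    exact Finset.sum_congr rfl fun i hi => if_pos hi
  rw [e] at key
  exact tendsto_nhds_unique key ha ▸ hs'.hasSum

/-- The coefficient of a state with even multiplicities. -/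
def stateCoeff (t κ : ℂ) (s : ℕ → ℂ) (m : ℕ →₀ ℕ) : ℂ :=
  m.prod fun x k => columnCoeff t (columnShift κ x) (s x) (k / 2)

theorem columnCoeff_zero (t κ s₀ : ℂ) : columnCoeff t κ s₀ (0 / 2) = 1 := by
  simp [columnCoeff]

theorem evenCoeff_eq (t : ℝ) (α : ℂ) (s : ℕ → ℂ) (m : ℕ →₀ ℕ) :
    evenCoeff t α s m = stateCoeff t ((t : ℂ) ^ α) s m := by
  have h1 : ∏ i ∈ m.support.erase 0, columnCoeff t (columnShift ((t : ℂ) ^ α) i) (s i) (m i / 2) =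
      ∏ i ∈ m.support.erase 0, ∏ j ∈ Finset.Icc 1 (m i / 2),
        (1 - s i ^ 2 * (t : ℂ) ^ (2 * j - 2)) / (1 - (t : ℂ) ^ (2 * j)) := by
    refine Finset.prod_congr rfl fun i hi => ?_
    rw [columnShift, if_neg (Finset.ne_of_mem_erase hi), columnCoeff]
    simp only [mul_one, one_mul]
  rw [evenCoeff, ← h1, stateCoeff, Finsupp.prod]
  by_cases h0 : 0 ∈ m.support
  · rw [← Finset.mul_prod_erase _ _ h0]
    rfl
  · rw [Finset.erase_eq_of_notMem h0, Finsupp.notMem_support_iff.mp h0]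
    simp

theorem stateCoeff_cons (t κ : ℂ) (s : ℕ → ℂ) (g : ℕ) (m : ℕ →₀ ℕ) :
    stateCoeff t κ s (consState g m) =
      columnCoeff t κ (s 0) (g / 2) * stateCoeff t 1 (fun x => s (x + 1)) m := by
  obtain ⟨N, hN⟩ := m.support.exists_nat_subset_range
  have hN' : (consState g m).support ⊆ Finset.range (N + 1) := by
    intro x hx
    rw [Finset.mem_range]
    rcases x with _ | x
    · omega
    · rw [Finsupp.mem_support_iff, consState_succ] at hx
      have := Finset.mem_range.mp (hN (Finsupp.mem_support_iff.mpr hx))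
      omega
  rw [stateCoeff, stateCoeff,
    Finsupp.prod_of_support_subset _ hN' (fun x k => columnCoeff t (columnShift κ x) (s x) (k / 2))
      fun x _ => columnCoeff_zero _ _ _,
    Finsupp.prod_of_support_subset _ hN
      (fun x k => columnCoeff t (columnShift 1 x) (s (x + 1)) (k / 2))
      fun x _ => columnCoeff_zero _ _ _, Finset.prod_range_succ', mul_comm]
  simp [columnShift]

/-- The states supported in the first `L` columns with even occupation numbers at most `2 n`. -/
def evenBox (n : ℕ) : ℕ → Finset (ℕ →₀ ℕ)
  | 0 => {0}
  | L + 1 => (Finset.range (n + 1) ×ˢ evenBox n L).image fun p => consState (2 * p.1) p.2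

theorem even_of_mem_evenBox {n L : ℕ} {m : ℕ →₀ ℕ} (h : m ∈ evenBox n L) (x : ℕ) :
    Even (m x) := by
  induction L generalizing m x with
  | zero =>
    rw [Finset.mem_singleton.mp h]
    simp
  | succ L ih =>
    rw [evenBox, Finset.mem_image] at h
    obtain ⟨p, hp, rfl⟩ := h
    rcases x with _ | x
    · simp
    · rw [consState_succ]
      exact ih (Finset.mem_product.mp hp).2 x

theorem mem_evenBox {n L : ℕ} {m : ℕ →₀ ℕ} (he : ∀ x, Even (m x)) (hn : ∀ x, m x ≤ 2 * n)
    (hL : ∀ x, L ≤ x → m x = 0) : m ∈ evenBox n L := by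
  induction L generalizing m with
  | zero =>
    refine Finset.mem_singleton.mpr (Finsupp.ext fun x => hL x (Nat.zero_le x))
  | succ L ih =>
    obtain ⟨m', hm'⟩ := exists_eq_consState m
    have hx : ∀ x, m' x = m (x + 1) := fun x => by rw [hm', consState_succ]
    obtain ⟨k, hk⟩ := he 0
    rw [← two_mul] at hk
    rw [evenBox, Finset.mem_image]
    refine ⟨(k, m'), Finset.mem_product.mpr ⟨Finset.mem_range.mpr ?_, ih ?_ ?_ ?_⟩, ?_⟩
    · have := hn 0
      omega
    · intro x
      rw [hx]
      exact he _
    · intro x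
      rw [hx]
      exact hn _
    · intro x hxL
      rw [hx]
      exact hL _ (by omega)
    · rw [hm', consState_zero] at hk
      rw [hm', hk]

theorem consState_two_mul_injective :
    Function.Injective fun p : ℕ × (ℕ →₀ ℕ) => consState (2 * p.1) p.2 := by
  rintro ⟨k, m⟩ ⟨k', m'⟩ h
  have h0 : 2 * k = 2 * k' := by
    have := DFunLike.congr_fun h 0
    simpa only [consState_zero] using this
  obtain rfl : k = k' := by omega
  exact congrArg (Prod.mk k) (consState_injective _ h)

theorem sum_evenBox (t κ : ℂ) (s : ℕ → ℂ) (n L : ℕ) (φ : (ℕ →₀ ℕ) → ℂ) :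
    ∑ m ∈ evenBox n L, stateCoeff t κ s m * φ m =
      evenSum t n κ s L fun l => φ (ofList l) := by
  induction L generalizing κ s φ with
  | zero => simp [evenBox, evenSum, stateCoeff, ofList]
  | succ L ih =>
    rw [evenBox, Finset.sum_image consState_two_mul_injective.injOn, Finset.sum_product, evenSum]
    refine Finset.sum_congr rfl fun k _ => ?_
    have e := ih 1 (fun x => s (x + 1)) (fun m => φ (consState (2 * k) m))
    simp only [ofList, ← e, Finset.mul_sum]
    refine Finset.sum_congr rfl fun m _ => ?_
    rw [stateCoeff_cons, Nat.mul_div_cancel_left k two_pos, mul_assoc]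

theorem sum_norm_evenBox (t κ : ℂ) (s : ℕ → ℂ) (n L : ℕ) (φ : (ℕ →₀ ℕ) → ℂ) :
    ∑ m ∈ evenBox n L, ‖stateCoeff t κ s m * φ m‖ =
      evenAbsSum t n κ s L fun l => φ (ofList l) := by
  induction L generalizing κ s φ with
  | zero => simp [evenBox, evenAbsSum, stateCoeff, ofList]
  | succ L ih =>
    rw [evenBox, Finset.sum_image consState_two_mul_injective.injOn, Finset.sum_product, evenAbsSum]
    refine Finset.sum_congr rfl fun k _ => ?_
    have e := ih 1 (fun x => s (x + 1)) (fun m => φ (consState (2 * k) m))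
    simp only [ofList, ← e, Finset.mul_sum]
    refine Finset.sum_congr rfl fun m _ => ?_
    rw [stateCoeff_cons, Nat.mul_div_cancel_left k two_pos, mul_assoc, norm_mul]

theorem mult_toMultiset {N : ℕ} (l : Fin N → ℕ) :
    Finsupp.toMultiset (mult l) = (List.ofFn l : Multiset ℕ) := by
  have h : ∀ S : Finset (Fin N), ∑ k ∈ S, ({l k} : Multiset ℕ) = S.val.map l := by
    intro S
    have e := Multiset.sum_map_singleton (S.val.map l)
    rwa [Multiset.map_map] at e
  rw [mult, map_sum, List.ofFn_eq_map, ← Multiset.map_coe]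
  simp only [Finsupp.toMultiset_single, one_nsmul, h]
  rfl

theorem mult_injective {N : ℕ} {l l' : Fin N → ℕ} (hl : Antitone l) (hl' : Antitone l')
    (h : mult l = mult l') : l = l' := by
  have e := mult_toMultiset l
  rw [h, mult_toMultiset, Multiset.coe_eq_coe] at e
  exact List.ofFn_injective (e.symm.eq_of_sortedGE hl.sortedGE_ofFn hl'.sortedGE_ofFn)

theorem exists_mult_eq {N : ℕ} {m : ℕ →₀ ℕ} (hm : m.degree = N) :
    ∃ l : Fin N → ℕ, Antitone l ∧ mult l = m := by
  set ls := (Finsupp.toMultiset m).sort (· ≥ ·) with hls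
  obtain rfl : N = ls.length := by
    rw [hls, Multiset.length_sort, Finsupp.card_toMultiset, ← hm, Finsupp.degree_apply]
    rfl
  refine ⟨ls.get, ?_, Multiset.toFinsupp.symm.injective ?_⟩
  · rw [← List.sortedGE_ofFn_iff, List.ofFn_get]
    exact (Multiset.pairwise_sort _ _).sortedGE
  · exact (mult_toMultiset _).trans (by rw [List.ofFn_get, hls, Multiset.sort_eq]; rfl)

open Classical in
theorem hasSum_partitionTerm {n : ℕ} {t : ℝ} (ht0 : 0 < t) (ht1 : t < 1) {α : ℂ}
    (hα : ∀ j : ℕ, 1 ≤ j → j ≤ n → 1 - (t : ℂ) ^ α * (t : ℂ) ^ (2 * j) ≠ 0)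
    {s : ℕ → ℂ} {u : Fin (2 * n) ↪ ℂ} {q : ℝ} (hq0 : 0 ≤ q) (hq1 : q < 1)
    (hs : Admissible (Finset.univ.map u) q s) :
    HasSum (partitionTerm t α s u) ((∏ x ∈ Finset.univ.map u, (1 - s 0 * x)⁻¹) *
      matchingSum t (shiftedNumerator t ((t : ℂ) ^ α) (s 0)) (Finset.univ.map u)) := by
  set γ := (t : ℂ) ^ α with hγ
  have hsu : ∀ i x, 1 - s x * u i ≠ 0 := fun i x =>
    (hs (u i) (Finset.mem_map_of_mem u (Finset.mem_univ i)) x).1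
  have hγ0 : γ ≠ 0 := by
    rw [hγ, Complex.cpow_ne_zero_iff]
    exact Or.inl (by exact_mod_cast ht0.ne')
  have hcard : (Finset.univ.map u).card = 2 * n := by
    rw [Finset.card_map, Finset.card_univ, Fintype.card_fin]
  set us := (List.ofFn u).reverse with hus
  have hnd : us.Nodup := List.nodup_reverse.mpr (List.nodup_ofFn.mpr u.injective)
  have hU : us.toFinset = Finset.univ.map u := by
    ext x
    simp [hus, List.mem_ofFn]
  set F : (ℕ →₀ ℕ) → ℂ := fun m => if ∀ x, Even (m x) then
    stateCoeff t γ s m * latticeF t γ s (2 * n) u m else 0 with hF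
  have hinj : Function.Injective fun l : EvenSignature (2 * n) => mult l.1 := fun l l' h =>
    Subtype.ext (mult_injective l.2.1 l'.2.1 h)
  have hcomp : partitionTerm t α s u = F ∘ fun l : EvenSignature (2 * n) => mult l.1 := by
    funext l
    simp only [hF, Function.comp, partitionTerm, refinedF, evenCoeff_eq]
    rw [if_pos l.2.2]
  have hdeg : ∀ m, F m ≠ 0 → (∀ x, Even (m x)) ∧ m.degree = 2 * n := by
    intro m hm
    obtain ⟨h1, h2⟩ := ite_ne_right_iff.mp hm
    exact ⟨h1, latticeF_degree hsu (right_ne_zero_of_mul h2)⟩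
  -- The series over signatures becomes one over all states: a nonzero term has even multiplicities
  -- and degree `2 n`, hence comes from a signature.
  rw [hcomp, hinj.hasSum_iff]
  swap
  · intro m hm
    by_contra hne
    obtain ⟨h1, h2⟩ := hdeg m hne
    obtain ⟨l, hl, rfl⟩ := exists_mult_eq h2
    exact hm ⟨⟨l, hl, h1⟩, rfl⟩
  have hbox : ∀ L, ∀ m ∈ evenBox n L, F m = stateCoeff t γ s m * latticeF t γ s (2 * n) u m :=
    fun L m hm => if_pos (even_of_mem_evenBox hm)
  have hlat : (fun l => latticeF t γ s (2 * n) u (ofList l)) = rowsOp t γ s us :=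
    funext fun l => latticeF_ofList hsu l
  obtain ⟨C, hC⟩ := exists_bound_evenAbsSum_rowsOp ht0 ht1 hcard.le hq0 hq1 hα hnd hU hs
  refine hasSum_of_tendsto_sum (B := evenBox n) (C := C) ?_ (fun m hm => ?_) ?_
  · filter_upwards [Filter.eventually_ge_atTop 1] with L hL
    obtain ⟨L, rfl⟩ := Nat.exists_eq_add_of_le' hL
    rw [Finset.sum_congr rfl fun m hm => congrArg norm (hbox _ m hm), sum_norm_evenBox, hlat]
    exact hC L
  · obtain ⟨h1, h2⟩ := hdeg m hm
    obtain ⟨N, hN⟩ := m.support.exists_nat_subset_range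
    filter_upwards [Filter.eventually_ge_atTop N] with L hL
    -- The cutoff `2 n` of the boxes loses nothing, since no column can hold more than all `2 n`
    -- paths.
    refine mem_evenBox h1 (fun x => h2 ▸ Finsupp.le_degree x m) fun x hx => ?_
    by_contra hne
    have := Finset.mem_range.mp (hN (Finsupp.mem_support_iff.mpr hne))
    omega
  · have e : (fun L => ∑ m ∈ evenBox n L, F m) =
        fun L => evenSum t n γ s L (rowsOp t γ s us) := by
      funext L
      rw [Finset.sum_congr rfl (hbox L), sum_evenBox, hlat]
    rw [e]
    exact tendsto_evenSum_rowsOp ht0 ht1 hcard.le hq0 hq1 hγ0 hα hnd hU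
      (by rw [hcard]; exact even_two_mul n) hs

theorem Z₂_eq (t : ℝ) (α s₀ x y : ℂ) :
    Z₂ t α s₀ x y = shiftedNumerator t ((t : ℂ) ^ α) s₀ x y := by
  rw [Z₂, shiftedNumerator]
  ring

end SpinHL

end

theorem theorem2 (n : ℕ) (t : ℝ) (ht0 : 0 < t) (ht1 : t < 1) (α : ℂ)
    (hα : ∀ j : ℕ, 1 ≤ j → j ≤ n → (t : ℂ) ^ α * (t : ℂ) ^ (2 * j) ≠ 1)
    (s : ℕ → ℂ) (u : Fin (2 * n) → ℂ)
    (hsu : ∀ (i : Fin (2 * n)) (x : ℕ), 1 - s x * u i ≠ 0)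
    (hadm : ∃ ε : ℝ, 0 < ε ∧
      ∀ (i : Fin (2 * n)) (x : ℕ), ‖(u i - s x) / (1 - s x * u i)‖ ≤ 1 - ε)
    (hu : Function.Injective u)
    (htu : ∀ i j : Fin (2 * n), i < j → 1 - (t : ℂ) * u i * u j ≠ 0) :
    Summable (SpinHL.partitionTerm t α s u) ∧
    SpinHL.partitionP t α s u =
      (∏ j : Fin (2 * n), 1 / (1 - s 0 * u j)) *
      (∏ i : Fin (2 * n), ∏ j ∈ Finset.Ioi i, (1 - (t : ℂ) * u i * u j) / (u i - u j)) *
      SpinHL.pfaffian (n := n) (Matrix.of fun i j =>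
        SpinHL.Z₂ t α (s 0) (u i) (u j) * (u i - u j) /
          ((1 - u i * u j) * (1 - (t : ℂ) * u i * u j))) := by
  obtain ⟨ε, hε, hadm⟩ := hadm
  -- For `n = 0` the bound does not force `1 - ε` to be nonnegative, hence the maximum with `0`.
  have hs : SpinHL.Admissible (Finset.univ.map ⟨u, hu⟩) (max 0 (1 - ε)) s := by
    intro v hv x
    obtain ⟨i, -, rfl⟩ := Finset.mem_map.mp hv
    exact ⟨hsu i x, (hadm i x).trans (le_max_right _ _)⟩
  have hsum := SpinHL.hasSum_partitionTerm ht0 ht1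
    (fun j h1 h2 => sub_ne_zero.mpr (hα j h1 h2).symm) (u := ⟨u, hu⟩) (le_max_left _ _)
    (max_lt one_pos (by linarith)) hs
  refine ⟨hsum.summable, hsum.tsum_eq.trans ?_⟩
  rw [mul_assoc, Finset.prod_map]
  congr 1
  · simp only [one_div, Function.Embedding.coeFn_mk]
  have hpf := SpinHL.pairProd_mul_pfaffian n (fun i j =>
    SpinHL.Z₂ t α (s 0) (u i) (u j) * (u i - u j) /
      ((1 - u i * u j) * (1 - (t : ℂ) * u i * u j))) (fun i j => SpinHL.crossFactor t (u i) (u j))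
    (fun i j => SpinHL.crossFactor_antisymm t (u i) (u j))
  refine Eq.trans ?_ hpf.symm
  have hsym := SpinHL.pairWeight_symm (SpinHL.shiftedNumerator_symm t ((t : ℂ) ^ α) (s 0))
  -- The matching sum over parameter values becomes one over indices, by injectivity of `u`. The
  -- Pfaffian entry times the cross factor is then the pair weight, as `1 - t u_i u_j` and `u_i -
  -- u_j` cancel off the diagonal.
  rw [SpinHL.matchingSum, ← SpinHL.pairSum_map hsym (SpinHL.crossFactor_antisymm (t : ℂ))]
  refine (SpinHL.pairSum_congr (fun i j => hsym (u i) (u j))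
    (fun i j => SpinHL.crossFactor_antisymm t (u i) (u j)) (fun i j => ?_) Finset.univ
    (fun i _ j _ hij => ?_)).symm
  · rw [SpinHL.crossFactor_antisymm t (u i), SpinHL.Z₂_eq, SpinHL.Z₂_eq,
      SpinHL.shiftedNumerator_symm t _ _ (u i), mul_comm (u i) (u j), mul_right_comm _ (u i)]
    ring
  · have h1 : u i - u j ≠ 0 := sub_ne_zero.mpr (hu.ne hij)
    have h2 : 1 - (t : ℂ) * u i * u j ≠ 0 := by
      rcases lt_or_gt_of_ne hij with h | h
      · exact htu i j h
      · have := htu j i h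
        rwa [mul_right_comm] at this
    rw [SpinHL.Z₂_eq, SpinHL.crossFactor, SpinHL.pairWeight, div_mul_div_comm,
      mul_assoc, mul_assoc (1 - u i * u j), mul_comm (u i - u j),
      mul_div_mul_right _ _ (mul_ne_zero h2 h1)]
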